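/- **Theorem 5 (Sharp estimates for the Jacobi–Riesz kernel).** For $\alpha,\beta>-1/2$ let $P_n^{(\alpha,\beta)}$ be the Jacobi polynomials, $$P_n^{(\alpha,\beta)}(x)=(1-x)^{-\alpha}(1+x)^{-\beta}\frac{(-1)^n}{2^nn!}\Big(\frac{d}{dx}\Big)^n\big\{(1-x)^{n+\alpha}(1+x)^{n+\beta}\big\},\quad x\in(-1,1),$$ let $$\mathcal P_n^{(\alpha,\beta)}(\theta)=\Big(\tfrac{(2n+\alpha+\beta+1)\Gamma(n+1)\Gamma(n+\alpha+\beta+1)}{\Gamma(n+\alpha+1)\Gamma(n+\beta+1)}\Big)^{1/2}P_n^{(\alpha,\beta)}(\cos\theta),\quad \theta\in(0,\pi),$$ which are orthonormal with respect to $d\mu_{\alpha,\beta}(\theta)=(\sin\frac\theta2)^{2\alpha+1}(\cos\frac\theta2)^{2\beta+1}\,d\theta$ on $(0,\pi)$, and define the Jacobi–Poisson kernel and the Jacobi–Riesz kernel by $$P_t^{\alpha,\beta}(\theta,\varphi)=\sum_{n=0}^\infty e^{-t|n+\frac{\alpha+\beta+1}2|}\,\mathcal P_n^{(\alpha,\beta)}(\theta)\,\mathcal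 P_n^{(\alpha,\beta)}(\varphi),\ t>0,\qquad \mathcal K^{\alpha,\beta}(\theta,\varphi)=\int_0^\infty\partial_\theta P_t^{\alpha,\beta}(\theta,\varphi)\,dt,\quad \theta\ne\varphi .$$ Let $\alpha,\beta>-1/2$, let $a\ge1$, let $b=0$ or $b\ge1$, and for $j\in\mathbb N_0=\{0,1,2,\dots\}$ put $u_j(\theta)=(\sin\frac\theta2)^{aj}(\cos\frac\theta2)^{bj}$. Then, for every $j\in\mathbb N_0$, the kernel $\mathcal K^{\alpha+aj,\beta+bj}(\theta,\varphi)$ is well defined for $\theta\neq\varphi$ in $(0,\pi)$ (the series converges, its sum is differentiable in $\theta$, and the $\theta$-derivative is integrable in $t$ over $(0,\infty)$), the function $u_j(\theta)u_j(\varphi)\mathcal K^{\alpha+aj,\beta+bj}(\theta,\varphi)$ is differentiable off the diagonal of $(0,\pi)\times(0,\pi)$, and there are constants $C_1$ and $C_2$, depending only on $\alpha,\beta,a,b$ and not on $j$, such that for all $j\in\mathbb N_0$ and all $\theta,\varphi\in(0,\pi)$ with $\theta\ne\varphi$ $$\big|u_j(\theta)u_j(\varphi)\mathcal K^{\alpha+aj,\beta+bj}(\theta,\varphi)\big|\le\frac{C_1}{\mu_{\alpha,\beta}(B(\theta,|\theta-\varphi|))},$$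 $$\big|\nabla_{\theta,\varphi}\big(u_j(\theta)u_j(\varphi)\mathcal K^{\alpha+aj,\beta+bj}(\theta,\varphi)\big)\big|\le\frac{C_2}{|\theta-\varphi|\,\mu_{\alpha,\beta}(B(\theta,|\theta-\varphi|))},$$ where $\mu_{\alpha,\beta}(B(\theta,|\theta-\varphi|))$ is the $\mu_{\alpha,\beta}$-measure of the part in $(0,\pi)$ of the open interval with center $\theta$ and radius $|\theta-\varphi|$. -/

import Mathlib

open Set MeasureTheory

noncomputable section

/-- The Jacobi polynomial `P_n^{(α,β)}(x)`, `-1 < x < 1`, by Rodrigues' formula. -/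
def jacobiP (α β : ℝ) (n : ℕ) (x : ℝ) : ℝ :=
  (1 - x) ^ (-α) * (1 + x) ^ (-β) * ((-1) ^ n / (2 ^ n * (n.factorial : ℝ))) *
    iteratedDeriv n (fun y : ℝ => (1 - y) ^ ((n : ℝ) + α) * (1 + y) ^ ((n : ℝ) + β)) x

/-- The constant `d_n^{α,β}` that normalizes `P_n^{(α,β)}(cos θ)` in `L²(dμ_{α,β})`. -/
def jacobiNormConst (α β : ℝ) (n : ℕ) : ℝ :=
  Real.sqrt ((2 * n + α + β + 1) * Real.Gamma (n + 1) * Real.Gamma (n + α + β + 1) /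
    (Real.Gamma (n + α + 1) * Real.Gamma (n + β + 1)))

/-- The normalized Jacobi trigonometric polynomial `d_n^{α,β} P_n^{(α,β)}(cos θ)`. -/
def jacobiTrig (α β : ℝ) (n : ℕ) (θ : ℝ) : ℝ :=
  jacobiNormConst α β n * jacobiP α β n (Real.cos θ)

/-- The measure `dμ_{α,β}(θ) = (sin (θ/2))^{2α+1} (cos (θ/2))^{2β+1} dθ` on `(0, π)`, as a measure
on `ℝ` that is carried by `(0, π)`. -/
def jacobiMeasure (α β : ℝ) : Measure ℝ :=
  (volume.restrict (Ioo 0 Real.pi)).withDensity fun θ =>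
    ENNReal.ofReal (Real.sin (θ / 2) ^ (2 * α + 1) * Real.cos (θ / 2) ^ (2 * β + 1))

/-- The `n`-th term of the series of the Jacobi-Poisson kernel. -/
def jacobiPoissonTerm (α β t θ φ : ℝ) (n : ℕ) : ℝ :=
  Real.exp (-t * |(n : ℝ) + (α + β + 1) / 2|) * jacobiTrig α β n θ * jacobiTrig α β n φ

/-- The Jacobi-Poisson kernel: the integral kernel, with respect to `dμ_{α,β}`, of the semigroup
generated by minus the square root of the Jacobi operator. -/
def jacobiPoissonKernel (α β t θ φ : ℝ) : ℝ :=
  ∑' n : ℕ, jacobiPoissonTerm α β t θ φ n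

/-- The Jacobi-Riesz kernel `K^{α,β}(θ,φ) = ∫₀^∞ ∂_θ P_t^{α,β}(θ,φ) dt`. -/
def jacobiRieszKernel (α β θ φ : ℝ) : ℝ :=
  ∫ t in Ioi (0 : ℝ), deriv (fun s => jacobiPoissonKernel α β t s φ) θ

/-- `u_j(θ) = (sin (θ/2))^{aj} (cos (θ/2))^{bj}`. -/
def uWeight (a b : ℝ) (j : ℕ) (θ : ℝ) : ℝ :=
  Real.sin (θ / 2) ^ (a * j) * Real.cos (θ / 2) ^ (b * j)

/-- The conjugated kernel `u_j(θ) u_j(φ) K^{α+aj,β+bj}(θ,φ)`. -/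
def conjRieszKernel (α β a b : ℝ) (j : ℕ) (θ φ : ℝ) : ℝ :=
  uWeight a b j θ * uWeight a b j φ * jacobiRieszKernel (α + a * j) (β + b * j) θ φ

/-- The Euclidean length of the gradient of `F(θ,φ)` in both variables (meaningful where `F` is
differentiable). -/
def gradLength (F : ℝ → ℝ → ℝ) (θ φ : ℝ) : ℝ :=
  Real.sqrt (deriv (fun s => F s φ) θ ^ 2 + deriv (fun s => F θ s) φ ^ 2)

end

/-! Write d = |θ - φ|, X = sin(θ/2) sin(φ/2), Y = cos(θ/2) cos(φ/2), D = 1 - cos((θ - φ)/2), N = aj,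
M = bj, s = α + 1/2, s' = β + 1/2 and e = N + M + s + s' + 1. The proof makes the kernel explicit as
a double integral and then bounds that integral with every Gamma factor kept, so that nothing is
lost as j grows.

Explicit kernel. Bailey's formula (`bailey_product`) turns the product of two Jacobi polynomials
into a finite sum of homogeneous expressions in X² and Y². These are, up to constants, the even
moments of uX + vY when u and v carry the weights (1 - u²)^(a - 1/2) and (1 - v²)^(b - 1/2). Summing
the Poisson series in z = e^(-t/2), first for small z and then on [0, 1) by analytic continuation
(`hasSum_poissonCoeff`), gives a closed integral formula. The integration in t is elementary, and
`jacobiRieszKernel_eq` writes the Riesz kernel as a constant times the integral of ∂_θ q · q^(-(a +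
b + 2)), where q = 1 - uX - vY = D + X(1 - u) + Y(1 - v).

Uniform bounds. With the weights u_j included, the constant in front becomes c₀ · X^N / (2^N Γ(N +
s)) · Y^M / (2^M Γ(M + s')) · Γ(e), with c₀ independent of j (`poissonConst_mul_uWeight`). The
factor Γ(e) is used up in writing Γ(e) q^(-e) as a Gamma integral over τ. This separates u from v
and leaves two one-variable Laplace transforms at τX and τY (`Gamma_mul_integral_ultraProd`). Each
of the other two factors is matched to one of these transforms. The decisive point is
`exists_ultraLaplace_le`: for large N the density contains (1 + u)^(N + s - 1), which is 2^(N + s -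
1) times an exponentially small function of N(1 - u). Hence powers of 1/(1 - u) can be traded for
powers of 1/N, with the sharp factor 2^N Γ(N + s) preserved.

Assembly. `exists_laplaceBounds` lists the resulting bounds, normalized so that the τ-integral
always produces a pure power D^(-δ), and D is at least d²/20. The factor |∂_θ q| is O(√D + √X (1 -
u) + √Y (1 - v)), so one such factor costs D^(-1/2), that is 1/d. A second derivative of the form,
or the logarithmic derivative of u_j, costs another 1/d. In the latter the dangerous factor N /
sin(θ/2) is controlled by N/√X or by N D/(dX); here it matters that N and M are 0 or at least 1
(`exists_majorant_le`). Finally the measure of the ball is at most a constant times d (X + D)^s (Y +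
D)^s' (`jacobiMeasure_ball_pos_and_le`), and this is the weight carried through all the bounds. -/

/-! ### Gamma quotients and the binomial series. -/

/-- `Γ(x + a) ≤ x ^ a Γ(x)` for `0 ≤ a ≤ 1`. -/
theorem Gamma_add_le_rpow_mul {x a : ℝ} (hx : 0 < x) (ha : 0 ≤ a) (ha1 : a ≤ 1) :
    Real.Gamma (x + a) ≤ x ^ a * Real.Gamma x := by
  have hG := Real.Gamma_pos_of_pos hx
  rcases ha.eq_or_lt with rfl | ha0
  · simp
  rcases ha1.eq_or_lt with rfl | ha2
  · rw [Real.Gamma_add_one hx.ne']; simp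
  have h := Real.Gamma_mul_add_mul_le_rpow_Gamma_mul_rpow_Gamma hx (by linarith : 0 < x + 1)
    (sub_pos.2 ha2) ha0 (by ring)
  rw [Real.Gamma_add_one hx.ne', Real.mul_rpow hx.le hG.le] at h
  calc Real.Gamma (x + a) = Real.Gamma ((1 - a) * x + a * (x + 1)) := by ring_nf
    _ ≤ _ := h
    _ = x ^ a * (Real.Gamma x ^ (1 - a) * Real.Gamma x ^ a) := by ring
    _ = _ := by rw [← Real.rpow_add hG]; simp

/-- The fractional part of r is handled by log-convexity and the integer part by the functional
equation. Using 1 + x in place of x keeps the constant uniform down to x = 0. -/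
theorem exists_Gamma_add_le {r : ℝ} (hr : 0 ≤ r) :
    ∃ C : ℝ, 0 < C ∧ ∀ x : ℝ, 0 < x →
      Real.Gamma (x + r) ≤ C * (1 + x) ^ r * Real.Gamma x := by
  have key : ∀ n : ℕ, ∀ a : ℝ, 0 ≤ a → a ≤ 1 → ∃ C : ℝ, 0 < C ∧ ∀ x : ℝ, 0 < x →
      Real.Gamma (x + (a + n)) ≤ C * (1 + x) ^ (a + n) * Real.Gamma x := by
    intro n a ha ha1
    induction n with
    | zero =>
      refine ⟨1, one_pos, fun x hx => ?_⟩
      simp only [Nat.cast_zero, add_zero, one_mul]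
      refine (Gamma_add_le_rpow_mul hx ha ha1).trans ?_
      have := (Real.Gamma_pos_of_pos hx).le
      gcongr
      linarith
    | succ n ih =>
      obtain ⟨C, hC, h⟩ := ih
      refine ⟨(1 + (a + n)) * C, by positivity, fun x hx => ?_⟩
      have hpos : 0 < x + (a + n) := by positivity
      have e : x + (a + ((n + 1 : ℕ) : ℝ)) = (x + (a + n)) + 1 := by push_cast; ring
      have e2 : a + ((n + 1 : ℕ) : ℝ) = (a + n) + 1 := by push_cast; ring
      rw [e, Real.Gamma_add_one hpos.ne', e2, Real.rpow_add (by linarith), Real.rpow_one]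
      have h1 : x + (a + n) ≤ (1 + (a + n)) * (1 + x) := by
        nlinarith [mul_nonneg hx.le (by positivity : 0 ≤ a + (n : ℝ))]
      calc (x + (a + n)) * Real.Gamma (x + (a + n))
          ≤ ((1 + (a + n)) * (1 + x)) * (C * (1 + x) ^ (a + n) * Real.Gamma x) :=
            mul_le_mul h1 (h x hx) (Real.Gamma_pos_of_pos hpos).le (by positivity)
        _ = _ := by ring
  obtain ⟨C, hC, h⟩ := key ⌊r⌋₊ (r - ⌊r⌋₊) (sub_nonneg.2 (Nat.floor_le hr))
    (by linarith [Nat.lt_floor_add_one r])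
  exact ⟨C, hC, by simpa using h⟩

/-- For an increment a in [0, 1], log-convexity is applied at x + a with increment 1 - a, which
lands on Γ(x + 1) = x Γ(x). The lower bound κ is needed to compare 1 + x with x, since Γ(x) blows up
at 0. -/
theorem exists_le_Gamma_add {r κ : ℝ} (hr : 0 ≤ r) (hκ : 0 < κ) :
    ∃ C : ℝ, 0 < C ∧ ∀ x : ℝ, κ ≤ x →
      (1 + x) ^ r * Real.Gamma x ≤ C * Real.Gamma (x + r) := by
  have key : ∀ n : ℕ, ∀ a : ℝ, 0 ≤ a → a ≤ 1 → ∃ C : ℝ, 0 < C ∧ ∀ x : ℝ, κ ≤ x →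
      (1 + x) ^ (a + n) * Real.Gamma x ≤ C * Real.Gamma (x + (a + n)) := by
    intro n a ha ha1
    have hk : ∀ x : ℝ, κ ≤ x → 1 + x ≤ (1 + 1 / κ) * x := by
      intro x hx
      have : 1 ≤ 1 / κ * x := by rw [one_div, inv_mul_eq_div]; exact (one_le_div hκ).2 hx
      linarith
    induction n with
    | zero =>
      refine ⟨1 + 1 / κ, by positivity, fun x hx => ?_⟩
      have hx0 : 0 < x := hκ.trans_le hx
      simp only [Nat.cast_zero, add_zero]
      have h1 := Gamma_add_le_rpow_mul (by linarith : 0 < x + a) (sub_nonneg.2 ha1)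
        (by linarith : 1 - a ≤ 1)
      have hG := Real.Gamma_pos_of_pos hx0
      have hG' := Real.Gamma_pos_of_pos (by linarith : 0 < x + a)
      rw [show x + a + (1 - a) = x + 1 by ring, Real.Gamma_add_one hx0.ne'] at h1
      have h2 : (x + a) ^ (1 - a) ≤ (1 + x) ^ (1 - a) :=
        Real.rpow_le_rpow (by linarith) (by linarith) (by linarith)
      have h3 : x * Real.Gamma x ≤ (1 + x) ^ (1 - a) * Real.Gamma (x + a) :=
        h1.trans (mul_le_mul_of_nonneg_right h2 hG'.le)
      have h4 : (1 + x) ^ a * (1 + x) ^ (1 - a) = 1 + x := by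
        rw [← Real.rpow_add (by linarith)]; simp
      have h5 : (1 + x) ^ a * Real.Gamma x * x ≤ (1 + 1 / κ) * Real.Gamma (x + a) * x := by
        calc (1 + x) ^ a * Real.Gamma x * x = (1 + x) ^ a * (x * Real.Gamma x) := by ring
          _ ≤ (1 + x) ^ a * ((1 + x) ^ (1 - a) * Real.Gamma (x + a)) := by gcongr
          _ = (1 + x) * Real.Gamma (x + a) := by rw [← mul_assoc, h4]
          _ ≤ ((1 + 1 / κ) * x) * Real.Gamma (x + a) := by gcongr; exact hk x hx
          _ = _ := by ring
      exact le_of_mul_le_mul_right h5 hx0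
    | succ n ih =>
      obtain ⟨C, hC, h⟩ := ih
      refine ⟨(1 + 1 / κ) * C, by positivity, fun x hx => ?_⟩
      have hx0 : 0 < x := hκ.trans_le hx
      have hpos : 0 < x + (a + n) := by positivity
      have e : x + (a + ((n + 1 : ℕ) : ℝ)) = (x + (a + n)) + 1 := by push_cast; ring
      have e2 : a + ((n + 1 : ℕ) : ℝ) = (a + n) + 1 := by push_cast; ring
      rw [e, Real.Gamma_add_one hpos.ne', e2, Real.rpow_add (by linarith), Real.rpow_one]
      have hG' := Real.Gamma_pos_of_pos hpos
      calc (1 + x) ^ (a + n) * (1 + x) * Real.Gamma x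
          = (1 + x) * ((1 + x) ^ (a + n) * Real.Gamma x) := by ring
        _ ≤ ((1 + 1 / κ) * (x + (a + n))) * (C * Real.Gamma (x + (a + n))) := by
            refine mul_le_mul ((hk x hx).trans ?_) (h x hx) ?_ (by positivity)
            · gcongr
              have : 0 ≤ a + (n : ℝ) := by positivity
              linarith
            · have := Real.Gamma_pos_of_pos hx0
              positivity
        _ = _ := by ring
  obtain ⟨C, hC, h⟩ := key ⌊r⌋₊ (r - ⌊r⌋₊) (sub_nonneg.2 (Nat.floor_le hr))
    (by linarith [Nat.lt_floor_add_one r])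
  exact ⟨C, hC, by simpa using h⟩

/-- A uniform bound for quotients of Gamma functions. -/
theorem exists_Gamma_ratio_le (p q : ℝ) {κ : ℝ} (hκ : 0 < κ) :
    ∃ C : ℝ, 0 < C ∧ ∀ N : ℝ, 0 ≤ N → κ ≤ N + p → κ ≤ N + q →
      Real.Gamma (N + p) ≤ C * (1 + N) ^ (p - q) * Real.Gamma (N + q) := by
  -- The Gamma bounds come with powers of 1 + N + q. They are converted to powers of 1 + N at the
  -- price of (1 + |q|)^|r|, for either sign of r.
  have comp : ∀ q r : ℝ, ∃ C : ℝ, 0 < C ∧ ∀ N : ℝ, 0 ≤ N → κ ≤ N + q →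
      (1 + (N + q)) ^ r ≤ C * (1 + N) ^ r := by
    intro q r
    refine ⟨(1 + |q|) ^ |r|, by positivity, fun N hN hNq => ?_⟩
    have hq := abs_nonneg q
    rcases le_or_gt 0 r with hr | hr
    · rw [abs_of_nonneg hr, ← Real.mul_rpow (by positivity) (by positivity)]
      refine Real.rpow_le_rpow (by linarith) ?_ hr
      nlinarith [le_abs_self q]
    · rw [abs_of_neg hr]
      have h1 : 1 + N ≤ (1 + |q|) * (1 + (N + q)) := by
        nlinarith [neg_abs_le q, mul_nonneg hq (by linarith : 0 ≤ N + q)]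
      have h2 := Real.rpow_le_rpow_of_nonpos (by linarith) h1 hr.le
      rw [Real.mul_rpow (by positivity) (by linarith)] at h2
      have h3 : 0 < (1 + |q|) ^ r := by positivity
      rw [Real.rpow_neg (by positivity), inv_mul_eq_div, le_div_iff₀ h3]
      linarith
  rcases le_total q p with h | h
  · obtain ⟨C, hC, h1⟩ := exists_Gamma_add_le (sub_nonneg.2 h)
    obtain ⟨C', hC', h2⟩ := comp q (p - q)
    refine ⟨C * C', by positivity, fun N hN hp hq => ?_⟩
    have hG := Real.Gamma_pos_of_pos (hκ.trans_le hq)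
    calc Real.Gamma (N + p) = Real.Gamma (N + q + (p - q)) := by ring_nf
      _ ≤ C * (1 + (N + q)) ^ (p - q) * Real.Gamma (N + q) := h1 _ (hκ.trans_le hq)
      _ ≤ C * (C' * (1 + N) ^ (p - q)) * Real.Gamma (N + q) := by
          gcongr; exact h2 N hN hq
      _ = _ := by ring
  · obtain ⟨C, hC, h1⟩ := exists_le_Gamma_add (sub_nonneg.2 h) hκ
    obtain ⟨C', hC', h2⟩ := comp p (p - q)
    refine ⟨C * C', by positivity, fun N hN hp hq => ?_⟩
    have hG := Real.Gamma_pos_of_pos (hκ.trans_le hq)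
    have hx : 0 < 1 + (N + p) := by linarith
    have h3 := h1 _ hp
    rw [show N + p + (q - p) = N + q by ring] at h3
    have h4 : (1 + (N + p)) ^ (p - q) * (1 + (N + p)) ^ (q - p) = 1 := by
      rw [← Real.rpow_add hx]; simp
    calc Real.Gamma (N + p)
        = (1 + (N + p)) ^ (p - q) * ((1 + (N + p)) ^ (q - p) * Real.Gamma (N + p)) := by
          rw [← mul_assoc, h4, one_mul]
      _ ≤ (C' * (1 + N) ^ (p - q)) * (C * Real.Gamma (N + q)) := by
          refine mul_le_mul (h2 N hN hp) h3 ?_ (by positivity)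
          have := Real.Gamma_pos_of_pos (hκ.trans_le hp)
          positivity
      _ = _ := by ring

theorem Gamma_add_natCast_eq {c : ℝ} (hc : 0 < c) (n : ℕ) :
    Real.Gamma (c + n) = (ascPochhammer ℝ n).eval c * Real.Gamma c := by
  induction n with
  | zero => simp
  | succ n ih =>
    rw [ascPochhammer_succ_eval, Nat.cast_succ, ← add_assoc,
      Real.Gamma_add_one (by positivity), ih]
    ring

theorem ringChoose_mul_Gamma {c : ℝ} (hc : 0 < c) (n : ℕ) :
    Ring.choose (c + n - 1) n * Real.Gamma c = Real.Gamma (c + n) / n.factorial := by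
  rw [Gamma_add_natCast_eq hc, Ring.choose_eq_smul,
    Polynomial.descPochhammer_smeval_eq_ascPochhammer,
    Polynomial.ascPochhammer_smeval_cast, Polynomial.ascPochhammer_smeval_eq_eval,
    show c + n - 1 - n + 1 = c by ring, smul_eq_mul]
  field_simp

/-- The binomial series. -/
theorem hasSum_Gamma_binomial {c r : ℝ} (hc : 0 < c) (hr : |r| < 1) :
    HasSum (fun n : ℕ => Real.Gamma (c + n) / n.factorial * r ^ n)
      (Real.Gamma c * (1 - r) ^ (-c)) := by
  have h := (Real.one_div_one_sub_rpow_hasFPowerSeriesOnBall_zero c).hasSum (y := r)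
    (by simpa [enorm_eq_nnnorm, ← NNReal.coe_lt_one] using hr)
  have h2 := h.mul_left (Real.Gamma c)
  have e : (1 - r) ^ (-c) = 1 / (1 - r) ^ c := by
    rw [Real.rpow_neg (by linarith [(abs_lt.1 hr).2]), one_div]
  rw [e]
  simp only [zero_add] at h2
  refine h2.congr_fun ?_
  intro n
  rw [← ringChoose_mul_Gamma hc]
  simp
  ring

/-- `∑ (c + 2n) Γ(c + n) / n! r ^ n = Γ(c + 1) (1 + r) (1 - r) ^ (-c-1)`. -/
theorem hasSum_Gamma_binomial_two_mul {c r : ℝ} (hc : 0 < c) (hr : |r| < 1) :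
    HasSum (fun n : ℕ => (c + 2 * n) * (Real.Gamma (c + n) / n.factorial) * r ^ n)
      (Real.Gamma (c + 1) * (1 + r) * (1 - r) ^ (-(c + 1))) := by
  have h := hasSum_Gamma_binomial (c := c + 1) (by linarith) hr
  set f : ℕ → ℝ := fun n => Real.Gamma (c + 1 + n) / n.factorial * r ^ n with hf
  set S := Real.Gamma (c + 1) * (1 - r) ^ (-(c + 1)) with hS
  -- Since c + 2n = (c + n) + n, the series splits in two: the first part is the binomial series
  -- with parameter c + 1, and `g` is r times the same series after an index shift.
  let g : ℕ → ℝ := fun n => n * (Real.Gamma (c + n) / n.factorial) * r ^ n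
  have hg : HasSum g (r * S) := by
    rw [← hasSum_nat_add_iff' 1]
    simp only [Finset.range_one, Finset.sum_singleton, g, Nat.cast_zero, zero_mul, sub_zero]
    refine (h.mul_left r).congr_fun ?_
    intro n
    rw [hf, Nat.factorial_succ]
    push_cast
    rw [show c + ((n : ℝ) + 1) = c + 1 + n by ring, pow_succ]
    field_simp
  have := h.add hg
  rw [show Real.Gamma (c + 1) * (1 + r) * (1 - r) ^ (-(c + 1)) = S + r * S by rw [hS]; ring]
  refine this.congr_fun ?_
  intro n
  simp only [hf, g]
  rw [show c + 1 + (n : ℝ) = c + n + 1 by ring, Real.Gamma_add_one (by positivity)]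
  ring


/-! ### The Jacobi operator and Bailey's product formula. -/

noncomputable section

open Polynomial in
/-- The Jacobi operator in the variable `x = sin²(θ/2)`. -/
def jacobiOp (a b : ℝ) : ℝ[X] →ₗ[ℝ] ℝ[X] :=
  LinearMap.mulLeft ℝ (X * (1 - X)) ∘ₗ derivative ∘ₗ derivative +
    LinearMap.mulLeft ℝ (C (a + 1) - (C (a + b + 1) + 1) * X) ∘ₗ derivative

open Polynomial in
theorem jacobiOp_apply (a b : ℝ) (p : ℝ[X]) :
    jacobiOp a b p = X * (1 - X) * derivative (derivative p) +
      (C (a + 1) - (C (a + b + 1) + 1) * X) * derivative p := rfl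

open Polynomial in
-- The operator preserves the total degree m + l up to terms of degree one lower. The truncated
-- exponents m - 1 and l - 1 are harmless, because their coefficients vanish at m = 0 and l = 0.
theorem jacobiOp_monomial (a b : ℝ) (m l : ℕ) :
    jacobiOp a b (X ^ m * (1 - X) ^ l) =
      C (m * (m + a)) * (X ^ (m - 1) * (1 - X) ^ l) +
        C (l * (l + b)) * (X ^ m * (1 - X) ^ (l - 1)) -
          C ((m + l) * (m + l + a + b + 1)) * (X ^ m * (1 - X) ^ l) := by
  rw [jacobiOp_apply]
  rcases m with _ | _ | m <;> rcases l with _ | _ | l <;>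
    simp [derivative_mul, derivative_pow] <;> ring

open Polynomial in
/-- A polynomial eigenfunction of the Jacobi operator that vanishes at `0` is zero. -/
theorem jacobiOp_eigen_eq_zero {a b μ : ℝ} (ha : -1 < a) {p : ℝ[X]}
    (hp : jacobiOp a b p = C μ * p) (h0 : p.eval 0 = 0) : p = 0 := by
  -- Comparing coefficients of X^k gives a two-term recursion. Its leading factor is nonzero because
  -- a > -1, so the constant term determines p.
  have hrec : ∀ k : ℕ, ((k : ℝ) + 1) * (k + a + 1) * p.coeff (k + 1) =
      (μ + k * (k + a + b + 1)) * p.coeff k := by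
    intro k
    have h := congrArg (fun r => coeff r k) hp
    simp only [jacobiOp_apply, coeff_add, coeff_C_mul] at h
    have e1 : X * (1 - X) * derivative (derivative p) =
        derivative (derivative p) * X - derivative (derivative p) * X ^ 2 := by ring
    have e2 : (C (a + 1) - (C (a + b + 1) + 1) * X) * derivative p =
        C (a + 1) * derivative p - (C (a + b + 1) * (derivative p * X) + derivative p * X) := by ring
    rw [e1, e2, coeff_sub, coeff_sub, coeff_add, coeff_C_mul, coeff_C_mul] at h
    rcases k with _ | _ | k
    · simp [coeff_derivative] at h
      simp
      linarith
    · simp [coeff_mul_X_pow', coeff_derivative] at h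
      simp
      linarith
    · simp [coeff_mul_X_pow', coeff_derivative] at h
      push_cast at h ⊢
      linear_combination h
  ext k
  induction k with
  | zero => simpa [coeff_zero_eq_eval_zero] using h0
  | succ k ih =>
    have h := hrec k
    rw [ih] at h
    simp only [coeff_zero, mul_zero, mul_eq_zero] at h ⊢
    rcases h with h | h
    · exfalso
      have h1 : (0 : ℝ) < (k : ℝ) + 1 := by positivity
      have h2 : (0 : ℝ) < (k : ℝ) + a + 1 := by
        have : (0 : ℝ) ≤ k := by positivity
        linarith
      rcases h with h | h
      · exact h1.ne' h
      · exact h2.ne' h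
    · exact h

/-- The coefficients `1 / (m! l! Γ(m + a + 1) Γ(l + b + 1))`. -/
def jacobiCoeff (a b : ℝ) (m l : ℕ) : ℝ :=
  1 / (m.factorial * l.factorial * Real.Gamma (m + a + 1) * Real.Gamma (l + b + 1))

theorem Gamma_natCast_add_pos {a : ℝ} (ha : -1 < a) (m : ℕ) : 0 < Real.Gamma (m + a + 1) := by
  refine Real.Gamma_pos_of_pos ?_
  have : (0 : ℝ) ≤ m := by positivity
  linarith

theorem jacobiCoeff_pos {a b : ℝ} (ha : -1 < a) (hb : -1 < b) (m l : ℕ) :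
    0 < jacobiCoeff a b m l := by
  have h1 := Gamma_natCast_add_pos ha m
  have h2 := Gamma_natCast_add_pos hb l
  unfold jacobiCoeff
  positivity

theorem jacobiCoeff_succ_left {a : ℝ} (b : ℝ) (ha : -1 < a) (m l : ℕ) :
    ((m : ℝ) + 1) * (m + 1 + a) * jacobiCoeff a b (m + 1) l = jacobiCoeff a b m l := by
  have h1 := Gamma_natCast_add_pos ha m
  have h2 : (0 : ℝ) < m + a + 1 := by
    have : (0 : ℝ) ≤ m := by positivity
    linarith
  unfold jacobiCoeff
  rw [Nat.factorial_succ]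
  push_cast
  rw [show (m : ℝ) + 1 + a + 1 = (m + a + 1) + 1 by ring, Real.Gamma_add_one h2.ne',
    show (m : ℝ) + 1 + a = m + a + 1 by ring]
  field_simp

theorem jacobiCoeff_comm (a b : ℝ) (m l : ℕ) : jacobiCoeff a b m l = jacobiCoeff b a l m := by
  unfold jacobiCoeff; ring

theorem jacobiCoeff_succ_right (a : ℝ) {b : ℝ} (hb : -1 < b) (m l : ℕ) :
    ((l : ℝ) + 1) * (l + 1 + b) * jacobiCoeff a b m (l + 1) = jacobiCoeff a b m l := by
  rw [jacobiCoeff_comm, jacobiCoeff_succ_left a hb, jacobiCoeff_comm]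

open Polynomial in
/-- `∑_{m + l = k} g_{m,l} (x y)^m ((1 - x) (1 - y))^l` as a polynomial in `x`. -/
def jacobiHomPoly (a b : ℝ) (y : ℝ) (k : ℕ) : ℝ[X] :=
  ∑ p ∈ Finset.HasAntidiagonal.antidiagonal k,
    C (jacobiCoeff a b p.1 p.2 * (y ^ p.1 * (1 - y) ^ p.2)) * (X ^ p.1 * (1 - X) ^ p.2)

open Polynomial in
theorem jacobiOp_homPoly_zero (a b y : ℝ) : jacobiOp a b (jacobiHomPoly a b y 0) = 0 := by
  simp [jacobiHomPoly, jacobiOp_apply]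

open Polynomial in
theorem jacobiOp_C_mul (a b c : ℝ) (p : ℝ[X]) :
    jacobiOp a b (C c * p) = C c * jacobiOp a b p := by
  rw [← smul_eq_C_mul, ← smul_eq_C_mul, map_smul]

open Polynomial in
theorem jacobiOp_C_mul_monomial (a b c : ℝ) (m l : ℕ) :
    jacobiOp a b (C c * (X ^ m * (1 - X) ^ l)) =
      C c * (C (m * (m + a)) * (X ^ (m - 1) * (1 - X) ^ l)) +
        C c * (C (l * (l + b)) * (X ^ m * (1 - X) ^ (l - 1))) -
          C c * (C ((m + l) * (m + l + a + b + 1)) * (X ^ m * (1 - X) ^ l)) := by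
  rw [jacobiOp_C_mul, jacobiOp_monomial]
  ring

open Polynomial in
-- The coefficients are built so that m(m + a) and l(l + b) cancel in the two lowering terms. After
-- an index shift these become y and 1 - y times the sum of degree k, and they add up to exactly
-- that sum.
theorem jacobiOp_homPoly_succ {a b : ℝ} (ha : -1 < a) (hb : -1 < b) (y : ℝ) (k : ℕ) :
    jacobiOp a b (jacobiHomPoly a b y (k + 1)) =
      jacobiHomPoly a b y k -
        C (((k + 1 : ℕ) : ℝ) * ((k + 1 : ℕ) + a + b + 1)) * jacobiHomPoly a b y (k + 1) := by
  have h1 : ∑ p ∈ Finset.HasAntidiagonal.antidiagonal (k + 1),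
      C (jacobiCoeff a b p.1 p.2 * (y ^ p.1 * (1 - y) ^ p.2)) *
        (C (p.1 * (p.1 + a)) * (X ^ (p.1 - 1) * (1 - X) ^ p.2)) =
      C y * jacobiHomPoly a b y k := by
    rw [Finset.Nat.sum_antidiagonal_succ, jacobiHomPoly, Finset.mul_sum]
    simp only [Nat.cast_zero, zero_mul, C_0, mul_zero, zero_add, Nat.add_sub_cancel]
    refine Finset.sum_congr rfl fun p _ => ?_
    rw [← jacobiCoeff_succ_left b ha p.1 p.2]
    simp only [C_mul, C_add, C_pow, C_sub, Nat.cast_add, Nat.cast_one]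
    ring
  have h2 : ∑ p ∈ Finset.HasAntidiagonal.antidiagonal (k + 1),
      C (jacobiCoeff a b p.1 p.2 * (y ^ p.1 * (1 - y) ^ p.2)) *
        (C (p.2 * (p.2 + b)) * (X ^ p.1 * (1 - X) ^ (p.2 - 1))) =
      C (1 - y) * jacobiHomPoly a b y k := by
    rw [Finset.Nat.sum_antidiagonal_succ', jacobiHomPoly, Finset.mul_sum]
    simp only [Nat.cast_zero, zero_mul, C_0, mul_zero, zero_add, Nat.add_sub_cancel]
    refine Finset.sum_congr rfl fun p _ => ?_
    rw [← jacobiCoeff_succ_right a hb p.1 p.2]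
    simp only [C_mul, C_add, C_pow, C_sub, Nat.cast_add, Nat.cast_one]
    ring
  have h3 : ∑ p ∈ Finset.HasAntidiagonal.antidiagonal (k + 1),
      C (jacobiCoeff a b p.1 p.2 * (y ^ p.1 * (1 - y) ^ p.2)) *
        (C (((p.1 : ℝ) + p.2) * (p.1 + p.2 + a + b + 1)) * (X ^ p.1 * (1 - X) ^ p.2)) =
      C (((k + 1 : ℕ) : ℝ) * ((k + 1 : ℕ) + a + b + 1)) * jacobiHomPoly a b y (k + 1) := by
    rw [jacobiHomPoly, Finset.mul_sum]
    refine Finset.sum_congr rfl fun p hp => ?_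
    have : ((k + 1 : ℕ) : ℝ) = p.1 + p.2 := by
      rw [← Finset.HasAntidiagonal.mem_antidiagonal.1 hp]; push_cast; ring
    rw [this]
    ring
  conv_lhs => rw [jacobiHomPoly, map_sum]
  simp only [jacobiOp_C_mul_monomial, Finset.sum_sub_distrib, Finset.sum_add_distrib]
  rw [h1, h2, h3, C_sub, C_1]
  ring

open Polynomial in
/-- The Jacobi polynomial, up to a constant factor, in the variable `x = sin²(θ/2)`. -/
def jacobiPoly (a b : ℝ) (n : ℕ) : ℝ[X] :=
  ∑ p ∈ Finset.HasAntidiagonal.antidiagonal n,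
    C ((-1) ^ p.1 * jacobiCoeff a b p.1 p.2) * (X ^ p.1 * (1 - X) ^ p.2)

open Polynomial in
-- Because of the alternating sign the two lowering sums cancel, and only the diagonal part of the
-- operator remains.
theorem jacobiOp_jacobiPoly {a b : ℝ} (ha : -1 < a) (hb : -1 < b) (n : ℕ) :
    jacobiOp a b (jacobiPoly a b n) = C (-(n * (n + a + b + 1))) * jacobiPoly a b n := by
  rcases n with _ | n
  · simp [jacobiPoly, jacobiOp_apply]
  have key : ∀ m l : ℕ, C (((m : ℝ) + 1) * (m + 1 + a)) * C ((-1) ^ (m + 1) *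
      jacobiCoeff a b (m + 1) l) = -C ((-1) ^ m * jacobiCoeff a b m l) := by
    intro m l
    rw [← jacobiCoeff_succ_left b ha m l, ← C_mul, ← C_neg]
    congr 1
    ring
  have key' : ∀ m l : ℕ, C (((l : ℝ) + 1) * (l + 1 + b)) * C ((-1) ^ m *
      jacobiCoeff a b m (l + 1)) = C ((-1) ^ m * jacobiCoeff a b m l) := by
    intro m l
    rw [← jacobiCoeff_succ_right a hb m l, ← C_mul]
    congr 1
    ring
  have h1 : ∑ p ∈ Finset.HasAntidiagonal.antidiagonal (n + 1),
      C ((-1) ^ p.1 * jacobiCoeff a b p.1 p.2) *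
        (C (p.1 * (p.1 + a)) * (X ^ (p.1 - 1) * (1 - X) ^ p.2)) =
      -∑ p ∈ Finset.HasAntidiagonal.antidiagonal n, C ((-1) ^ p.1 * jacobiCoeff a b p.1 p.2) *
        (X ^ p.1 * (1 - X) ^ p.2) := by
    rw [Finset.Nat.sum_antidiagonal_succ, ← Finset.sum_neg_distrib]
    simp only [Nat.cast_zero, zero_mul, C_0, mul_zero, zero_add, Nat.add_sub_cancel]
    refine Finset.sum_congr rfl fun p _ => ?_
    have := key p.1 p.2
    push_cast
    linear_combination (X ^ p.1 * (1 - X) ^ p.2) * this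
  have h2 : ∑ p ∈ Finset.HasAntidiagonal.antidiagonal (n + 1),
      C ((-1) ^ p.1 * jacobiCoeff a b p.1 p.2) *
        (C (p.2 * (p.2 + b)) * (X ^ p.1 * (1 - X) ^ (p.2 - 1))) =
      ∑ p ∈ Finset.HasAntidiagonal.antidiagonal n, C ((-1) ^ p.1 * jacobiCoeff a b p.1 p.2) *
        (X ^ p.1 * (1 - X) ^ p.2) := by
    rw [Finset.Nat.sum_antidiagonal_succ']
    simp only [Nat.cast_zero, zero_mul, C_0, mul_zero, zero_add, Nat.add_sub_cancel]
    refine Finset.sum_congr rfl fun p _ => ?_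
    have := key' p.1 p.2
    push_cast
    linear_combination (X ^ p.1 * (1 - X) ^ p.2) * this
  have h3 : ∑ p ∈ Finset.HasAntidiagonal.antidiagonal (n + 1),
      C ((-1) ^ p.1 * jacobiCoeff a b p.1 p.2) *
        (C (((p.1 : ℝ) + p.2) * (p.1 + p.2 + a + b + 1)) * (X ^ p.1 * (1 - X) ^ p.2)) =
      C (((n + 1 : ℕ) : ℝ) * ((n + 1 : ℕ) + a + b + 1)) * jacobiPoly a b (n + 1) := by
    rw [jacobiPoly, Finset.mul_sum]
    refine Finset.sum_congr rfl fun p hp => ?_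
    have : ((n + 1 : ℕ) : ℝ) = p.1 + p.2 := by
      rw [← Finset.HasAntidiagonal.mem_antidiagonal.1 hp]; push_cast; ring
    rw [this]
    ring
  conv_lhs => rw [jacobiPoly, map_sum]
  simp only [jacobiOp_C_mul_monomial, Finset.sum_sub_distrib, Finset.sum_add_distrib]
  rw [h1, h2, h3, C_neg]
  ring

open Polynomial in
/-- The right side of Bailey's product formula, as a polynomial in `x`. -/
def baileyPoly (a b y : ℝ) (n : ℕ) : ℝ[X] :=
  ∑ k ∈ Finset.range (n + 1),
    C (Real.Gamma (n + (a + b + 1) + k) * (-1) ^ (n - k) / (n - k).factorial) *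
      jacobiHomPoly a b y k

open Polynomial in
-- On the homogeneous sums the operator is bidiagonal. The weights `w k` solve the recursion that
-- makes their combination an eigenvector for the eigenvalue of degree n.
theorem jacobiOp_baileyPoly {a b : ℝ} (ha : -1 < a) (hb : -1 < b) (hab : 0 < a + b + 1) (y : ℝ)
    (n : ℕ) :
    jacobiOp a b (baileyPoly a b y n) = C (-(n * (n + a + b + 1))) * baileyPoly a b y n := by
  set w : ℕ → ℝ := fun k =>
    Real.Gamma (n + (a + b + 1) + k) * (-1) ^ (n - k) / (n - k).factorial with hw
  have hwrec : ∀ k, k < n → w (k + 1) = -((n - k) * (n + (a + b + 1) + k)) * w k := by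
    intro k hk
    obtain ⟨i, rfl⟩ := Nat.exists_eq_add_of_lt hk
    simp only [hw]
    have e1 : k + i + 1 - (k + 1) = i := by omega
    have e2 : k + i + 1 - k = i + 1 := by omega
    rw [e1, e2, Nat.factorial_succ, pow_succ]
    push_cast
    have hpos : (0 : ℝ) < (k : ℝ) + i + 1 + (a + b + 1) + k := by positivity
    rw [show (k : ℝ) + i + 1 + (a + b + 1) + (k + 1) = (k + i + 1 + (a + b + 1) + k) + 1 by ring,
      Real.Gamma_add_one hpos.ne']
    field_simp
    ring
  have hQ : baileyPoly a b y n = ∑ k ∈ Finset.range (n + 1), C (w k) * jacobiHomPoly a b y k := rfl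
  have hop : ∀ k, jacobiOp a b (jacobiHomPoly a b y k) =
      (if k = 0 then 0 else jacobiHomPoly a b y (k - 1)) -
        C ((k : ℝ) * (k + a + b + 1)) * jacobiHomPoly a b y k := by
    rintro (_ | k)
    · simp [jacobiOp_homPoly_zero]
    · rw [jacobiOp_homPoly_succ ha hb]; simp
  rw [hQ, map_sum]
  simp only [jacobiOp_C_mul, hop, mul_sub, Finset.sum_sub_distrib]
  rw [Finset.sum_range_succ' (fun k => C (w k) * if k = 0 then 0 else _)]
  simp only [Nat.succ_ne_zero, if_false, if_true, mul_zero, add_zero, Nat.add_sub_cancel]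
  rw [Finset.sum_range_succ (fun k => C (w k) * (_ * _)),
    Finset.sum_range_succ (fun k => C (w k) * jacobiHomPoly a b y k),
    sub_add_eq_sub_sub, ← Finset.sum_sub_distrib]
  have h1 : ∀ k ∈ Finset.range n, C (w (k + 1)) * jacobiHomPoly a b y k -
      C (w k) * (C ((k : ℝ) * (k + a + b + 1)) * jacobiHomPoly a b y k) =
      C (-(n * (n + a + b + 1))) * (C (w k) * jacobiHomPoly a b y k) := by
    intro k hk
    rw [hwrec k (Finset.mem_range.1 hk)]
    rw [← mul_assoc, ← mul_assoc, ← sub_mul, ← C_mul, ← C_mul, ← C_sub]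
    congr 2
    ring
  rw [Finset.sum_congr rfl h1, ← Finset.mul_sum, C_neg]
  ring

theorem eval_baileyPoly (a b x y : ℝ) (n : ℕ) :
    (baileyPoly a b y n).eval x = ∑ k ∈ Finset.range (n + 1),
      Real.Gamma (n + (a + b + 1) + k) * (-1) ^ (n - k) / (n - k).factorial *
        ∑ p ∈ Finset.HasAntidiagonal.antidiagonal k,
          jacobiCoeff a b p.1 p.2 * ((x * y) ^ p.1 * ((1 - x) * (1 - y)) ^ p.2) := by
  simp only [baileyPoly, jacobiHomPoly, Polynomial.eval_finsetSum, Polynomial.eval_mul,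
    Polynomial.eval_C, Polynomial.eval_pow, Polynomial.eval_X, Polynomial.eval_sub,
    Polynomial.eval_one]
  refine Finset.sum_congr rfl fun k _ => ?_
  congr 1
  refine Finset.sum_congr rfl fun p _ => ?_
  rw [mul_pow, mul_pow]
  ring

theorem eval_jacobiPoly (a b x : ℝ) (n : ℕ) :
    (jacobiPoly a b n).eval x = ∑ p ∈ Finset.HasAntidiagonal.antidiagonal n,
      (-1) ^ p.1 * jacobiCoeff a b p.1 p.2 * (x ^ p.1 * (1 - x) ^ p.2) := by
  simp [jacobiPoly, Polynomial.eval_finsetSum]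

theorem eval_baileyPoly_comm (a b x y : ℝ) (n : ℕ) :
    (baileyPoly a b y n).eval x = (baileyPoly a b x n).eval y := by
  rw [eval_baileyPoly, eval_baileyPoly, mul_comm x y, mul_comm (1 - x)]

theorem eval_zero_jacobiPoly (a b : ℝ) (n : ℕ) :
    (jacobiPoly a b n).eval 0 = jacobiCoeff a b 0 n := by
  rw [eval_jacobiPoly, Finset.sum_eq_single (0, n)]
  · simp
  · rintro ⟨m, l⟩ hp hne
    have : m ≠ 0 := by
      rintro rfl
      simp at hp
      simp [hp] at hne
    simp [this]
  · simp

theorem eval_one_jacobiPoly (a b : ℝ) (n : ℕ) :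
    (jacobiPoly a b n).eval 1 = (-1) ^ n * jacobiCoeff a b n 0 := by
  rw [eval_jacobiPoly, Finset.sum_eq_single (n, 0)]
  · simp
  · rintro ⟨m, l⟩ hp hne
    have : l ≠ 0 := by
      rintro rfl
      simp at hp
      simp [hp] at hne
    simp [this]
  · simp

/-- Both polynomials in x are eigenfunctions for the same eigenvalue, so they are proportional; the
factor is read off at x = 0. -/
theorem jacobiPoly_eval_zero_mul_baileyPoly {a b : ℝ} (ha : -1 < a) (hb : -1 < b)
    (hab : 0 < a + b + 1) (x y : ℝ) (n : ℕ) :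
    jacobiCoeff a b 0 n * (baileyPoly a b y n).eval x =
      (baileyPoly a b y n).eval 0 * (jacobiPoly a b n).eval x := by
  have h : Polynomial.C (jacobiCoeff a b 0 n) * baileyPoly a b y n -
      Polynomial.C ((baileyPoly a b y n).eval 0) * jacobiPoly a b n = 0 := by
    refine jacobiOp_eigen_eq_zero (b := b) (μ := -(n * (n + a + b + 1))) ha ?_ ?_
    · rw [map_sub, jacobiOp_C_mul, jacobiOp_C_mul, jacobiOp_baileyPoly ha hb hab,
        jacobiOp_jacobiPoly ha hb]
      ring
    · simp [eval_zero_jacobiPoly]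
      ring
  have := congrArg (Polynomial.eval x) h
  simp at this
  linarith

/-- Bailey's product formula for Jacobi polynomials. -/
theorem bailey_product {a b : ℝ} (ha : -1 < a) (hb : -1 < b)
    (hab : 0 < a + b + 1) (x y : ℝ) (n : ℕ) :
    (baileyPoly a b y n).eval x = n.factorial * Real.Gamma (n + (a + b + 1)) *
      Real.Gamma (n + a + 1) * Real.Gamma (n + b + 1) *
        (jacobiPoly a b n).eval x * (jacobiPoly a b n).eval y := by
  -- Proportionality is used three times: in x, then in y by symmetry of the right side, and at the
  -- corner (1, 0). At the corner xy and (1 - x)(1 - y) both vanish, so only the term k = 0 survives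
  -- and fixes the constant.
  have h1 := jacobiPoly_eval_zero_mul_baileyPoly ha hb hab x y n
  have h2 := jacobiPoly_eval_zero_mul_baileyPoly ha hb hab y 0 n
  have h3 := jacobiPoly_eval_zero_mul_baileyPoly ha hb hab 1 0 n
  rw [eval_baileyPoly_comm] at h2
  have h4 : (baileyPoly a b 0 n).eval 1 =
      Real.Gamma (n + (a + b + 1)) * (-1) ^ n / n.factorial * jacobiCoeff a b 0 0 := by
    rw [eval_baileyPoly, Finset.sum_eq_single 0]
    · simp
    · intro k _ hk
      rw [Finset.sum_eq_zero, mul_zero]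
      rintro ⟨m, l⟩ hp
      simp only [Finset.HasAntidiagonal.mem_antidiagonal] at hp
      rcases Nat.eq_zero_or_pos m with rfl | hm
      · have : l ≠ 0 := by omega
        simp [this]
      · simp [hm.ne']
    · simp
  rw [eval_one_jacobiPoly, h4] at h3
  have ga := Gamma_natCast_add_pos ha n
  have gb := Gamma_natCast_add_pos hb n
  have ga0 := Gamma_natCast_add_pos ha 0
  have gb0 := Gamma_natCast_add_pos hb 0
  have hs : ((-1 : ℝ) ^ n) ≠ 0 := by positivity
  have hg := jacobiCoeff_pos ha hb 0 n
  have hg' := jacobiCoeff_pos ha hb n 0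
  have h5 : (baileyPoly a b 0 n).eval 0 = jacobiCoeff a b 0 n *
      (Real.Gamma (n + (a + b + 1)) / n.factorial * jacobiCoeff a b 0 0) /
        jacobiCoeff a b n 0 := by
    rw [eq_div_iff hg'.ne']
    refine mul_left_cancel₀ hs ?_
    linear_combination -h3
  have h6 : (baileyPoly a b y n).eval 0 =
      (Real.Gamma (n + (a + b + 1)) / n.factorial * jacobiCoeff a b 0 0) /
        jacobiCoeff a b n 0 * (jacobiPoly a b n).eval y := by
    refine mul_left_cancel₀ hg.ne' ?_
    rw [h2, h5]
    ring
  refine mul_left_cancel₀ hg.ne' ?_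
  rw [h1, h6]
  clear h1 h2 h3 h4 h5 h6 hg hg'
  simp only [jacobiCoeff, Nat.cast_zero, Nat.factorial_zero, Nat.cast_one, one_mul, mul_one] at *
  field_simp

end


/-! ### From Rodrigues' formula to the terms of the Poisson series. -/

noncomputable section

theorem descPochhammer_eval_mul_Gamma {c : ℝ} {i : ℕ} (hc : 0 < c - i + 1) :
    (descPochhammer ℝ i).eval c * Real.Gamma (c - i + 1) = Real.Gamma (c + 1) := by
  rw [descPochhammer_eval_eq_ascPochhammer, ← Gamma_add_natCast_eq hc]
  congr 1
  ring

theorem iteratedDeriv_one_sub_rpow (p x : ℝ) (i : ℕ) :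
    iteratedDeriv i (fun y : ℝ => (1 - y) ^ p) x =
      (-1) ^ i * ((descPochhammer ℝ i).eval p * (1 - x) ^ (p - i)) := by
  rw [iteratedDeriv_comp_const_sub i (fun y : ℝ => y ^ p) 1]
  simp only [smul_eq_mul]
  rw [iteratedDeriv_eq_iterate, Real.iter_deriv_rpow_const]

theorem iteratedDeriv_one_add_rpow (p x : ℝ) (i : ℕ) :
    iteratedDeriv i (fun y : ℝ => (1 + y) ^ p) x =
      (descPochhammer ℝ i).eval p * (1 + x) ^ (p - i) := by
  rw [iteratedDeriv_comp_const_add i (fun y : ℝ => y ^ p) 1]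
  simp only
  rw [iteratedDeriv_eq_iterate, Real.iter_deriv_rpow_const]

/-- Leibniz' rule applied to Rodrigues' formula. The falling factorials become Gamma quotients, and
the fractional powers cancel against the prefactor. -/
theorem jacobiP_eq_eval {a b : ℝ} (ha : -1 < a) (hb : -1 < b) (n : ℕ) {x : ℝ} (hx : -1 < x)
    (hx1 : x < 1) :
    jacobiP a b n x = Real.Gamma (n + a + 1) * Real.Gamma (n + b + 1) *
      (jacobiPoly a b n).eval ((1 - x) / 2) := by
  have h1 : (0 : ℝ) < 1 - x := by linarith
  have h2 : (0 : ℝ) < 1 + x := by linarith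
  have hd1 : ContDiffAt ℝ n (fun y : ℝ => (1 - y) ^ ((n : ℝ) + a)) x :=
    ContDiffAt.rpow_const_of_ne (by fun_prop) h1.ne'
  have hd2 : ContDiffAt ℝ n (fun y : ℝ => (1 + y) ^ ((n : ℝ) + b)) x :=
    ContDiffAt.rpow_const_of_ne (by fun_prop) h2.ne'
  -- The antidiagonal is swapped because differentiating the factor (1 - y)^(n + a) exactly i times
  -- leaves the integer exponent i on 1 + x.
  rw [jacobiP, iteratedDeriv_fun_mul hd1 hd2, eval_jacobiPoly,
    ← Finset.Nat.sum_antidiagonal_swap]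
  simp only [Prod.fst_swap, Prod.snd_swap]
  rw [Finset.Nat.sum_antidiagonal_eq_sum_range_succ (fun i j => (-1) ^ j * jacobiCoeff a b j i *
      (((1 - x) / 2) ^ j * (1 - (1 - x) / 2) ^ i)), Finset.mul_sum, Finset.mul_sum]
  refine Finset.sum_congr rfl fun i hi => ?_
  have hin : i ≤ n := Nat.lt_succ_iff.1 (Finset.mem_range.1 hi)
  obtain ⟨m, rfl⟩ := Nat.exists_eq_add_of_le hin
  rw [Nat.add_sub_cancel_left, iteratedDeriv_one_sub_rpow, iteratedDeriv_one_add_rpow]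
  have hm := Gamma_natCast_add_pos ha m
  have hi := Gamma_natCast_add_pos hb i
  have e1 := descPochhammer_eval_mul_Gamma (c := ((i + m : ℕ) : ℝ) + a) (i := i) (by
    push_cast
    have : (0 : ℝ) ≤ m := by positivity
    linarith)
  have e2 := descPochhammer_eval_mul_Gamma (c := ((i + m : ℕ) : ℝ) + b) (i := m) (by
    push_cast
    have : (0 : ℝ) ≤ i := by positivity
    linarith)
  rw [show ((i + m : ℕ) : ℝ) + a - i + 1 = m + a + 1 by push_cast; ring] at e1
  rw [show ((i + m : ℕ) : ℝ) + b - m + 1 = i + b + 1 by push_cast; ring] at e2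
  rw [← e1, ← e2]
  have p1 : (1 - x) ^ (((i + m : ℕ) : ℝ) + a - i) = (1 - x) ^ m * (1 - x) ^ a := by
    rw [← Real.rpow_natCast, ← Real.rpow_add h1]; congr 1; push_cast; ring
  have p2 : (1 + x) ^ (((i + m : ℕ) : ℝ) + b - m) = (1 + x) ^ i * (1 + x) ^ b := by
    rw [← Real.rpow_natCast, ← Real.rpow_add h2]; congr 1; push_cast; ring
  rw [p1, p2, Real.rpow_neg h1.le, Real.rpow_neg h2.le, jacobiCoeff,
    show 1 - (1 - x) / 2 = (1 + x) / 2 by ring, div_pow, div_pow]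
  have q1 : 0 < (1 - x) ^ a := by positivity
  have q2 : 0 < (1 + x) ^ b := by positivity
  have hch : ((i + m).choose i : ℝ) * (i.factorial * m.factorial) = ((i + m).factorial : ℝ) := by
    have := Nat.choose_mul_factorial_mul_factorial hin
    rw [Nat.add_sub_cancel_left] at this
    rw [← this]
    push_cast
    ring
  have hsgn : (-1 : ℝ) ^ (i + m) * (-1) ^ i = (-1) ^ m := by
    rw [pow_add, mul_right_comm, ← mul_pow]; simp
  have hfac : ((i + m).factorial : ℝ) ≠ 0 := by positivity
  rw [← hch] at hfac ⊢
  rw [← hsgn, pow_add 2 i m]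
  have hc0 : ((i + m).choose i : ℝ) ≠ 0 := left_ne_zero_of_mul hfac
  field_simp

/-- The homogeneous sums `∑_{m + l = k} X^{2m} Y^{2l} / (m! l! Γ(m + a + 1) Γ(l + b + 1))`. -/
def jacobiHom (a b X Y : ℝ) (k : ℕ) : ℝ :=
  ∑ p ∈ Finset.HasAntidiagonal.antidiagonal k,
    jacobiCoeff a b p.1 p.2 * (X ^ (2 * p.1) * Y ^ (2 * p.2))

/-- The coefficient of `e^{-t (n + (a + b + 1) / 2)}` in the Jacobi-Poisson kernel. -/
def poissonCoeff (a b X Y : ℝ) (n : ℕ) : ℝ :=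
  (2 * n + (a + b + 1)) * ∑ k ∈ Finset.range (n + 1),
    Real.Gamma (n + (a + b + 1) + k) * (-1) ^ (n - k) / (n - k).factorial * jacobiHom a b X Y k

/-- The square of the normalizing constant equals 2n + a + b + 1 times the Gamma factors of Bailey's
formula, once those of `jacobiP_eq_eval` are taken into account. Hence only this linear factor
remains in the coefficient. -/
theorem jacobiPoissonTerm_eq {a b : ℝ} (ha : -1 < a) (hb : -1 < b) (hab : 0 < a + b + 1)
    (t : ℝ) {θ φ : ℝ} (hθ : θ ∈ Ioo 0 Real.pi) (hφ : φ ∈ Ioo 0 Real.pi) (n : ℕ) :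
    jacobiPoissonTerm a b t θ φ n = Real.exp (-t * (n + (a + b + 1) / 2)) *
      poissonCoeff a b (Real.sin (θ / 2) * Real.sin (φ / 2))
        (Real.cos (θ / 2) * Real.cos (φ / 2)) n := by
  have hcos : ∀ θ ∈ Ioo 0 Real.pi, -1 < Real.cos θ ∧ Real.cos θ < 1 := by
    intro θ hθ
    constructor
    · rw [← Real.cos_pi]
      exact Real.cos_lt_cos_of_nonneg_of_le_pi hθ.1.le le_rfl hθ.2
    · rw [← Real.cos_zero]
      exact Real.cos_lt_cos_of_nonneg_of_le_pi le_rfl hθ.2.le hθ.1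
  have hs : ∀ θ, (1 - Real.cos θ) / 2 = Real.sin (θ / 2) ^ 2 := by
    intro θ
    have := Real.cos_sq' (θ / 2)
    have h2 := Real.cos_two_mul (θ / 2)
    rw [mul_div_cancel₀ _ (two_ne_zero)] at h2
    rw [h2, this]
    ring
  have hc : ∀ θ, 1 - Real.sin (θ / 2) ^ 2 = Real.cos (θ / 2) ^ 2 := fun θ =>
    (Real.cos_sq' (θ / 2)).symm
  rw [jacobiPoissonTerm, jacobiTrig, jacobiTrig, jacobiP_eq_eval ha hb n (hcos θ hθ).1 (hcos θ hθ).2,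
    jacobiP_eq_eval ha hb n (hcos φ hφ).1 (hcos φ hφ).2]
  have habs : |(n : ℝ) + (a + b + 1) / 2| = n + (a + b + 1) / 2 := abs_of_pos (by positivity)
  rw [habs]
  have hga := Gamma_natCast_add_pos ha n
  have hgb := Gamma_natCast_add_pos hb n
  have hgab : 0 < Real.Gamma (n + a + b + 1) := Real.Gamma_pos_of_pos (by
    have : (0 : ℝ) ≤ n := by positivity
    linarith)
  have hn : Real.Gamma (n + 1) = n.factorial := Real.Gamma_nat_eq_factorial n
  have hd : jacobiNormConst a b n * jacobiNormConst a b n =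
      (2 * n + a + b + 1) * n.factorial * Real.Gamma (n + a + b + 1) /
        (Real.Gamma (n + a + 1) * Real.Gamma (n + b + 1)) := by
    rw [jacobiNormConst, Real.mul_self_sqrt, hn]
    rw [hn]
    have : 0 ≤ 2 * (n : ℝ) + a + b + 1 := by
      have : (0 : ℝ) ≤ n := by positivity
      linarith
    positivity
  have hB := bailey_product ha hb hab ((1 - Real.cos θ) / 2) ((1 - Real.cos φ) / 2) n
  rw [eval_baileyPoly] at hB
  have hsum : poissonCoeff a b (Real.sin (θ / 2) * Real.sin (φ / 2))
        (Real.cos (θ / 2) * Real.cos (φ / 2)) n = (2 * n + (a + b + 1)) *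
      (n.factorial * Real.Gamma (n + (a + b + 1)) *
      Real.Gamma (n + a + 1) * Real.Gamma (n + b + 1) *
        (jacobiPoly a b n).eval ((1 - Real.cos θ) / 2) *
          (jacobiPoly a b n).eval ((1 - Real.cos φ) / 2)) := by
    rw [← hB, poissonCoeff]
    simp only [jacobiHom, hs, hc, ← mul_pow, ← pow_mul]
  rw [hsum, ← add_assoc, ← add_assoc]
  calc _ = Real.exp (-t * (n + (a + b + 1) / 2)) *
        (jacobiNormConst a b n * jacobiNormConst a b n) *
        (Real.Gamma (n + a + 1) * Real.Gamma (n + b + 1)) ^ 2 *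
        (jacobiPoly a b n).eval ((1 - Real.cos θ) / 2) *
          (jacobiPoly a b n).eval ((1 - Real.cos φ) / 2) := by ring
    _ = _ := by
      rw [hd]
      field_simp
      ring_nf

end


/-! ### Ultraspherical measures and their moments. -/

noncomputable section

/-- The measure `(1 - u²)^{s-1} du` on `(-1, 1)`. -/
def ultraMeasure (s : ℝ) : Measure ℝ :=
  (volume.restrict (Ioo (-1) 1)).withDensity fun u => ENNReal.ofReal ((1 - u ^ 2) ^ (s - 1))

theorem integral_beta_real {p q : ℝ} (hp : 0 < p) (hq : 0 < q) :
    ∫ x in (0 : ℝ)..1, x ^ (p - 1) * (1 - x) ^ (q - 1) =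
      Real.Gamma p * Real.Gamma q / Real.Gamma (p + q) := by
  have h := Complex.betaIntegral_eq_Gamma_mul_div p q (by simpa) (by simpa)
  have e : Complex.betaIntegral p q =
      ((∫ x in (0 : ℝ)..1, x ^ (p - 1) * (1 - x) ^ (q - 1) : ℝ) : ℂ) := by
    rw [Complex.betaIntegral, ← intervalIntegral.integral_ofReal]
    refine intervalIntegral.integral_congr fun x hx => ?_
    rw [uIcc_of_le zero_le_one] at hx
    rw [Complex.ofReal_mul, Complex.ofReal_cpow hx.1, Complex.ofReal_cpow (sub_nonneg.2 hx.2)]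
    push_cast
    rfl
  rw [e, ← Complex.ofReal_add, Complex.Gamma_ofReal, Complex.Gamma_ofReal,
    Complex.Gamma_ofReal] at h
  exact_mod_cast h

/-- The substitution x = (1 + u)/2 gives the beta integral with both parameters s, which Legendre's
duplication formula rewrites. -/
theorem integral_one_sub_sq_rpow {s : ℝ} (hs : 0 < s) :
    ∫ u in (-1 : ℝ)..1, (1 - u ^ 2) ^ (s - 1) =
      Real.sqrt Real.pi * Real.Gamma s / Real.Gamma (s + 1 / 2) := by
  have h1 := intervalIntegral.integral_comp_add_div (a := -1) (b := 1)
    (fun x : ℝ => x ^ (s - 1) * (1 - x) ^ (s - 1)) (c := 2) two_ne_zero (1 / 2)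
  norm_num at h1
  rw [integral_beta_real hs hs] at h1
  have e : ∫ u in (-1 : ℝ)..1, (1 / 2 + u / 2) ^ (s - 1) * (1 - (1 / 2 + u / 2)) ^ (s - 1) =
      ∫ u in (-1 : ℝ)..1, (1 / 4) ^ (s - 1) * (1 - u ^ 2) ^ (s - 1) := by
    refine intervalIntegral.integral_congr fun u hu => ?_
    rw [uIcc_of_le (by norm_num)] at hu
    rw [← Real.mul_rpow (by linarith [hu.1]) (by linarith [hu.2]),
      ← Real.mul_rpow (by norm_num) (by nlinarith [hu.1, hu.2])]
    ring_nf
  rw [e, intervalIntegral.integral_const_mul] at h1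
  have hG := Real.Gamma_mul_Gamma_add_half s
  have hg1 := Real.Gamma_pos_of_pos hs
  have hg2 := Real.Gamma_pos_of_pos (by linarith : 0 < s + 1 / 2)
  have hg3 := Real.Gamma_pos_of_pos (by linarith : 0 < 2 * s)
  have e4 : ((1 : ℝ) / 4) ^ (s - 1) = 2 * 2 ^ (1 - 2 * s) := by
    rw [show (1 / 4 : ℝ) = 2 ^ (-2 : ℝ) by rw [Real.rpow_neg (by norm_num)]; norm_num,
      ← Real.rpow_mul (by norm_num)]
    rw [show (-2) * (s - 1) = 1 + (1 - 2 * s) by ring, Real.rpow_add (by norm_num), Real.rpow_one]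
  have hp : (0 : ℝ) < 2 ^ (1 - 2 * s) := by positivity
  rw [e4, ← two_mul s] at h1
  rw [eq_div_iff hg2.ne']
  refine mul_left_cancel₀ (mul_pos hp hg1).ne' ?_
  set J := ∫ u in (-1 : ℝ)..1, (1 - u ^ 2) ^ (s - 1)
  have h2 : 2 ^ (1 - 2 * s) * J * Real.Gamma (2 * s) = Real.Gamma s * Real.Gamma s := by
    have : 2 ^ (1 - 2 * s) * J = Real.Gamma s * Real.Gamma s / Real.Gamma (2 * s) := by linarith
    rw [this]; field_simp
  calc 2 ^ (1 - 2 * s) * Real.Gamma s * (J * Real.Gamma (s + 1 / 2))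
      = 2 ^ (1 - 2 * s) * J * (Real.Gamma s * Real.Gamma (s + 1 / 2)) := by ring
    _ = (2 ^ (1 - 2 * s) * J * Real.Gamma (2 * s)) * (2 ^ (1 - 2 * s) * √Real.pi) := by
        rw [hG]; ring
    _ = _ := by rw [h2]; ring

theorem intervalIntegrable_one_sub_sq_rpow {s : ℝ} (hs : 0 < s) :
    IntervalIntegrable (fun u : ℝ => (1 - u ^ 2) ^ (s - 1)) volume (-1) 1 := by
  -- The integral of a non-integrable function is 0 by convention, so a nonzero value proves
  -- integrability.
  refine intervalIntegral.intervalIntegrable_of_integral_ne_zero ?_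
  rw [integral_one_sub_sq_rpow hs]
  have hg1 := Real.Gamma_pos_of_pos hs
  have hg2 := Real.Gamma_pos_of_pos (by linarith : 0 < s + 1 / 2)
  have := Real.pi_pos
  positivity

theorem measurable_ultraDensity (s : ℝ) :
    Measurable fun u : ℝ => ENNReal.ofReal ((1 - u ^ 2) ^ (s - 1)) := by
  fun_prop

theorem isFiniteMeasure_ultraMeasure {s : ℝ} (hs : 0 < s) : IsFiniteMeasure (ultraMeasure s) := by
  refine isFiniteMeasure_withDensity_ofReal ?_
  have := (intervalIntegrable_iff_integrableOn_Ioo_of_le (by norm_num)).1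
    (intervalIntegrable_one_sub_sq_rpow hs)
  exact this.hasFiniteIntegral

theorem ae_ultraMeasure_mem (s : ℝ) : ∀ᵐ u ∂ultraMeasure s, u ∈ Ioo (-1 : ℝ) 1 :=
  (withDensity_absolutelyContinuous _ _).ae_le (ae_restrict_mem measurableSet_Ioo)

instance (s : ℝ) : SFinite (ultraMeasure s) := by
  unfold ultraMeasure; infer_instance

theorem ae_ultraMeasure_prod_mem (s s' : ℝ) :
    ∀ᵐ p ∂(ultraMeasure s).prod (ultraMeasure s'),
      p.1 ∈ Ioo (-1 : ℝ) 1 ∧ p.2 ∈ Ioo (-1 : ℝ) 1 :=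
  (Measure.quasiMeasurePreserving_fst.ae (ae_ultraMeasure_mem s)).and
    (Measure.quasiMeasurePreserving_snd.ae (ae_ultraMeasure_mem s'))

theorem integral_ultraMeasure (s : ℝ) (f : ℝ → ℝ) :
    ∫ u, f u ∂ultraMeasure s = ∫ u in (-1 : ℝ)..1, (1 - u ^ 2) ^ (s - 1) * f u := by
  rw [ultraMeasure, integral_withDensity_eq_integral_toReal_smul (measurable_ultraDensity s)
    (by simp), intervalIntegral.integral_of_le (by norm_num), integral_Ioc_eq_integral_Ioo]
  refine setIntegral_congr_fun measurableSet_Ioo fun u hu => ?_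
  have : 0 ≤ 1 - u ^ 2 := by nlinarith [hu.1, hu.2]
  simp only [smul_eq_mul]
  rw [ENNReal.toReal_ofReal (by positivity)]

theorem integrable_ultraMeasure_of_bound {s : ℝ} (hs : 0 < s) {f : ℝ → ℝ} (hf : Measurable f)
    {C : ℝ} (hC : ∀ u ∈ Ioo (-1 : ℝ) 1, |f u| ≤ C) : Integrable f (ultraMeasure s) := by
  have := isFiniteMeasure_ultraMeasure hs
  exact Integrable.of_bound hf.aestronglyMeasurable C
    ((ae_ultraMeasure_mem s).mono fun u hu => hC u hu)

theorem integrable_ultraMeasure_prod_of_bound {s s' : ℝ} (hs : 0 < s) (hs' : 0 < s')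
    {f : ℝ × ℝ → ℝ} (hf : Measurable f)
    {C : ℝ} (hC : ∀ u ∈ Ioo (-1 : ℝ) 1, ∀ v ∈ Ioo (-1 : ℝ) 1, |f (u, v)| ≤ C) :
    Integrable f ((ultraMeasure s).prod (ultraMeasure s')) := by
  have := isFiniteMeasure_ultraMeasure hs
  have := isFiniteMeasure_ultraMeasure hs'
  exact Integrable.of_bound hf.aestronglyMeasurable C
    ((ae_ultraMeasure_prod_mem s s').mono fun p hp => hC p.1 hp.1 p.2 hp.2)

theorem integral_pow_odd_ultraMeasure (s : ℝ) {m : ℕ} (hm : Odd m) :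
    ∫ u, u ^ m ∂ultraMeasure s = 0 := by
  rw [integral_ultraMeasure]
  have h := intervalIntegral.integral_comp_neg (a := -1) (b := 1)
    (fun u : ℝ => (1 - u ^ 2) ^ (s - 1) * u ^ m)
  simp only [neg_neg, hm.neg_pow, even_two.neg_pow, mul_neg, intervalIntegral.integral_neg] at h
  linarith

theorem integral_pow_even_ultraMeasure {s : ℝ} (hs : 0 < s) (m : ℕ) :
    ∫ u, u ^ (2 * m) ∂ultraMeasure s =
      Real.Gamma (m + 1 / 2) * Real.Gamma s / Real.Gamma (m + s + 1 / 2) := by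
  induction m with
  | zero =>
    rw [integral_ultraMeasure]
    simp only [mul_zero, pow_zero, mul_one, Nat.cast_zero, zero_add]
    rw [integral_one_sub_sq_rpow hs, Real.Gamma_one_half_eq]
  | succ m ih =>
    have hint : ∀ k : ℕ, Integrable (fun u : ℝ => u ^ k) (ultraMeasure s) := fun k =>
      integrable_ultraMeasure_of_bound hs (by fun_prop) (C := 1) fun u hu => by
        rw [abs_pow]; exact pow_le_one₀ (abs_nonneg _) (abs_le.2 ⟨hu.1.le, hu.2.le⟩)
    -- This integrand against the density is the derivative of u^(2m + 1) (1 - u²)^s, which vanishes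
    -- at both ends. It yields the recursion between consecutive even moments.
    have key : ∫ u, ((2 * m + 1) * u ^ (2 * m) - (2 * m + 1 + 2 * s) * u ^ (2 * (m + 1)))
        ∂ultraMeasure s = 0 := by
      rw [integral_ultraMeasure]
      have := intervalIntegral.integral_eq_sub_of_hasDerivAt_of_le (a := -1) (b := 1)
        (f := fun u : ℝ => u ^ (2 * m + 1) * (1 - u ^ 2) ^ s)
        (f' := fun u => (1 - u ^ 2) ^ (s - 1) *
          ((2 * m + 1) * u ^ (2 * m) - (2 * m + 1 + 2 * s) * u ^ (2 * (m + 1))))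
        (by norm_num) ?_ ?_ ?_
      · rw [this]
        simp [Real.zero_rpow hs.ne']
      · exact (by fun_prop : Continuous fun u : ℝ => u ^ (2 * m + 1)).continuousOn.mul
          (((by fun_prop : Continuous fun u : ℝ => 1 - u ^ 2).rpow_const
            fun _ => Or.inr hs.le).continuousOn)
      · intro u hu
        have hpos : 0 < 1 - u ^ 2 := by nlinarith [hu.1, hu.2]
        have h1 := (hasDerivAt_pow (2 * m + 1) u).mul
          (((hasDerivAt_pow 2 u).const_sub 1).rpow_const (p := s) (Or.inl hpos.ne'))
        refine h1.congr_deriv ?_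
        have : (1 - u ^ 2) ^ s = (1 - u ^ 2) ^ (s - 1) * (1 - u ^ 2) := by
          rw [← Real.rpow_add_one hpos.ne']; simp
        rw [this]
        push_cast
        ring
      · refine (intervalIntegrable_one_sub_sq_rpow hs).mul_continuousOn ?_
        fun_prop
    rw [integral_sub ((hint _).const_mul _) ((hint _).const_mul _), integral_const_mul,
      integral_const_mul, ih] at key
    have h1 : (0 : ℝ) < m + s + 1 / 2 := by positivity
    have h2 : (0 : ℝ) < (m : ℝ) + 1 / 2 := by positivity
    push_cast
    rw [show (m : ℝ) + 1 + 1 / 2 = (m + 1 / 2) + 1 by ring,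
      show (m : ℝ) + 1 + s + 1 / 2 = (m + s + 1 / 2) + 1 by ring,
      Real.Gamma_add_one h1.ne', Real.Gamma_add_one h2.ne']
    have hG := Real.Gamma_pos_of_pos h1
    rw [eq_div_iff (by positivity)]
    have h3 : (2 * m + 1 + 2 * s) * ∫ u, u ^ (2 * (m + 1)) ∂ultraMeasure s =
        (2 * m + 1) * (Real.Gamma (m + 1 / 2) * Real.Gamma s / Real.Gamma (m + s + 1 / 2)) := by
      linarith
    have h4 : (m + s + 1 / 2) * ∫ u, u ^ (2 * (m + 1)) ∂ultraMeasure s =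
        (m + 1 / 2) * (Real.Gamma (m + 1 / 2) * Real.Gamma s / Real.Gamma (m + s + 1 / 2)) := by
      linarith
    calc (∫ u, u ^ (2 * (m + 1)) ∂ultraMeasure s) * ((m + s + 1 / 2) * Real.Gamma (m + s + 1 / 2))
        = ((m + s + 1 / 2) * ∫ u, u ^ (2 * (m + 1)) ∂ultraMeasure s) *
            Real.Gamma (m + s + 1 / 2) := by ring
      _ = _ := by rw [h4]; field_simp

theorem Gamma_natCast_add_half (m : ℕ) :
    Real.Gamma (m + 1 / 2) = (2 * m).factorial * Real.sqrt Real.pi / (4 ^ m * m.factorial) := by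
  induction m with
  | zero => simpa using Real.Gamma_one_half_eq
  | succ m ih =>
    have h2 : (0 : ℝ) < (m : ℝ) + 1 / 2 := by positivity
    push_cast
    rw [show (m : ℝ) + 1 + 1 / 2 = (m + 1 / 2) + 1 by ring, Real.Gamma_add_one h2.ne', ih,
      show 2 * (m + 1) = 2 * m + 1 + 1 by ring, Nat.factorial_succ, Nat.factorial_succ,
      Nat.factorial_succ, pow_succ]
    push_cast
    field_simp
    ring

/-- The moments of `u X + v Y`. -/
theorem integral_linear_pow_even {a b : ℝ} (ha : -(1 / 2) < a) (hb : -(1 / 2) < b) (X Y : ℝ)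
    (k : ℕ) :
    ∫ p : ℝ × ℝ, (p.1 * X + p.2 * Y) ^ (2 * k)
        ∂(ultraMeasure (a + 1 / 2)).prod (ultraMeasure (b + 1 / 2)) =
      (2 * k).factorial * (Real.pi * Real.Gamma (a + 1 / 2) * Real.Gamma (b + 1 / 2)) / 4 ^ k *
        jacobiHom a b X Y k := by
  have hs : 0 < a + 1 / 2 := by linarith
  have hs' : 0 < b + 1 / 2 := by linarith
  have hint : ∀ s : ℝ, 0 < s → ∀ k : ℕ, Integrable (fun u : ℝ => u ^ k) (ultraMeasure s) :=
    fun s hs k => integrable_ultraMeasure_of_bound hs (by fun_prop) (C := 1) fun u hu => by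
      rw [abs_pow]; exact pow_le_one₀ (abs_nonneg _) (abs_le.2 ⟨hu.1.le, hu.2.le⟩)
  have e1 : ∀ p : ℝ × ℝ, (p.1 * X + p.2 * Y) ^ (2 * k) =
      ∑ m ∈ Finset.HasAntidiagonal.antidiagonal (2 * k),
        ((2 * k).choose m.1 * X ^ m.1 * Y ^ m.2) * (p.1 ^ m.1 * p.2 ^ m.2) := by
    intro p
    rw [(Commute.all _ _).add_pow']
    refine Finset.sum_congr rfl fun m _ => ?_
    rw [nsmul_eq_mul, mul_pow, mul_pow]
    ring
  simp_rw [e1]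
  rw [integral_finsetSum _ fun m _ => Integrable.const_mul
    ((hint _ hs m.1).mul_prod (hint _ hs' m.2)) _]
  have e2 : ∀ (c : ℝ) (m : ℕ × ℕ), ∫ p : ℝ × ℝ, c * (p.1 ^ m.1 * p.2 ^ m.2)
      ∂(ultraMeasure (a + 1 / 2)).prod (ultraMeasure (b + 1 / 2)) =
      c * ((∫ u, u ^ m.1 ∂ultraMeasure (a + 1 / 2)) * ∫ v, v ^ m.2 ∂ultraMeasure (b + 1 / 2)) :=
    fun c m => by
      rw [integral_const_mul, integral_prod_mul (fun u : ℝ => u ^ m.1) (fun u : ℝ => u ^ m.2)]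
  rw [Finset.sum_congr rfl fun m _ => e2 _ m]
  have hinj : Function.Injective fun p : ℕ × ℕ => (2 * p.1, 2 * p.2) := by
    rintro ⟨a, b⟩ ⟨c, d⟩ h
    simpa using h
  -- In the binomial expansion, pairs of odd exponents contribute 0 by parity; the even pairs are
  -- the doubles of the pairs with sum k.
  rw [← Finset.sum_subset (s₁ := (Finset.HasAntidiagonal.antidiagonal k).map ⟨_, hinj⟩),
    Finset.sum_map, jacobiHom, Finset.mul_sum]
  · refine Finset.sum_congr rfl fun m hm => ?_
    have hk : m.1 + m.2 = k := Finset.HasAntidiagonal.mem_antidiagonal.1 hm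
    rw [Function.Embedding.coeFn_mk, integral_pow_even_ultraMeasure hs, integral_pow_even_ultraMeasure hs',
      Gamma_natCast_add_half, Gamma_natCast_add_half, jacobiCoeff,
      show (m.1 : ℝ) + (a + 1 / 2) + 1 / 2 = m.1 + a + 1 by ring,
      show (m.2 : ℝ) + (b + 1 / 2) + 1 / 2 = m.2 + b + 1 by ring]
    have hga := Gamma_natCast_add_pos (by linarith : -1 < a) m.1
    have hgb := Gamma_natCast_add_pos (by linarith : -1 < b) m.2
    have hch : ((2 * k).factorial : ℝ) = (2 * k).choose (2 * m.1) * (2 * m.1).factorial *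
        (2 * m.2).factorial := by
      have := Nat.choose_mul_factorial_mul_factorial (n := 2 * k) (k := 2 * m.1) (by omega)
      rw [show 2 * k - 2 * m.1 = 2 * m.2 by omega] at this
      rw [← this]
      push_cast
      ring
    rw [hch, ← hk, pow_add]
    field_simp
    rw [Real.sq_sqrt Real.pi_pos.le]
    ring
  · intro p hp
    simp only [Finset.mem_map, Function.Embedding.coeFn_mk,
      Finset.HasAntidiagonal.mem_antidiagonal] at hp ⊢
    obtain ⟨q, hq, rfl⟩ := hp
    simp only
    omega
  · rintro ⟨i, j⟩ hp hne
    simp only [Finset.HasAntidiagonal.mem_antidiagonal] at hp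
    rcases Nat.even_or_odd i with hi | hi
    · exfalso
      apply hne
      obtain ⟨r, rfl⟩ := hi
      simp only [Finset.mem_map, Function.Embedding.coeFn_mk,
        Finset.HasAntidiagonal.mem_antidiagonal]
      refine ⟨(r, k - r), ?_, ?_⟩
      · simp only; omega
      · ext
        · simp only; omega
        · simp only; omega
    · simp only
      rw [integral_pow_odd_ultraMeasure _ hi]
      ring

theorem integral_linear_pow_odd {a b : ℝ} (ha : -(1 / 2) < a) (hb : -(1 / 2) < b) (X Y : ℝ)
    {k : ℕ} (hk : Odd k) :
    ∫ p : ℝ × ℝ, (p.1 * X + p.2 * Y) ^ k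
        ∂(ultraMeasure (a + 1 / 2)).prod (ultraMeasure (b + 1 / 2)) = 0 := by
  have hs : 0 < a + 1 / 2 := by linarith
  have hs' : 0 < b + 1 / 2 := by linarith
  have hint : ∀ s : ℝ, 0 < s → ∀ k : ℕ, Integrable (fun u : ℝ => u ^ k) (ultraMeasure s) :=
    fun s hs k => integrable_ultraMeasure_of_bound hs (by fun_prop) (C := 1) fun u hu => by
      rw [abs_pow]; exact pow_le_one₀ (abs_nonneg _) (abs_le.2 ⟨hu.1.le, hu.2.le⟩)
  have e1 : ∀ p : ℝ × ℝ, (p.1 * X + p.2 * Y) ^ k =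
      ∑ m ∈ Finset.HasAntidiagonal.antidiagonal k,
        (k.choose m.1 * X ^ m.1 * Y ^ m.2) * (p.1 ^ m.1 * p.2 ^ m.2) := by
    intro p
    rw [(Commute.all _ _).add_pow']
    refine Finset.sum_congr rfl fun m _ => ?_
    rw [nsmul_eq_mul, mul_pow, mul_pow]
    ring
  simp_rw [e1]
  rw [integral_finsetSum _ fun m _ => Integrable.const_mul
    ((hint _ hs m.1).mul_prod (hint _ hs' m.2)) _]
  refine Finset.sum_eq_zero fun m hm => ?_
  rw [integral_const_mul, integral_prod_mul (fun u : ℝ => u ^ m.1) (fun u : ℝ => u ^ m.2)]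
  have hm' : m.1 + m.2 = k := Finset.HasAntidiagonal.mem_antidiagonal.1 hm
  rcases Nat.even_or_odd m.1 with hi | hi
  · have : Odd m.2 := by
      rw [← hm'] at hk
      by_contra h
      exact (Nat.not_odd_iff_even.2 (hi.add (Nat.not_odd_iff_even.1 h))) hk
    rw [integral_pow_odd_ultraMeasure _ this]
    ring
  · rw [integral_pow_odd_ultraMeasure _ hi]
    ring

end


/-! ### The generating function for small z. -/

noncomputable section

theorem abs_linear_le_one {X Y : ℝ} (hX : 0 ≤ X) (hY : 0 ≤ Y) (hXY : X + Y ≤ 1) {u v : ℝ}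
    (hu : u ∈ Icc (-1 : ℝ) 1) (hv : v ∈ Icc (-1 : ℝ) 1) : |u * X + v * Y| ≤ 1 := by
  rw [abs_le]
  constructor
  · nlinarith [mul_le_mul_of_nonneg_right hu.1 hX, mul_le_mul_of_nonneg_right hv.1 hY]
  · nlinarith [mul_le_mul_of_nonneg_right hu.2 hX, mul_le_mul_of_nonneg_right hv.2 hY]

/-- The binomial series of (1 - κ(uX + vY))^(-(a + b + 2)) is integrated term by term. It is
dominated because |uX + vY| ≤ 1 and κ < 1, and the odd moments vanish. -/
theorem hasSum_jacobiHom {a b : ℝ} (ha : -(1 / 2) < a) (hb : -(1 / 2) < b) {X Y : ℝ}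
    (hX : 0 ≤ X) (hY : 0 ≤ Y) (hXY : X + Y ≤ 1) {κ : ℝ} (hκ : 0 ≤ κ) (hκ1 : κ < 1) :
    HasSum (fun k : ℕ => Real.pi * Real.Gamma (a + 1 / 2) * Real.Gamma (b + 1 / 2) *
        (Real.Gamma (a + b + 2 + 2 * k) * (κ / 2) ^ (2 * k) * jacobiHom a b X Y k))
      (∫ p : ℝ × ℝ, Real.Gamma (a + b + 2) * (1 - κ * (p.1 * X + p.2 * Y)) ^ (-(a + b + 2))
        ∂(ultraMeasure (a + 1 / 2)).prod (ultraMeasure (b + 1 / 2))) := by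
  have hs : 0 < a + 1 / 2 := by linarith
  have hs' : 0 < b + 1 / 2 := by linarith
  have hlam : 0 < a + b + 2 := by linarith
  have := isFiniteMeasure_ultraMeasure hs
  have := isFiniteMeasure_ultraMeasure hs'
  set μ := (ultraMeasure (a + 1 / 2)).prod (ultraMeasure (b + 1 / 2)) with hμ
  let F : ℕ → ℝ × ℝ → ℝ := fun k p =>
    Real.Gamma (a + b + 2 + k) / k.factorial * (κ * (p.1 * X + p.2 * Y)) ^ k
  have hbd : ∀ k, ∀ u ∈ Ioo (-1 : ℝ) 1, ∀ v ∈ Ioo (-1 : ℝ) 1, |F k (u, v)| ≤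
      Real.Gamma (a + b + 2 + k) / k.factorial * κ ^ k := by
    intro k u hu v hv
    have hG : 0 < Real.Gamma (a + b + 2 + k) := Real.Gamma_pos_of_pos (by positivity)
    simp only [F]
    rw [abs_mul, abs_of_nonneg (by positivity), abs_pow, abs_mul, abs_of_nonneg hκ]
    have := abs_linear_le_one hX hY hXY (Ioo_subset_Icc_self hu) (Ioo_subset_Icc_self hv)
    gcongr
    nlinarith
  have hint : ∀ k, Integrable (F k) μ := fun k =>
    integrable_ultraMeasure_prod_of_bound hs hs' (by fun_prop) (hbd k)
  have hbinom := hasSum_Gamma_binomial hlam (r := κ) (by rwa [abs_of_nonneg hκ])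
  have hsum : Summable fun k => ∫ p, ‖F k p‖ ∂μ := by
    refine Summable.of_nonneg_of_le (fun k => integral_nonneg fun _ => norm_nonneg _)
      (fun k => ?_) (hbinom.summable.mul_right (μ.real univ))
    calc ∫ p, ‖F k p‖ ∂μ
        ≤ ∫ _p, Real.Gamma (a + b + 2 + k) / k.factorial * κ ^ k ∂μ :=
          integral_mono_ae (hint k).norm (integrable_const _)
            ((ae_ultraMeasure_prod_mem _ _).mono fun p hp => hbd k p.1 hp.1 p.2 hp.2)
      _ = _ := by rw [integral_const, smul_eq_mul, mul_comm]
  have h1 := hasSum_integral_of_summable_integral_norm hint hsum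
  have h2 : ∫ p, ∑' k, F k p ∂μ =
      ∫ p : ℝ × ℝ, Real.Gamma (a + b + 2) * (1 - κ * (p.1 * X + p.2 * Y)) ^ (-(a + b + 2)) ∂μ := by
    refine integral_congr_ae ((ae_ultraMeasure_prod_mem _ _).mono fun p hp => ?_)
    have hw := abs_linear_le_one hX hY hXY (Ioo_subset_Icc_self hp.1) (Ioo_subset_Icc_self hp.2)
    refine (hasSum_Gamma_binomial hlam ?_).tsum_eq
    rw [abs_mul, abs_of_nonneg hκ]
    nlinarith
  rw [h2] at h1
  rw [← (mul_right_injective₀ (two_ne_zero (α := ℕ))).hasSum_iff] at h1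
  · refine h1.congr_fun fun k => ?_
    simp only [Function.comp_apply, F]
    simp_rw [mul_pow κ]
    rw [integral_const_mul, integral_const_mul, integral_linear_pow_even ha hb, div_pow,
      pow_mul 2 2 k]
    push_cast
    have h4 : (2 : ℝ) ^ 2 = 4 := by norm_num
    rw [h4]
    field_simp
  · intro k hk
    have hodd : Odd k := by
      rw [← Nat.not_even_iff_odd]
      rintro ⟨r, rfl⟩
      exact hk ⟨r, by simp; ring⟩
    simp only [F]
    simp_rw [mul_pow κ]
    rw [integral_const_mul, integral_const_mul, integral_linear_pow_odd ha hb _ _ hodd]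
    ring

theorem jacobiHom_nonneg {a b : ℝ} (ha : -1 < a) (hb : -1 < b) (X Y : ℝ) (k : ℕ) :
    0 ≤ jacobiHom a b X Y k :=
  Finset.sum_nonneg fun p _ => by
    have := jacobiCoeff_pos ha hb p.1 p.2
    rw [pow_mul, pow_mul]
    positivity

theorem hasSum_sum_antidiagonal {F : ℕ × ℕ → ℝ} {S : ℝ} (h : HasSum F S) :
    HasSum (fun n => ∑ p ∈ Finset.HasAntidiagonal.antidiagonal n, F p) S :=
  (Finset.HasAntidiagonal.sigmaAntidiagonalEquivProd.hasSum_iff.2 h).sigma fun n =>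
    (Finset.HasAntidiagonal.antidiagonal n).hasSum F

/-- The generating function of the coefficients of the Poisson kernel, near `0`. -/
theorem hasSum_poissonCoeff_of_small {a b : ℝ} (ha : -(1 / 2) < a) (hb : -(1 / 2) < b) {X Y : ℝ}
    (hX : 0 ≤ X) (hY : 0 ≤ Y) (hXY : X + Y ≤ 1) {z : ℝ} (hz : 0 ≤ z) (hz1 : z ≤ 2 / 5) :
    HasSum (fun n : ℕ => Real.pi * Real.Gamma (a + 1 / 2) * Real.Gamma (b + 1 / 2) *
        (poissonCoeff a b X Y n * z ^ (2 * n)))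
      (Real.Gamma (a + b + 2) * ((1 - z ^ 2) *
        ∫ p : ℝ × ℝ, (1 + z ^ 2 - 2 * z * (p.1 * X + p.2 * Y)) ^ (-(a + b + 2))
          ∂(ultraMeasure (a + 1 / 2)).prod (ultraMeasure (b + 1 / 2)))) := by
  have hz2 : z ^ 2 ≤ 4 / 25 := by nlinarith
  set r := z ^ 2 with hr
  have hr0 : 0 ≤ r := by positivity
  set P := Real.pi * Real.Gamma (a + 1 / 2) * Real.Gamma (b + 1 / 2) with hP
  have hP0 : 0 < P := by
    have h1 := Real.Gamma_pos_of_pos (by linarith : 0 < a + 1 / 2)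
    have h2 := Real.Gamma_pos_of_pos (by linarith : 0 < b + 1 / 2)
    have := Real.pi_pos
    positivity
  set μ := (ultraMeasure (a + 1 / 2)).prod (ultraMeasure (b + 1 / 2)) with hμ
  set H := jacobiHom a b X Y with hH
  have hH0 : ∀ k, 0 ≤ H k := jacobiHom_nonneg (by linarith) (by linarith) X Y
  set c : ℕ → ℝ := fun k => 2 * k + (a + b + 1) with hc
  have hc0 : ∀ k, 0 < c k := fun k => by
    have : (0 : ℝ) ≤ k := by positivity
    simp only [hc]; linarith
  -- The double series is indexed by (k, i) with n = k + i. For fixed k the sum over i is a binomial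
  -- series in -r with parameter c k = 2k + a + b + 1.
  let F : ℕ × ℕ → ℝ := fun p => H p.1 * r ^ p.1 *
    ((c p.1 + 2 * p.2) * (Real.Gamma (c p.1 + p.2) / p.2.factorial) * (-r) ^ p.2)
  have hinner : ∀ k, HasSum (fun i => F (k, i))
      (H k * r ^ k * (Real.Gamma (c k + 1) * (1 - r) * (1 + r) ^ (-(c k + 1)))) := by
    intro k
    have := (hasSum_Gamma_binomial_two_mul (hc0 k) (r := -r)
      (by rw [abs_neg, abs_of_nonneg hr0]; linarith)).mul_left (H k * r ^ k)
    simpa [F, sub_eq_add_neg] using this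
  have hnorm : ∀ k, HasSum (fun i => ‖F (k, i)‖)
      (H k * r ^ k * (Real.Gamma (c k + 1) * (1 + r) * (1 - r) ^ (-(c k + 1)))) := by
    intro k
    have := (hasSum_Gamma_binomial_two_mul (hc0 k) (r := r)
      (by rw [abs_of_nonneg hr0]; linarith)).mul_left (H k * r ^ k)
    refine this.congr_fun fun i => ?_
    have h1 := hc0 k
    have hG : 0 < Real.Gamma (c k + i) := Real.Gamma_pos_of_pos (by positivity)
    have h2 := hH0 k
    simp only [F]
    rw [norm_mul, norm_mul (_ * _) ((-r) ^ i), norm_pow, norm_neg,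
      Real.norm_of_nonneg (by positivity), Real.norm_of_nonneg (by positivity),
      Real.norm_of_nonneg hr0]
  have hrw : ∀ (k : ℕ) (ε : ℝ), 0 < 1 + ε → r ^ k * (1 + ε) ^ (-(c k + 1)) =
      (1 + ε) ^ (-(a + b + 2)) * ((2 * z / (1 + ε)) / 2) ^ (2 * k) := by
    intro k ε hε
    have : -(c k + 1) = -(a + b + 2) + -((2 * k : ℕ) : ℝ) := by
      simp only [hc]; push_cast; ring
    rw [this, Real.rpow_add hε, Real.rpow_neg hε.le ((2 * k : ℕ) : ℝ), Real.rpow_natCast, hr,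
      ← pow_mul, show 2 * z / (1 + ε) / 2 = z / (1 + ε) by ring, div_pow]
    ring
  have hcG : ∀ k, c k + 1 = a + b + 2 + 2 * k := fun k => by simp only [hc]; ring
  have hsumm : Summable F := by
    rw [← summable_norm_iff]
    refine (summable_prod_of_nonneg fun _ => norm_nonneg _).2
      ⟨fun k => (hnorm k).summable, ?_⟩
    -- Taking absolute values replaces 1 + z² by 1 - z², so absolute summability needs 2z/(1 - z²) <
    -- 1, that is z < √2 - 1. This is why z is restricted to z ≤ 2/5.
    have h1 := hasSum_jacobiHom ha hb hX hY hXY (κ := 2 * z / (1 + -r))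
      (div_nonneg (by positivity) (by linarith)) (by rw [div_lt_one (by linarith)]; linarith)
    simp only [← hP, ← hH] at h1
    have h2 := h1.summable.mul_left ((1 + r) * (1 + -r) ^ (-(a + b + 2)) / P)
    refine h2.congr fun k => ?_
    rw [(hnorm k).tsum_eq]
    have := hrw k (-r) (by linarith)
    rw [← hcG, sub_eq_add_neg]
    calc _ = ((1 + -r) ^ (-(a + b + 2)) * (2 * z / (1 + -r) / 2) ^ (2 * k)) *
          (H k * Real.Gamma (c k + 1) * (1 + r)) := by field_simp
      _ = _ := by rw [← this]; ring
  have houter := hsumm.hasSum.prod_fiberwise hinner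
  -- The signed sum has κ = 2z/(1 + z²), and (1 + z²)(1 - κw) = 1 + z² - 2zw produces the generating
  -- integral.
  have h1 := hasSum_jacobiHom ha hb hX hY hXY (κ := 2 * z / (1 + r))
      (by positivity) (by rw [div_lt_one (by linarith)]; linarith)
  simp only [← hP, ← hH] at h1
  have h2 : HasSum (fun k => H k * r ^ k * (Real.Gamma (c k + 1) * (1 - r) *
      (1 + r) ^ (-(c k + 1)))) _ := (h1.mul_left ((1 - r) * (1 + r) ^ (-(a + b + 2)) / P)).congr_fun
    fun k => by
      have := hrw k r (by linarith)
      rw [← hcG]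
      calc _ = (r ^ k * (1 + r) ^ (-(c k + 1))) * (H k * Real.Gamma (c k + 1) * (1 - r)) := by ring
        _ = _ := by rw [this]; field_simp
  have h3 := hasSum_sum_antidiagonal hsumm.hasSum
  rw [houter.unique h2] at h3
  have h4 := h3.mul_left P
  have e1 : P * ((1 - r) * (1 + r) ^ (-(a + b + 2)) / P *
      ∫ p : ℝ × ℝ, Real.Gamma (a + b + 2) *
        (1 - 2 * z / (1 + r) * (p.1 * X + p.2 * Y)) ^ (-(a + b + 2)) ∂μ) =
      Real.Gamma (a + b + 2) * ((1 - r) *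
        ∫ p : ℝ × ℝ, (1 + r - 2 * z * (p.1 * X + p.2 * Y)) ^ (-(a + b + 2)) ∂μ) := by
    have e2 : ∫ p : ℝ × ℝ, (1 + r - 2 * z * (p.1 * X + p.2 * Y)) ^ (-(a + b + 2)) ∂μ =
        ∫ p : ℝ × ℝ, (1 + r) ^ (-(a + b + 2)) *
          (1 - 2 * z / (1 + r) * (p.1 * X + p.2 * Y)) ^ (-(a + b + 2)) ∂μ := by
      refine integral_congr_ae ((ae_ultraMeasure_prod_mem _ _).mono fun p hp => ?_)
      have hw := abs_linear_le_one hX hY hXY (Ioo_subset_Icc_self hp.1)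
        (Ioo_subset_Icc_self hp.2)
      have h5 : 2 * z / (1 + r) ≤ 1 := by rw [div_le_one (by linarith)]; linarith
      have h6 : 0 ≤ 2 * z / (1 + r) := by positivity
      simp only
      rw [← Real.mul_rpow (by linarith) (by nlinarith [abs_le.1 hw])]
      congr 1
      field_simp
    rw [e2, integral_const_mul, integral_const_mul]
    generalize ∫ p : ℝ × ℝ, (1 - 2 * z / (1 + r) * (p.1 * X + p.2 * Y)) ^ (-(a + b + 2)) ∂μ = J
    field_simp
  rw [e1] at h4
  refine h4.congr_fun fun n => ?_
  congr 1
  rw [Finset.Nat.sum_antidiagonal_eq_sum_range_succ_mk, poissonCoeff, mul_assoc, Finset.sum_mul,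
    Finset.mul_sum]
  refine Finset.sum_congr rfl fun k hk => ?_
  obtain ⟨i, rfl⟩ := Nat.exists_eq_add_of_le (Nat.lt_succ_iff.1 (Finset.mem_range.1 hk))
  simp only [F, hc, hH]
  rw [Nat.add_sub_cancel_left, pow_mul, ← hr, pow_add, neg_pow r]
  push_cast
  rw [show (k : ℝ) + i + (a + b + 1) + k = 2 * k + (a + b + 1) + i by ring]
  ring

end


/-! ### Analytic continuation of the generating function to [0, 1). -/

noncomputable section

/-- The imaginary part is 2 Im ζ (Re ζ - w). It vanishes only if ζ is real or Re ζ = w, and in both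
cases the real part is positive inside the unit disc. Hence the principal branch of the power is
holomorphic there. -/
theorem one_add_sq_sub_mem_slitPlane {ζ : ℂ} (hζ : ‖ζ‖ < 1) {w : ℝ} (hw : |w| ≤ 1) :
    1 + ζ ^ 2 - 2 * ζ * w ∈ Complex.slitPlane := by
  have h1 : ζ.re ^ 2 + ζ.im ^ 2 < 1 := by
    have := Complex.sq_norm ζ
    rw [Complex.normSq_apply] at this
    nlinarith [norm_nonneg ζ]
  have hre : (1 + ζ ^ 2 - 2 * ζ * w).re = 1 + (ζ.re ^ 2 - ζ.im ^ 2) - 2 * ζ.re * w := by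
    simp [pow_two]
  have him : (1 + ζ ^ 2 - 2 * ζ * w).im = 2 * (ζ.im * (ζ.re - w)) := by
    simp [pow_two]; ring
  rw [Complex.mem_slitPlane_iff, hre, him]
  by_contra! h
  obtain ⟨h2, h3⟩ := h
  have hw' := abs_le.1 hw
  rcases mul_eq_zero.1 (by linarith : ζ.im * (ζ.re - w) = 0) with h4 | h4
  · rw [h4] at h1 h2
    have h5 : |ζ.re * w| ≤ |ζ.re| := by
      rw [abs_mul]; exact mul_le_of_le_one_right (abs_nonneg _) hw
    have h6 := sq_abs ζ.re
    have h7 : |ζ.re| < 1 := by rw [← sq_lt_one_iff_abs_lt_one]; linarith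
    nlinarith [le_abs_self (ζ.re * w)]
  · have : w = ζ.re := by linarith
    rw [this] at h2
    nlinarith

/-- The generating integral of the Poisson kernel is holomorphic in the unit disc. -/
theorem differentiableOn_generating_integral {s s' : ℝ} (hs : 0 < s) (hs' : 0 < s') (l : ℝ)
    {X Y : ℝ} (hX : 0 ≤ X) (hY : 0 ≤ Y) (hXY : X + Y ≤ 1) :
    DifferentiableOn ℂ (fun ζ : ℂ => (1 - ζ ^ 2) * ∫ p : ℝ × ℝ,
      (1 + ζ ^ 2 - 2 * ζ * ((p.1 * X + p.2 * Y : ℝ) : ℂ)) ^ (-(l : ℂ))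
        ∂(ultraMeasure s).prod (ultraMeasure s')) (Metric.ball 0 1) := by
  intro ζ₀ hζ₀
  refine DifferentiableAt.differentiableWithinAt ?_
  have := isFiniteMeasure_ultraMeasure hs
  have := isFiniteMeasure_ultraMeasure hs'
  refine DifferentiableAt.mul (by fun_prop) ?_
  set μ := (ultraMeasure s).prod (ultraMeasure s')
  obtain ⟨ε, hε, hball⟩ := Metric.nhds_basis_closedBall.mem_iff.1
    (Metric.isOpen_ball.mem_nhds hζ₀)
  let G : ℂ × ℝ → ℂ := fun q => -(l : ℂ) * (1 + q.1 ^ 2 - 2 * q.1 * q.2) ^ (-(l : ℂ) - 1) *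
    (2 * q.1 - 2 * q.2)
  have hslit : ∀ ζ ∈ Metric.closedBall ζ₀ ε, ∀ w : ℝ, |w| ≤ 1 →
      1 + ζ ^ 2 - 2 * ζ * w ∈ Complex.slitPlane := fun ζ hζ w hw =>
    one_add_sq_sub_mem_slitPlane (by simpa using hball hζ) hw
  have hcont : ContinuousOn G (Metric.closedBall ζ₀ ε ×ˢ Icc (-1) 1) := by
    refine ContinuousOn.mul (ContinuousOn.mul continuousOn_const ?_) (by fun_prop)
    refine ContinuousOn.cpow_const (by fun_prop) ?_
    rintro ⟨ζ, w⟩ ⟨hζ, hw⟩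
    exact hslit ζ hζ w (abs_le.2 hw)
  obtain ⟨C, hC⟩ := ((isCompact_closedBall ζ₀ ε).prod isCompact_Icc).exists_bound_of_continuousOn
    hcont
  have hmeas : ∀ ζ ∈ Metric.closedBall ζ₀ ε, ∀ e : ℂ, AEStronglyMeasurable
      (fun p : ℝ × ℝ => (1 + ζ ^ 2 - 2 * ζ * ((p.1 * X + p.2 * Y : ℝ) : ℂ)) ^ e) μ := by
    intro ζ _ e
    exact (by fun_prop : Measurable _).aestronglyMeasurable
  have hwabs : ∀ p : ℝ × ℝ, p.1 ∈ Ioo (-1 : ℝ) 1 ∧ p.2 ∈ Ioo (-1 : ℝ) 1 →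
      |p.1 * X + p.2 * Y| ≤ 1 := fun p hp =>
    abs_linear_le_one hX hY hXY (Ioo_subset_Icc_self hp.1) (Ioo_subset_Icc_self hp.2)
  have h := hasDerivAt_integral_of_dominated_loc_of_deriv_le (μ := μ) (𝕜 := ℂ)
    (F := fun ζ p => (1 + ζ ^ 2 - 2 * ζ * ((p.1 * X + p.2 * Y : ℝ) : ℂ)) ^ (-(l : ℂ)))
    (F' := fun ζ p => G (ζ, p.1 * X + p.2 * Y)) (x₀ := ζ₀) (bound := fun _ => C)
    (s := Metric.closedBall ζ₀ ε) (Metric.closedBall_mem_nhds ζ₀ hε) ?_ ?_ ?_ ?_ ?_ ?_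
  · exact h.2.differentiableAt
  · exact Filter.eventually_of_mem (Metric.closedBall_mem_nhds ζ₀ hε) fun ζ hζ => hmeas ζ hζ _
  · have hc0 : ContinuousOn (fun w : ℝ => (1 + ζ₀ ^ 2 - 2 * ζ₀ * w) ^ (-(l : ℂ))) (Icc (-1) 1) := by
      refine ContinuousOn.cpow_const (by fun_prop) ?_
      intro w hw
      exact hslit ζ₀ (Metric.mem_closedBall_self hε.le) w (abs_le.2 hw)
    obtain ⟨C', hC'⟩ := isCompact_Icc.exists_bound_of_continuousOn hc0
    exact Integrable.of_bound (hmeas ζ₀ (Metric.mem_closedBall_self hε.le) _) C'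
      ((ae_ultraMeasure_prod_mem _ _).mono fun p hp => hC' _ (abs_le.1 (hwabs p hp)))
  · exact ((((hmeas ζ₀ (Metric.mem_closedBall_self hε.le) (-(l : ℂ) - 1)).const_mul _)).mul
      (by fun_prop : Measurable fun p : ℝ × ℝ =>
        2 * ζ₀ - 2 * ((p.1 * X + p.2 * Y : ℝ) : ℂ)).aestronglyMeasurable)
  · refine (ae_ultraMeasure_prod_mem _ _).mono fun p hp ζ hζ => ?_
    exact hC (ζ, _) ⟨hζ, abs_le.1 (hwabs p hp)⟩
  · exact integrable_const _
  · refine (ae_ultraMeasure_prod_mem _ _).mono fun p hp ζ hζ => ?_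
    have h1 : HasDerivAt (fun ζ : ℂ => 1 + ζ ^ 2 - 2 * ζ * ((p.1 * X + p.2 * Y : ℝ) : ℂ))
        (2 * ζ - 2 * ((p.1 * X + p.2 * Y : ℝ) : ℂ)) ζ := by
      exact (((hasDerivAt_pow 2 ζ).const_add 1).sub
        (((hasDerivAt_id ζ).const_mul 2).mul_const ((p.1 * X + p.2 * Y : ℝ) : ℂ))).congr_deriv
          (by simp)
    exact h1.cpow_const (hslit ζ hζ _ (hwabs p hp))

theorem generating_integral_ofReal {s s' : ℝ} (l : ℝ)
    {X Y : ℝ} (hX : 0 ≤ X) (hY : 0 ≤ Y) (hXY : X + Y ≤ 1) (z : ℝ) :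
    (1 - (z : ℂ) ^ 2) * ∫ p : ℝ × ℝ,
      (1 + (z : ℂ) ^ 2 - 2 * z * ((p.1 * X + p.2 * Y : ℝ) : ℂ)) ^ (-(l : ℂ))
        ∂(ultraMeasure s).prod (ultraMeasure s') =
      (((1 - z ^ 2) * ∫ p : ℝ × ℝ, (1 + z ^ 2 - 2 * z * (p.1 * X + p.2 * Y)) ^ (-l)
        ∂(ultraMeasure s).prod (ultraMeasure s') : ℝ) : ℂ) := by
  rw [Complex.ofReal_mul, ← integral_complex_ofReal]
  push_cast
  congr 1
  refine integral_congr_ae ((ae_ultraMeasure_prod_mem _ _).mono fun p hp => ?_)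
  have hw := abs_linear_le_one hX hY hXY (Ioo_subset_Icc_self hp.1) (Ioo_subset_Icc_self hp.2)
  have hz2 : |z * (p.1 * X + p.2 * Y)| ≤ |z| := by
    rw [abs_mul]; exact mul_le_of_le_one_right (abs_nonneg _) hw
  have hpos : 0 ≤ 1 + z ^ 2 - 2 * z * (p.1 * X + p.2 * Y) := by
    nlinarith [le_abs_self (z * (p.1 * X + p.2 * Y)), sq_abs z, sq_nonneg (1 - |z|)]
  simp only
  rw [Complex.ofReal_cpow hpos]
  push_cast
  rfl

/-- A power series that represents a holomorphic function on `[0, r]` represents it on `[0, 1)`. -/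
theorem hasSum_of_differentiableOn_ball {f : ℂ → ℂ} (hf : DifferentiableOn ℂ f (Metric.ball 0 1))
    {c : ℕ → ℝ} {r : ℝ} (hr : 0 < r)
    (h : ∀ z : ℝ, 0 ≤ z → z ≤ r → HasSum (fun n => (c n : ℂ) * (z : ℂ) ^ n) (f z))
    {z : ℝ} (hz : 0 ≤ z) (hz1 : z < 1) :
    HasSum (fun n => (c n : ℂ) * (z : ℂ) ^ n) (f z) := by
  obtain ⟨R, hzR, hR1⟩ := exists_between hz1
  have hR0 : 0 < R := hz.trans_lt hzR
  lift R to NNReal using hR0.le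
  have hp := (hf.mono (Metric.closedBall_subset_ball hR1)).hasFPowerSeriesOnBall
    (by exact_mod_cast hR0)
  set p := cauchyPowerSeries f 0 R
  set q : FormalMultilinearSeries ℂ ℂ ℂ := .ofScalars ℂ fun n => (c n : ℂ) with hq
  have hrad : (0 : ENNReal) < q.radius := by
    have h1 := (h r hr.le le_rfl).summable.norm
    have h2 : (ENNReal.ofReal r) ≤ q.radius := by
      refine q.le_radius_of_summable_norm (r := r.toNNReal) ?_
      refine h1.congr fun n => ?_
      rw [hq, FormalMultilinearSeries.ofScalars_norm, norm_mul, norm_pow, Complex.norm_real r,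
        Real.norm_of_nonneg hr.le, Real.coe_toNNReal _ hr.le]
    exact (ENNReal.ofReal_pos.2 hr).trans_le h2
  have hqs := q.hasFPowerSeriesOnBall hrad
  have hq_eq : ∀ z : ℝ, 0 ≤ z → z ≤ r → q.sum z = f z := by
    intro z hz hzr
    rw [← (h z hz hzr).tsum_eq, FormalMultilinearSeries.sum]
    refine tsum_congr fun n => ?_
    rw [hq, FormalMultilinearSeries.ofScalars_apply_eq]
    simp
  -- Agreement is known only on a real segment, but its points accumulate at 0, which is enough for
  -- the identity theorem. The given coefficients are then those of the Cauchy power series.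
  have hfreq : ∃ᶠ ζ in nhdsWithin (0 : ℂ) {0}ᶜ, f ζ = q.sum ζ := by
    have ht : Filter.Tendsto (fun x : ℝ => (x : ℂ)) (nhdsWithin 0 (Ioi 0))
        (nhdsWithin (0 : ℂ) {0}ᶜ) := by
      refine tendsto_nhdsWithin_iff.2 ⟨?_, ?_⟩
      · exact (Complex.continuous_ofReal.tendsto' 0 0 (by simp)).mono_left nhdsWithin_le_nhds
      · filter_upwards [self_mem_nhdsWithin] with x hx
        simpa using (ne_of_gt hx : x ≠ 0)
    refine ht.frequently (Filter.Eventually.frequently ?_)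
    filter_upwards [Ioc_mem_nhdsGT hr] with x hx
    exact (hq_eq x hx.1.le hx.2).symm
  have hev := (hp.analyticAt.frequently_eq_iff_eventually_eq hqs.analyticAt).1 hfreq
  have hpq : p = q := hp.hasFPowerSeriesAt.eq_formalMultilinearSeries_of_eventually
    hqs.hasFPowerSeriesAt hev
  have hfin := hp.hasSum (y := (z : ℂ)) (by
    simp only [Metric.mem_eball, edist_zero_right, enorm_eq_nnnorm, ENNReal.coe_lt_coe]
    rw [← NNReal.coe_lt_coe]
    simpa [abs_of_nonneg hz] using hzR)
  rw [zero_add] at hfin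
  refine hfin.congr_fun fun n => ?_
  rw [hpq, hq, FormalMultilinearSeries.ofScalars_apply_eq]
  simp

/-- The generating function of the coefficients of the Poisson kernel. -/
theorem hasSum_poissonCoeff {a b : ℝ} (ha : -(1 / 2) < a) (hb : -(1 / 2) < b) {X Y : ℝ}
    (hX : 0 ≤ X) (hY : 0 ≤ Y) (hXY : X + Y ≤ 1) {z : ℝ} (hz : 0 ≤ z) (hz1 : z < 1) :
    HasSum (fun n : ℕ => Real.pi * Real.Gamma (a + 1 / 2) * Real.Gamma (b + 1 / 2) *
        (poissonCoeff a b X Y n * z ^ (2 * n)))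
      (Real.Gamma (a + b + 2) * ((1 - z ^ 2) *
        ∫ p : ℝ × ℝ, (1 + z ^ 2 - 2 * z * (p.1 * X + p.2 * Y)) ^ (-(a + b + 2))
          ∂(ultraMeasure (a + 1 / 2)).prod (ultraMeasure (b + 1 / 2)))) := by
  have hs : 0 < a + 1 / 2 := by linarith
  have hs' : 0 < b + 1 / 2 := by linarith
  set P := Real.pi * Real.Gamma (a + 1 / 2) * Real.Gamma (b + 1 / 2) with hP
  have hf := (differentiableOn_generating_integral hs hs' (a + b + 2) hX hY hXY).const_mul
    ((Real.Gamma (a + b + 2) : ℝ) : ℂ)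
  -- The series in z² is padded with zeros at odd orders to become a power series in z.
  let c : ℕ → ℝ := fun N => if Even N then P * poissonCoeff a b X Y (N / 2) else 0
  have hc : ∀ (z : ℝ) (S : ℝ), HasSum (fun N => (c N : ℂ) * (z : ℂ) ^ N) (S : ℂ) ↔
      HasSum (fun n : ℕ => P * (poissonCoeff a b X Y n * z ^ (2 * n))) S := by
    intro z S
    have h1 : (fun N => (c N : ℂ) * (z : ℂ) ^ N) = fun N => ((c N * z ^ N : ℝ) : ℂ) := by
      ext N; push_cast; rfl
    rw [h1, Complex.hasSum_ofReal,
      ← (mul_right_injective₀ (two_ne_zero (α := ℕ))).hasSum_iff]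
    · have : (fun N => c N * z ^ N) ∘ (fun x => 2 * x) =
          fun n : ℕ => P * (poissonCoeff a b X Y n * z ^ (2 * n)) := by
        ext n
        simp [c, mul_assoc]
      rw [this]
    · intro k hk
      have : ¬ Even k := by
        rintro ⟨r, rfl⟩
        exact hk ⟨r, by simp; ring⟩
      simp [c, this]
  rw [← hc]
  have := hasSum_of_differentiableOn_ball hf (c := c) (r := 2 / 5) (by norm_num) ?_ hz hz1
  · rw [generating_integral_ofReal _ hX hY hXY z] at this
    exact_mod_cast this
  · intro x hx hx1
    rw [generating_integral_ofReal _ hX hY hXY x,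
      ← Complex.ofReal_mul, hc]
    exact hasSum_poissonCoeff_of_small ha hb hX hY hXY hx hx1

end


/-! ### The form q, its derivatives, and differentiation under the integral. -/

noncomputable section

/-- The function `1 - u sin(θ/2) sin(φ/2) - v cos(θ/2) cos(φ/2)` of `x = (θ, φ)`, `p = (u, v)`. -/
def halfAngleForm (x p : ℝ × ℝ) : ℝ :=
  1 - p.1 * (Real.sin (x.1 / 2) * Real.sin (x.2 / 2)) -
    p.2 * (Real.cos (x.1 / 2) * Real.cos (x.2 / 2))

/-- The derivative of `halfAngleForm` in `θ`. -/
def halfAngleFormFst (x p : ℝ × ℝ) : ℝ :=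
  (p.2 * (Real.sin (x.1 / 2) * Real.cos (x.2 / 2)) -
    p.1 * (Real.cos (x.1 / 2) * Real.sin (x.2 / 2))) / 2

/-- The derivative of `halfAngleForm` in `φ`. -/
def halfAngleFormSnd (x p : ℝ × ℝ) : ℝ :=
  (p.2 * (Real.cos (x.1 / 2) * Real.sin (x.2 / 2)) -
    p.1 * (Real.sin (x.1 / 2) * Real.cos (x.2 / 2))) / 2

/-- The second derivative of `halfAngleForm` in `θ`. -/
def halfAngleFormFstFst (x p : ℝ × ℝ) : ℝ :=
  (p.1 * (Real.sin (x.1 / 2) * Real.sin (x.2 / 2)) +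
    p.2 * (Real.cos (x.1 / 2) * Real.cos (x.2 / 2))) / 4

/-- The mixed second derivative of `halfAngleForm`. -/
def halfAngleFormFstSnd (x p : ℝ × ℝ) : ℝ :=
  -(p.1 * (Real.cos (x.1 / 2) * Real.cos (x.2 / 2)) +
    p.2 * (Real.sin (x.1 / 2) * Real.sin (x.2 / 2))) / 4

theorem hasFDerivAt_halfAngleForm (x p : ℝ × ℝ) :
    HasFDerivAt (fun x => halfAngleForm x p)
      (halfAngleFormFst x p • ContinuousLinearMap.fst ℝ ℝ ℝ +
        halfAngleFormSnd x p • ContinuousLinearMap.snd ℝ ℝ ℝ) x := by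
  have h1 : HasFDerivAt (fun x : ℝ × ℝ => x.1 / 2)
      ((1 / 2 : ℝ) • ContinuousLinearMap.fst ℝ ℝ ℝ) x := by
    simpa [div_eq_inv_mul] using (hasFDerivAt_fst (𝕜 := ℝ) (p := x)).const_mul (1 / 2)
  have h2 : HasFDerivAt (fun x : ℝ × ℝ => x.2 / 2)
      ((1 / 2 : ℝ) • ContinuousLinearMap.snd ℝ ℝ ℝ) x := by
    simpa [div_eq_inv_mul] using (hasFDerivAt_snd (𝕜 := ℝ) (p := x)).const_mul (1 / 2)
  have h := (((h1.sin.fun_mul h2.sin).const_mul p.1).const_sub 1).fun_sub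
    ((h1.cos.fun_mul h2.cos).const_mul p.2)
  refine h.congr_fderiv ?_
  ext <;> simp [halfAngleFormFst, halfAngleFormSnd] <;> ring

theorem hasFDerivAt_halfAngleFormFst (x p : ℝ × ℝ) :
    HasFDerivAt (fun x => halfAngleFormFst x p)
      (halfAngleFormFstFst x p • ContinuousLinearMap.fst ℝ ℝ ℝ +
        halfAngleFormFstSnd x p • ContinuousLinearMap.snd ℝ ℝ ℝ) x := by
  have h1 : HasFDerivAt (fun x : ℝ × ℝ => x.1 / 2)
      ((1 / 2 : ℝ) • ContinuousLinearMap.fst ℝ ℝ ℝ) x := by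
    simpa [div_eq_inv_mul] using (hasFDerivAt_fst (𝕜 := ℝ) (p := x)).const_mul (1 / 2)
  have h2 : HasFDerivAt (fun x : ℝ × ℝ => x.2 / 2)
      ((1 / 2 : ℝ) • ContinuousLinearMap.snd ℝ ℝ ℝ) x := by
    simpa [div_eq_inv_mul] using (hasFDerivAt_snd (𝕜 := ℝ) (p := x)).const_mul (1 / 2)
  have h := ((((h1.sin.fun_mul h2.cos).const_mul p.2).fun_sub
    ((h1.cos.fun_mul h2.sin).const_mul p.1))).mul_const (1 / 2)
  refine (h.congr_fderiv ?_).congr_of_eventuallyEq (Filter.Eventually.of_forall fun y => ?_)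
  · ext <;> simp [halfAngleFormFstFst, halfAngleFormFstSnd] <;> ring
  · simp only [halfAngleFormFst]; ring

theorem continuous_halfAngleForm :
    Continuous fun y : (ℝ × ℝ) × (ℝ × ℝ) => halfAngleForm y.1 y.2 := by
  unfold halfAngleForm; fun_prop

theorem continuous_halfAngleFormFst :
    Continuous fun y : (ℝ × ℝ) × (ℝ × ℝ) => halfAngleFormFst y.1 y.2 := by
  unfold halfAngleFormFst; fun_prop

theorem continuous_halfAngleFormSnd :
    Continuous fun y : (ℝ × ℝ) × (ℝ × ℝ) => halfAngleFormSnd y.1 y.2 := by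
  unfold halfAngleFormSnd; fun_prop

theorem continuous_halfAngleFormFstFst :
    Continuous fun y : (ℝ × ℝ) × (ℝ × ℝ) => halfAngleFormFstFst y.1 y.2 := by
  unfold halfAngleFormFstFst; fun_prop

theorem continuous_halfAngleFormFstSnd :
    Continuous fun y : (ℝ × ℝ) × (ℝ × ℝ) => halfAngleFormFstSnd y.1 y.2 := by
  unfold halfAngleFormFstSnd; fun_prop

/-- As X and Y are positive, the form is smallest at u = v = 1, where it equals 1 - X - Y. This
lower bound D is positive off the diagonal and does not depend on u and v. -/
theorem one_sub_cos_half_sub_le_halfAngleForm {θ φ u v : ℝ} (hθ : θ ∈ Ioo 0 Real.pi)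
    (hφ : φ ∈ Ioo 0 Real.pi) (hu : u ≤ 1) (hv : v ≤ 1) :
    1 - Real.cos ((θ - φ) / 2) ≤ halfAngleForm (θ, φ) (u, v) := by
  have h1 := Real.sin_pos_of_pos_of_lt_pi (by linarith [hθ.1] : 0 < θ / 2)
    (by linarith [hθ.2, hθ.1])
  have h2 := Real.sin_pos_of_pos_of_lt_pi (by linarith [hφ.1] : 0 < φ / 2)
    (by linarith [hφ.2, hφ.1])
  have h3 := Real.cos_pos_of_mem_Ioo (x := θ / 2) ⟨by linarith [hθ.2, hθ.1], by linarith [hθ.2]⟩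
  have h4 := Real.cos_pos_of_mem_Ioo (x := φ / 2) ⟨by linarith [hφ.2, hφ.1], by linarith [hφ.2]⟩
  have h5 := mul_pos h1 h2
  have h6 := mul_pos h3 h4
  rw [show (θ - φ) / 2 = θ / 2 - φ / 2 by ring, Real.cos_sub]
  simp only [halfAngleForm]
  nlinarith

theorem one_sub_cos_half_sub_pos {θ φ : ℝ} (hθ : θ ∈ Ioo 0 Real.pi) (hφ : φ ∈ Ioo 0 Real.pi)
    (h : θ ≠ φ) : 0 < 1 - Real.cos ((θ - φ) / 2) := by
  have hne : (θ - φ) / 2 ≠ 0 := by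
    intro h0; exact h (by linarith)
  have h1 : Real.cos ((θ - φ) / 2) < 1 := by
    refine lt_of_le_of_ne (Real.cos_le_one _) fun h1 => hne ?_
    exact (Real.cos_eq_one_iff_of_lt_of_lt (by linarith [hθ.1, hφ.2, Real.pi_pos])
      (by linarith [hθ.2, hφ.1, Real.pi_pos])).1 h1
  linarith

theorem halfAngleForm_nonneg {x p : ℝ × ℝ} (hx : x ∈ Ioo 0 Real.pi ×ˢ Ioo 0 Real.pi)
    (hp : p ∈ Icc (-1 : ℝ) 1 ×ˢ Icc (-1 : ℝ) 1) : 0 ≤ halfAngleForm x p := by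
  have := one_sub_cos_half_sub_le_halfAngleForm hx.1 hx.2 hp.1.2 hp.2.2
  linarith [Real.cos_le_one ((x.1 - x.2) / 2)]

theorem halfAngleForm_pos {x p : ℝ × ℝ} (hx : x ∈ Ioo 0 Real.pi ×ˢ Ioo 0 Real.pi)
    (hne : x.1 ≠ x.2) (hp : p ∈ Icc (-1 : ℝ) 1 ×ˢ Icc (-1 : ℝ) 1) : 0 < halfAngleForm x p := by
  have := one_sub_cos_half_sub_le_halfAngleForm hx.1 hx.2 hp.1.2 hp.2.2
  linarith [one_sub_cos_half_sub_pos hx.1 hx.2 hne]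

/-- The product of two ultraspherical measures, on `(-1, 1)²`. -/
abbrev ultraProd (s s' : ℝ) : Measure (ℝ × ℝ) := (ultraMeasure s).prod (ultraMeasure s')

theorem ae_ultraProd_mem (s s' : ℝ) :
    ∀ᵐ p ∂ultraProd s s', p ∈ Icc (-1 : ℝ) 1 ×ˢ Icc (-1 : ℝ) 1 :=
  (ae_ultraMeasure_prod_mem s s').mono fun _ hp =>
    ⟨Ioo_subset_Icc_self hp.1, Ioo_subset_Icc_self hp.2⟩

/-- The integrand and its derivatives are continuous on a closed ball times the closed square, hence
bounded; since the measure is finite, constants dominate. -/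
theorem hasFDerivAt_integral_ultraProd {s s' : ℝ} (hs : 0 < s) (hs' : 0 < s')
    {U : Set (ℝ × ℝ)} (hU : IsOpen U) {f f₁ f₂ : ℝ × ℝ → ℝ × ℝ → ℝ}
    (hm : ∀ x, Measurable (f x)) (hm₁ : ∀ x, Measurable (f₁ x)) (hm₂ : ∀ x, Measurable (f₂ x))
    (hc : ContinuousOn (Function.uncurry f) (U ×ˢ (Icc (-1 : ℝ) 1 ×ˢ Icc (-1 : ℝ) 1)))
    (hc₁ : ContinuousOn (Function.uncurry f₁) (U ×ˢ (Icc (-1 : ℝ) 1 ×ˢ Icc (-1 : ℝ) 1)))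
    (hc₂ : ContinuousOn (Function.uncurry f₂) (U ×ˢ (Icc (-1 : ℝ) 1 ×ˢ Icc (-1 : ℝ) 1)))
    (hd : ∀ x ∈ U, ∀ p ∈ Icc (-1 : ℝ) 1 ×ˢ Icc (-1 : ℝ) 1, HasFDerivAt (fun y => f y p)
      (f₁ x p • ContinuousLinearMap.fst ℝ ℝ ℝ + f₂ x p • ContinuousLinearMap.snd ℝ ℝ ℝ) x)
    {x : ℝ × ℝ} (hx : x ∈ U) :
    HasFDerivAt (fun y => ∫ p, f y p ∂ultraProd s s')
      ((∫ p, f₁ x p ∂ultraProd s s') • ContinuousLinearMap.fst ℝ ℝ ℝ +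
        (∫ p, f₂ x p ∂ultraProd s s') • ContinuousLinearMap.snd ℝ ℝ ℝ) x := by
  have := isFiniteMeasure_ultraMeasure hs
  have := isFiniteMeasure_ultraMeasure hs'
  obtain ⟨ε, hε, hεU⟩ := Metric.nhds_basis_closedBall.mem_iff.1 (hU.mem_nhds hx)
  have hK : IsCompact (Metric.closedBall x ε ×ˢ (Icc (-1 : ℝ) 1 ×ˢ Icc (-1 : ℝ) 1)) :=
    (isCompact_closedBall x ε).prod (isCompact_Icc.prod isCompact_Icc)
  have hsub : Metric.closedBall x ε ×ˢ (Icc (-1 : ℝ) 1 ×ˢ Icc (-1 : ℝ) 1) ⊆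
    U ×ˢ (Icc (-1 : ℝ) 1 ×ˢ Icc (-1 : ℝ) 1) := prod_mono hεU le_rfl
  obtain ⟨C, hC⟩ := hK.exists_bound_of_continuousOn (hc.mono hsub)
  obtain ⟨C₁, hC₁⟩ := hK.exists_bound_of_continuousOn (hc₁.mono hsub)
  obtain ⟨C₂, hC₂⟩ := hK.exists_bound_of_continuousOn (hc₂.mono hsub)
  have hxε : x ∈ Metric.closedBall x ε := Metric.mem_closedBall_self hε.le
  have hae := ae_ultraProd_mem s s'
  have hint : Integrable (f x) (ultraProd s s') :=
    Integrable.of_bound (hm x).aestronglyMeasurable C (hae.mono fun p hp => hC (x, p) ⟨hxε, hp⟩)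
  have hint₁ : Integrable (f₁ x) (ultraProd s s') :=
    Integrable.of_bound (hm₁ x).aestronglyMeasurable C₁ (hae.mono fun p hp => hC₁ (x, p) ⟨hxε, hp⟩)
  have hint₂ : Integrable (f₂ x) (ultraProd s s') :=
    Integrable.of_bound (hm₂ x).aestronglyMeasurable C₂ (hae.mono fun p hp => hC₂ (x, p) ⟨hxε, hp⟩)
  have h := hasFDerivAt_integral_of_dominated_of_fderiv_le (μ := ultraProd s s') (F := f)
    (F' := fun y p => f₁ y p • ContinuousLinearMap.fst ℝ ℝ ℝ +
      f₂ y p • ContinuousLinearMap.snd ℝ ℝ ℝ) (x₀ := x) (s := Metric.closedBall x ε)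
    (bound := fun _ => C₁ + C₂) (Metric.closedBall_mem_nhds x hε)
    (Filter.Eventually.of_forall fun y => (hm y).aestronglyMeasurable) hint
    (((hm₁ x).aestronglyMeasurable.smul_const _).add ((hm₂ x).aestronglyMeasurable.smul_const _))
    (hae.mono fun p hp y hy => ?_) (integrable_const _)
    (hae.mono fun p hp y hy => hd y (hεU hy) p hp)
  · refine h.congr_fderiv ?_
    rw [integral_add (hint₁.smul_const _) (hint₂.smul_const _), integral_smul_const,
      integral_smul_const]
  · refine (norm_add_le _ _).trans (add_le_add ?_ ?_)
    · rw [norm_smul]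
      exact (mul_le_of_le_one_right (norm_nonneg _) (ContinuousLinearMap.norm_fst_le _ _ _)).trans
        (hC₁ (y, p) ⟨hy, hp⟩)
    · rw [norm_smul]
      exact (mul_le_of_le_one_right (norm_nonneg _) (ContinuousLinearMap.norm_snd_le _ _ _)).trans
        (hC₂ (y, p) ⟨hy, hp⟩)

end


/-! ### Integral formulas for the Poisson and Riesz kernels. -/

noncomputable section

/-- The constant in front of the integral representation of the Jacobi-Poisson kernel. -/
def poissonConst (a b : ℝ) : ℝ :=
  2 ^ (-(a + b + 1)) * Real.Gamma (a + b + 2) /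
    (Real.pi * Real.Gamma (a + 1 / 2) * Real.Gamma (b + 1 / 2))

theorem sin_half_mul_pos {θ φ : ℝ} (hθ : θ ∈ Ioo 0 Real.pi) (hφ : φ ∈ Ioo 0 Real.pi) :
    0 < Real.sin (θ / 2) * Real.sin (φ / 2) :=
  mul_pos (Real.sin_pos_of_pos_of_lt_pi (by linarith [hθ.1]) (by linarith [hθ.2, hθ.1]))
    (Real.sin_pos_of_pos_of_lt_pi (by linarith [hφ.1]) (by linarith [hφ.2, hφ.1]))

theorem cos_half_mul_pos {θ φ : ℝ} (hθ : θ ∈ Ioo 0 Real.pi) (hφ : φ ∈ Ioo 0 Real.pi) :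
    0 < Real.cos (θ / 2) * Real.cos (φ / 2) :=
  mul_pos (Real.cos_pos_of_mem_Ioo ⟨by linarith [hθ.2, hθ.1], by linarith [hθ.2]⟩)
    (Real.cos_pos_of_mem_Ioo ⟨by linarith [hφ.2, hφ.1], by linarith [hφ.2]⟩)

theorem sin_half_mul_add_cos_half_mul (θ φ : ℝ) :
    Real.sin (θ / 2) * Real.sin (φ / 2) + Real.cos (θ / 2) * Real.cos (φ / 2) =
      Real.cos ((θ - φ) / 2) := by
  rw [show (θ - φ) / 2 = θ / 2 - φ / 2 by ring, Real.cos_sub]; ring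

/-- The generating function at z = e^(-t/2): here 1 + z² - 2zw = 2z (cosh(t/2) - w) and 1 - z² = 2z
sinh(t/2), and the remaining powers of z cancel against z^(a + b + 1). -/
theorem hasSum_jacobiPoissonTerm {a b : ℝ} (ha : -(1 / 2) < a) (hb : -(1 / 2) < b) {θ φ : ℝ}
    (hθ : θ ∈ Ioo 0 Real.pi) (hφ : φ ∈ Ioo 0 Real.pi) {t : ℝ} (ht : 0 < t) :
    HasSum (jacobiPoissonTerm a b t θ φ)
      (poissonConst a b * (Real.sinh (t / 2) *
        ∫ p, (Real.cosh (t / 2) - 1 + halfAngleForm (θ, φ) p) ^ (-(a + b + 2))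
          ∂ultraProd (a + 1 / 2) (b + 1 / 2))) := by
  have hX := sin_half_mul_pos hθ hφ
  have hY := cos_half_mul_pos hθ hφ
  have hXY := sin_half_mul_add_cos_half_mul θ φ
  have hz0 : 0 < Real.exp (-(t / 2)) := Real.exp_pos _
  have h := hasSum_poissonCoeff ha hb hX.le hY.le (hXY.le.trans (Real.cos_le_one _)) hz0.le
    (Real.exp_lt_one_iff.2 (by linarith))
  set X := Real.sin (θ / 2) * Real.sin (φ / 2)
  set Y := Real.cos (θ / 2) * Real.cos (φ / 2)
  set z := Real.exp (-(t / 2)) with hz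
  have hga := Real.Gamma_pos_of_pos (by linarith : 0 < a + 1 / 2)
  have hgb := Real.Gamma_pos_of_pos (by linarith : 0 < b + 1 / 2)
  have hpi := Real.pi_pos
  have hzinv : Real.exp (t / 2) = z⁻¹ := by rw [hz, Real.exp_neg, inv_inv]
  have e1 : ∫ p : ℝ × ℝ, (1 + z ^ 2 - 2 * z * (p.1 * X + p.2 * Y)) ^ (-(a + b + 2))
      ∂(ultraMeasure (a + 1 / 2)).prod (ultraMeasure (b + 1 / 2)) =
      (2 * z) ^ (-(a + b + 2)) *
        ∫ p, (Real.cosh (t / 2) - 1 + halfAngleForm (θ, φ) p) ^ (-(a + b + 2))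
          ∂ultraProd (a + 1 / 2) (b + 1 / 2) := by
    rw [← integral_const_mul]
    refine integral_congr_ae ((ae_ultraProd_mem _ _).mono fun p hp => ?_)
    have h0 : 0 ≤ Real.cosh (t / 2) - 1 + halfAngleForm (θ, φ) p := by
      have := halfAngleForm_nonneg (x := (θ, φ)) ⟨hθ, hφ⟩ hp
      linarith [Real.one_le_cosh (t / 2)]
    simp only
    rw [← Real.mul_rpow (by positivity) h0]
    congr 1
    simp only [halfAngleForm]
    rw [Real.cosh_eq, ← hz, hzinv]
    field_simp
    ring
  rw [e1] at h
  have h2 := h.mul_left (z ^ (a + b + 1) / (Real.pi * Real.Gamma (a + 1 / 2) *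
    Real.Gamma (b + 1 / 2)))
  generalize (∫ p, (Real.cosh (t / 2) - 1 + halfAngleForm (θ, φ) p) ^ (-(a + b + 2))
          ∂ultraProd (a + 1 / 2) (b + 1 / 2)) = I at h2 ⊢
  have e3 : z ^ (a + b + 1) / (Real.pi * Real.Gamma (a + 1 / 2) * Real.Gamma (b + 1 / 2)) *
      (Real.Gamma (a + b + 2) * ((1 - z ^ 2) * ((2 * z) ^ (-(a + b + 2)) * I))) =
      poissonConst a b * (Real.sinh (t / 2) * I) := by
    rw [poissonConst, Real.sinh_eq, ← hz, hzinv, Real.mul_rpow (by norm_num) hz0.le,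
      show -(a + b + 2) = -(a + b + 1) - 1 by ring, Real.rpow_sub_one (by norm_num),
      Real.rpow_sub_one hz0.ne', Real.rpow_neg hz0.le]
    have := Real.rpow_pos_of_pos hz0 (a + b + 1)
    field_simp
  rw [e3] at h2
  refine h2.congr_fun fun n => ?_
  rw [jacobiPoissonTerm_eq (by linarith) (by linarith) (by linarith) t hθ hφ n,
    show -t * (n + (a + b + 1) / 2) = (2 * n : ℕ) * (-(t / 2)) + (-(t / 2)) * (a + b + 1) by
      push_cast; ring, Real.exp_add, Real.exp_nat_mul, Real.exp_mul, ← hz]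
  generalize Real.Gamma (a + 1 / 2) = g at *
  generalize Real.Gamma (b + 1 / 2) = g' at *
  field_simp
  rfl

/-- The open square with the diagonal removed. -/
def offDiagonal : Set (ℝ × ℝ) := (Ioo 0 Real.pi ×ˢ Ioo 0 Real.pi) ∩ {x | x.1 ≠ x.2}

theorem isOpen_offDiagonal : IsOpen offDiagonal :=
  (isOpen_Ioo.prod isOpen_Ioo).inter (isOpen_ne_fun continuous_fst continuous_snd)

/-- The shift κ, later cosh(t/2) - 1, keeps the base of the power positive even at θ = φ. Without
it, as in the next lemma, one has to stay off the diagonal. -/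
theorem hasFDerivAt_integral_add_halfAngleForm_rpow {s s' : ℝ} (hs : 0 < s) (hs' : 0 < s')
    (l : ℝ) {κ : ℝ} (hκ : 0 < κ) {x : ℝ × ℝ} (hx : x ∈ Ioo 0 Real.pi ×ˢ Ioo 0 Real.pi) :
    HasFDerivAt (fun y => ∫ p, (κ + halfAngleForm y p) ^ (-l) ∂ultraProd s s')
      ((∫ p, -l * ((κ + halfAngleForm x p) ^ (-l - 1) * halfAngleFormFst x p) ∂ultraProd s s') •
          ContinuousLinearMap.fst ℝ ℝ ℝ +
        (∫ p, -l * ((κ + halfAngleForm x p) ^ (-l - 1) * halfAngleFormSnd x p) ∂ultraProd s s') •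
          ContinuousLinearMap.snd ℝ ℝ ℝ) x := by
  have hpos : ∀ y ∈ (Ioo 0 Real.pi ×ˢ Ioo 0 Real.pi) ×ˢ (Icc (-1 : ℝ) 1 ×ˢ Icc (-1 : ℝ) 1),
      κ + halfAngleForm y.1 y.2 ≠ 0 := fun y hy => by
    have := halfAngleForm_nonneg hy.1 hy.2
    positivity
  have hc : ∀ r : ℝ, ContinuousOn (fun y : (ℝ × ℝ) × (ℝ × ℝ) => (κ + halfAngleForm y.1 y.2) ^ r)
      ((Ioo 0 Real.pi ×ˢ Ioo 0 Real.pi) ×ˢ (Icc (-1 : ℝ) 1 ×ˢ Icc (-1 : ℝ) 1)) := fun r =>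
    (continuous_const.add continuous_halfAngleForm).continuousOn.rpow_const
      fun y hy => Or.inl (hpos y hy)
  refine hasFDerivAt_integral_ultraProd hs hs' (isOpen_Ioo.prod isOpen_Ioo)
    (f := fun y p => (κ + halfAngleForm y p) ^ (-l))
    (f₁ := fun y p => -l * ((κ + halfAngleForm y p) ^ (-l - 1) * halfAngleFormFst y p))
    (f₂ := fun y p => -l * ((κ + halfAngleForm y p) ^ (-l - 1) * halfAngleFormSnd y p))
    (fun y => by unfold halfAngleForm; fun_prop)
    (fun y => by unfold halfAngleForm halfAngleFormFst; fun_prop)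
    (fun y => by unfold halfAngleForm halfAngleFormSnd; fun_prop)
    (hc _) (continuousOn_const.mul ((hc _).mul continuous_halfAngleFormFst.continuousOn))
    (continuousOn_const.mul ((hc _).mul continuous_halfAngleFormSnd.continuousOn))
    (fun y hy p hp => ?_) hx
  have h := ((hasFDerivAt_halfAngleForm y p).const_add κ).rpow_const (p := -l)
    (Or.inl (hpos (y, p) ⟨hy, hp⟩))
  refine h.congr_fderiv ?_
  ext <;> simp <;> ring

theorem hasFDerivAt_integral_halfAngleFormFst_mul {s s' : ℝ} (hs : 0 < s) (hs' : 0 < s')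
    (l : ℝ) {x : ℝ × ℝ} (hx : x ∈ offDiagonal) :
    HasFDerivAt (fun y => ∫ p, halfAngleFormFst y p * halfAngleForm y p ^ (-l) ∂ultraProd s s')
      ((∫ p, (halfAngleFormFstFst x p * halfAngleForm x p ^ (-l) -
            l * (halfAngleFormFst x p * halfAngleFormFst x p * halfAngleForm x p ^ (-l - 1)))
            ∂ultraProd s s') • ContinuousLinearMap.fst ℝ ℝ ℝ +
        (∫ p, (halfAngleFormFstSnd x p * halfAngleForm x p ^ (-l) -
            l * (halfAngleFormFst x p * halfAngleFormSnd x p * halfAngleForm x p ^ (-l - 1)))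
            ∂ultraProd s s') • ContinuousLinearMap.snd ℝ ℝ ℝ) x := by
  have hpos : ∀ y ∈ offDiagonal ×ˢ (Icc (-1 : ℝ) 1 ×ˢ Icc (-1 : ℝ) 1),
      halfAngleForm y.1 y.2 ≠ 0 := fun y hy => (halfAngleForm_pos hy.1.1 hy.1.2 hy.2).ne'
  have hc : ∀ r : ℝ, ContinuousOn (fun y : (ℝ × ℝ) × (ℝ × ℝ) => halfAngleForm y.1 y.2 ^ r)
      (offDiagonal ×ˢ (Icc (-1 : ℝ) 1 ×ˢ Icc (-1 : ℝ) 1)) := fun r =>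
    continuous_halfAngleForm.continuousOn.rpow_const fun y hy => Or.inl (hpos y hy)
  refine hasFDerivAt_integral_ultraProd hs hs' isOpen_offDiagonal
    (f := fun y p => halfAngleFormFst y p * halfAngleForm y p ^ (-l))
    (f₁ := fun x p => halfAngleFormFstFst x p * halfAngleForm x p ^ (-l) -
            l * (halfAngleFormFst x p * halfAngleFormFst x p * halfAngleForm x p ^ (-l - 1)))
    (f₂ := fun x p => halfAngleFormFstSnd x p * halfAngleForm x p ^ (-l) -
            l * (halfAngleFormFst x p * halfAngleFormSnd x p * halfAngleForm x p ^ (-l - 1)))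
    (fun y => by unfold halfAngleForm halfAngleFormFst; fun_prop)
    (fun y => by unfold halfAngleForm halfAngleFormFst halfAngleFormFstFst; fun_prop)
    (fun y => by
      unfold halfAngleForm halfAngleFormFst halfAngleFormSnd halfAngleFormFstSnd; fun_prop)
    (continuous_halfAngleFormFst.continuousOn.mul (hc _))
    ((continuous_halfAngleFormFstFst.continuousOn.mul (hc _)).sub (continuousOn_const.mul
      ((continuous_halfAngleFormFst.mul continuous_halfAngleFormFst).continuousOn.mul (hc _))))
    ((continuous_halfAngleFormFstSnd.continuousOn.mul (hc _)).sub (continuousOn_const.mul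
      ((continuous_halfAngleFormFst.mul continuous_halfAngleFormSnd).continuousOn.mul (hc _))))
    (fun y hy p hp => ?_) hx
  have h := (hasFDerivAt_halfAngleFormFst y p).fun_mul
    ((hasFDerivAt_halfAngleForm y p).rpow_const (p := -l) (Or.inl (hpos (y, p) ⟨hy, hp⟩)))
  refine h.congr_fderiv ?_
  ext <;> simp <;> ring

theorem abs_halfAngleFormFst_le_one (x : ℝ × ℝ) {p : ℝ × ℝ}
    (hp : p ∈ Icc (-1 : ℝ) 1 ×ˢ Icc (-1 : ℝ) 1) : |halfAngleFormFst x p| ≤ 1 := by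
  have h1 : |p.1| ≤ 1 := abs_le.2 hp.1
  have h2 : |p.2| ≤ 1 := abs_le.2 hp.2
  have h : ∀ u c d : ℝ, |u| ≤ 1 → |c| ≤ 1 → |d| ≤ 1 → |u * (c * d)| ≤ 1 := fun u c d hu hc hd => by
    rw [abs_mul, abs_mul]
    exact mul_le_one₀ hu (by positivity) (mul_le_one₀ hc (abs_nonneg _) hd)
  have h3 := h _ _ _ h2 (Real.abs_sin_le_one (x.1 / 2)) (Real.abs_cos_le_one (x.2 / 2))
  have h4 := h _ _ _ h1 (Real.abs_cos_le_one (x.1 / 2)) (Real.abs_sin_le_one (x.2 / 2))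
  rw [halfAngleFormFst, abs_div, abs_two, div_le_one (by norm_num)]
  exact (abs_sub _ _).trans (by linarith)

theorem tendsto_cosh_half_add_rpow_neg {l : ℝ} (hl : 0 < l) (c : ℝ) :
    Filter.Tendsto (fun t : ℝ => (Real.cosh (t / 2) - 1 + c) ^ (-l)) Filter.atTop (nhds 0) := by
  refine (tendsto_rpow_neg_atTop hl).comp ?_
  refine Filter.tendsto_atTop_add_const_right _ _ (Filter.tendsto_atTop_add_const_right _ (-1) ?_)
  refine Filter.tendsto_atTop_mono (f := fun t : ℝ => t / 4) (fun t => ?_)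
    (Filter.tendsto_id.atTop_div_const (by norm_num))
  rw [Real.cosh_eq]
  have := Real.add_one_le_exp (t / 2)
  have := Real.exp_pos (-(t / 2))
  linarith

/-- This primitive makes the t-integral exact: the factor sinh(t/2) of the Poisson kernel is, up to
the factor 2, the derivative of cosh(t/2). -/
theorem hasDerivAt_cosh_half_add_rpow {l c t : ℝ} (hc : 0 < c) (hl : l ≠ 0) :
    HasDerivAt (fun t : ℝ => -(2 / l) * (Real.cosh (t / 2) - 1 + c) ^ (-l))
      (Real.sinh (t / 2) * (Real.cosh (t / 2) - 1 + c) ^ (-l - 1)) t := by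
  have hpos : 0 < Real.cosh (t / 2) - 1 + c := by linarith [Real.one_le_cosh (t / 2)]
  have h := (((((hasDerivAt_id t).div_const 2).cosh.sub_const 1).add_const c).rpow_const
    (p := -l) (Or.inl hpos.ne')).const_mul (-(2 / l))
  refine h.congr_deriv ?_
  simp only [id]
  field_simp

theorem integrableOn_sinh_half_mul_rpow {l c : ℝ} (hl : 0 < l) (hc : 0 < c) :
    IntegrableOn (fun t : ℝ => Real.sinh (t / 2) * (Real.cosh (t / 2) - 1 + c) ^ (-l - 1))
      (Ioi 0) := by
  refine integrableOn_Ioi_deriv_of_nonneg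
    (hasDerivAt_cosh_half_add_rpow hc hl.ne').continuousAt.continuousWithinAt
    (fun t _ => hasDerivAt_cosh_half_add_rpow hc hl.ne') (fun t ht => ?_)
    ((tendsto_cosh_half_add_rpow_neg hl c).const_mul _)
  have hpos : 0 < Real.cosh (t / 2) - 1 + c := by linarith [Real.one_le_cosh (t / 2)]
  have := Real.sinh_nonneg_iff.2 (by linarith [mem_Ioi.1 ht] : 0 ≤ t / 2)
  positivity

theorem integral_sinh_half_mul_rpow {l c : ℝ} (hl : 0 < l) (hc : 0 < c) :
    ∫ t in Ioi (0 : ℝ), Real.sinh (t / 2) * (Real.cosh (t / 2) - 1 + c) ^ (-l - 1) =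
      2 / l * c ^ (-l) := by
  rw [integral_Ioi_of_hasDerivAt_of_nonneg
    (hasDerivAt_cosh_half_add_rpow hc hl.ne').continuousAt.continuousWithinAt
    (fun t _ => hasDerivAt_cosh_half_add_rpow hc hl.ne') (fun t ht => ?_)
    ((tendsto_cosh_half_add_rpow_neg hl c).const_mul _)]
  · simp
  · have hpos : 0 < Real.cosh (t / 2) - 1 + c := by linarith [Real.one_le_cosh (t / 2)]
    have := Real.sinh_nonneg_iff.2 (by linarith [mem_Ioi.1 ht] : 0 ≤ t / 2)
    positivity

theorem jacobiPoissonKernel_eq {a b : ℝ} (ha : -(1 / 2) < a) (hb : -(1 / 2) < b) {θ φ : ℝ}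
    (hθ : θ ∈ Ioo 0 Real.pi) (hφ : φ ∈ Ioo 0 Real.pi) {t : ℝ} (ht : 0 < t) :
    jacobiPoissonKernel a b t θ φ = poissonConst a b * (Real.sinh (t / 2) *
        ∫ p, (Real.cosh (t / 2) - 1 + halfAngleForm (θ, φ) p) ^ (-(a + b + 2))
          ∂ultraProd (a + 1 / 2) (b + 1 / 2)) :=
  (hasSum_jacobiPoissonTerm ha hb hθ hφ ht).tsum_eq

theorem hasDerivAt_jacobiPoissonKernel {a b : ℝ} (ha : -(1 / 2) < a) (hb : -(1 / 2) < b)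
    {θ φ : ℝ} (hθ : θ ∈ Ioo 0 Real.pi) (hφ : φ ∈ Ioo 0 Real.pi) {t : ℝ} (ht : 0 < t) :
    HasDerivAt (fun s => jacobiPoissonKernel a b t s φ)
      (-(a + b + 2) * poissonConst a b * ∫ p, Real.sinh (t / 2) *
        (Real.cosh (t / 2) - 1 + halfAngleForm (θ, φ) p) ^ (-(a + b + 2) - 1) *
          halfAngleFormFst (θ, φ) p ∂ultraProd (a + 1 / 2) (b + 1 / 2)) θ := by
  have hκ : 0 < Real.cosh (t / 2) - 1 := by
    have := Real.one_lt_cosh.2 (by positivity : t / 2 ≠ 0)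
    linarith
  have h := hasFDerivAt_integral_add_halfAngleForm_rpow (s := a + 1 / 2) (s' := b + 1 / 2)
    (by linarith) (by linarith) (a + b + 2) hκ (x := (θ, φ)) ⟨hθ, hφ⟩
  have h1 := (h.comp_hasDerivAt θ ((hasDerivAt_id θ).prodMk (hasDerivAt_const θ φ))).const_mul
    (poissonConst a b * Real.sinh (t / 2))
  refine (h1.congr_of_eventuallyEq ?_).congr_deriv ?_
  · filter_upwards [isOpen_Ioo.mem_nhds hθ] with s hs
    rw [jacobiPoissonKernel_eq ha hb hs hφ ht]
    simp only [Function.comp, id, mul_assoc]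
  · simp only [add_apply, smul_apply,
      ContinuousLinearMap.coe_fst', ContinuousLinearMap.coe_snd', smul_eq_mul, mul_one, mul_zero,
      add_zero, integral_const_mul, mul_assoc]
    ring

/-- This justifies exchanging the t-integral with the integral over the square: replacing the form
by its minimum D gives a majorant that depends on t alone. -/
theorem integrable_sinh_half_mul_halfAngleForm {s s' : ℝ} (hs : 0 < s) (hs' : 0 < s') {l : ℝ}
    (hl : 0 < l) {x : ℝ × ℝ} (hx : x ∈ offDiagonal) :
    Integrable (fun y : ℝ × (ℝ × ℝ) => Real.sinh (y.1 / 2) *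
        (Real.cosh (y.1 / 2) - 1 + halfAngleForm x y.2) ^ (-l - 1) * halfAngleFormFst x y.2)
      ((volume.restrict (Ioi 0)).prod (ultraProd s s')) := by
  have := isFiniteMeasure_ultraMeasure hs
  have := isFiniteMeasure_ultraMeasure hs'
  have hD := one_sub_cos_half_sub_pos hx.1.1 hx.1.2 hx.2
  have h := (integrableOn_sinh_half_mul_rpow hl hD).mul_prod
    (integrable_const (1 : ℝ) (μ := ultraProd s s'))
  refine h.mono' ?_ ?_
  · refine Measurable.aestronglyMeasurable ?_
    unfold halfAngleForm halfAngleFormFst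
    have := Real.measurable_sinh
    have := Real.measurable_cosh
    fun_prop
  · filter_upwards [Measure.quasiMeasurePreserving_fst.ae (ae_restrict_mem measurableSet_Ioi),
      Measure.quasiMeasurePreserving_snd.ae (ae_ultraProd_mem s s')] with y hy1 hy2
    have h1 := one_sub_cos_half_sub_le_halfAngleForm hx.1.1 hx.1.2 hy2.1.2 hy2.2.2
    have h2 : 0 ≤ Real.sinh (y.1 / 2) :=
      Real.sinh_nonneg_iff.2 (by linarith [mem_Ioi.1 hy1])
    have h3 := Real.one_le_cosh (y.1 / 2)
    have h4 : 0 < Real.cosh (y.1 / 2) - 1 + (1 - Real.cos ((x.1 - x.2) / 2)) := by linarith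
    have h5 : (Real.cosh (y.1 / 2) - 1 + halfAngleForm x y.2) ^ (-l - 1) ≤
        (Real.cosh (y.1 / 2) - 1 + (1 - Real.cos ((x.1 - x.2) / 2))) ^ (-l - 1) :=
      Real.rpow_le_rpow_of_nonpos h4 (by linarith) (by linarith)
    have h6 : 0 ≤ (Real.cosh (y.1 / 2) - 1 + halfAngleForm x y.2) ^ (-l - 1) :=
      Real.rpow_nonneg (by linarith) _
    rw [Real.norm_eq_abs, abs_mul, abs_of_nonneg (mul_nonneg h2 h6)]
    exact mul_le_mul (mul_le_mul_of_nonneg_left h5 h2) (abs_halfAngleFormFst_le_one x hy2)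
      (abs_nonneg _) (mul_nonneg h2 (h6.trans h5))

theorem deriv_jacobiPoissonKernel_ae {a b : ℝ} (ha : -(1 / 2) < a) (hb : -(1 / 2) < b)
    {θ φ : ℝ} (hθ : θ ∈ Ioo 0 Real.pi) (hφ : φ ∈ Ioo 0 Real.pi) :
    (fun t => deriv (fun s => jacobiPoissonKernel a b t s φ) θ) =ᵐ[volume.restrict (Ioi 0)]
      fun t => -(a + b + 2) * poissonConst a b * ∫ p, Real.sinh (t / 2) *
        (Real.cosh (t / 2) - 1 + halfAngleForm (θ, φ) p) ^ (-(a + b + 2) - 1) *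
          halfAngleFormFst (θ, φ) p ∂ultraProd (a + 1 / 2) (b + 1 / 2) :=
  (ae_restrict_mem measurableSet_Ioi).mono fun _ ht =>
    (hasDerivAt_jacobiPoissonKernel ha hb hθ hφ ht).deriv

theorem integrableOn_deriv_jacobiPoissonKernel {a b : ℝ} (ha : -(1 / 2) < a)
    (hb : -(1 / 2) < b) {θ φ : ℝ} (hx : (θ, φ) ∈ offDiagonal) :
    IntegrableOn (fun t => deriv (fun s => jacobiPoissonKernel a b t s φ) θ) (Ioi 0) := by
  have := isFiniteMeasure_ultraMeasure (by linarith : 0 < a + 1 / 2)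
  have := isFiniteMeasure_ultraMeasure (by linarith : 0 < b + 1 / 2)
  refine Integrable.congr ?_ (deriv_jacobiPoissonKernel_ae ha hb hx.1.1 hx.1.2).symm
  exact (integrable_sinh_half_mul_halfAngleForm (by linarith) (by linarith)
    (by linarith : 0 < a + b + 2) hx).integral_prod_left.const_mul _

/-- The integral representation of the Jacobi-Riesz kernel. -/
theorem jacobiRieszKernel_eq {a b : ℝ} (ha : -(1 / 2) < a) (hb : -(1 / 2) < b) {θ φ : ℝ}
    (hx : (θ, φ) ∈ offDiagonal) :
    jacobiRieszKernel a b θ φ = -2 * poissonConst a b *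
      ∫ p, halfAngleFormFst (θ, φ) p * halfAngleForm (θ, φ) p ^ (-(a + b + 2))
        ∂ultraProd (a + 1 / 2) (b + 1 / 2) := by
  have := isFiniteMeasure_ultraMeasure (by linarith : 0 < a + 1 / 2)
  have := isFiniteMeasure_ultraMeasure (by linarith : 0 < b + 1 / 2)
  have hl : 0 < a + b + 2 := by linarith
  rw [jacobiRieszKernel, integral_congr_ae (deriv_jacobiPoissonKernel_ae ha hb hx.1.1 hx.1.2),
    integral_const_mul, integral_integral_swap
      (integrable_sinh_half_mul_halfAngleForm (by linarith) (by linarith) hl hx)]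
  have e : ∫ p, (∫ t in Ioi (0 : ℝ), Real.sinh (t / 2) *
        (Real.cosh (t / 2) - 1 + halfAngleForm (θ, φ) p) ^ (-(a + b + 2) - 1) *
          halfAngleFormFst (θ, φ) p) ∂ultraProd (a + 1 / 2) (b + 1 / 2) =
      ∫ p, 2 / (a + b + 2) * (halfAngleFormFst (θ, φ) p *
        halfAngleForm (θ, φ) p ^ (-(a + b + 2))) ∂ultraProd (a + 1 / 2) (b + 1 / 2) := by
    refine integral_congr_ae ((ae_ultraProd_mem _ _).mono fun p hp => ?_)
    simp only
    rw [integral_mul_const, integral_sinh_half_mul_rpow hl (halfAngleForm_pos hx.1 hx.2 hp)]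
    ring
  rw [e, integral_const_mul]
  field_simp

end


/-! ### Laplace transforms of ultraspherical measures. -/

noncomputable section

theorem exists_one_add_rpow_le_exp {K c : ℝ} (hK : 0 ≤ K) (hc : 0 < c) :
    ∃ C, 0 < C ∧ ∀ y, 0 ≤ y → (1 + y) ^ K ≤ C * Real.exp (c * y) := by
  refine ⟨(1 + (K + 1) / c) ^ (K + 1), by positivity, fun y hy => ?_⟩
  have h1 : 1 + y ≤ (1 + (K + 1) / c) * Real.exp (c * y / (K + 1)) := by
    have h := Real.add_one_le_exp (c * y / (K + 1))
    have h2 : (1 + (K + 1) / c) * (c * y / (K + 1) + 1) =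
        1 + y + (c * y / (K + 1) + (K + 1) / c) := by field_simp; ring
    have h3 : 0 ≤ c * y / (K + 1) + (K + 1) / c := by positivity
    have h4 := mul_le_mul_of_nonneg_left h (by positivity : 0 ≤ 1 + (K + 1) / c)
    linarith
  calc (1 + y) ^ K ≤ (1 + y) ^ (K + 1) :=
        Real.rpow_le_rpow_of_exponent_le (by linarith) (by linarith)
    _ ≤ ((1 + (K + 1) / c) * Real.exp (c * y / (K + 1))) ^ (K + 1) :=
        Real.rpow_le_rpow (by linarith) h1 (by linarith)
    _ = _ := by
        rw [Real.mul_rpow (by positivity) (Real.exp_pos _).le, ← Real.exp_mul]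
        congr 2
        field_simp

theorem integrable_ultraMeasure_iff (s : ℝ) (f : ℝ → ℝ) :
    Integrable f (ultraMeasure s) ↔
      IntegrableOn (fun u => (1 - u ^ 2) ^ (s - 1) * f u) (Ioo (-1) 1) := by
  rw [ultraMeasure, integrable_withDensity_iff_integrable_smul' (measurable_ultraDensity s)
    (by simp), IntegrableOn]
  refine integrable_congr ((ae_restrict_mem measurableSet_Ioo).mono fun u hu => ?_)
  have : 0 ≤ 1 - u ^ 2 := by nlinarith [hu.1, hu.2]
  simp only [smul_eq_mul]
  rw [ENNReal.toReal_ofReal (by positivity)]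

theorem integral_ultraMeasure_Ioo (s : ℝ) (f : ℝ → ℝ) :
    ∫ u, f u ∂ultraMeasure s = ∫ u in Ioo (-1 : ℝ) 1, (1 - u ^ 2) ^ (s - 1) * f u := by
  rw [integral_ultraMeasure, intervalIntegral.integral_of_le (by norm_num),
    integral_Ioc_eq_integral_Ioo]

theorem integral_ultraMeasure_mono {s s' : ℝ} {f g : ℝ → ℝ} (hf : Integrable f (ultraMeasure s))
    (hg : Integrable g (ultraMeasure s'))
    (h : ∀ u ∈ Ioo (-1 : ℝ) 1, (1 - u ^ 2) ^ (s - 1) * f u ≤ (1 - u ^ 2) ^ (s' - 1) * g u) :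
    ∫ u, f u ∂ultraMeasure s ≤ ∫ u, g u ∂ultraMeasure s' := by
  rw [integral_ultraMeasure_Ioo, integral_ultraMeasure_Ioo]
  exact setIntegral_mono_on ((integrable_ultraMeasure_iff _ _).1 hf)
    ((integrable_ultraMeasure_iff _ _).1 hg) measurableSet_Ioo h

/-- The substitution z = 1 - u, followed by enlarging (0, 2) to the half-line, where Gamma integrals
are available. -/
theorem integral_ultraMeasure_le_Ioi {s : ℝ} {f g : ℝ → ℝ} (hf : Integrable f (ultraMeasure s))
    (hg : IntegrableOn g (Ioi 0)) (hg0 : ∀ z ∈ Ioi (0 : ℝ), 0 ≤ g z)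
    (h : ∀ u ∈ Ioo (-1 : ℝ) 1, (1 - u ^ 2) ^ (s - 1) * f u ≤ g (1 - u)) :
    ∫ u, f u ∂ultraMeasure s ≤ ∫ z in Ioi (0 : ℝ), g z := by
  have hmp : MeasurePreserving (fun u : ℝ => 1 - u) volume volume :=
    Measure.measurePreserving_sub_left volume 1
  have hemb : MeasurableEmbedding (fun u : ℝ => 1 - u) := (MeasurableEquiv.subLeft (1 : ℝ)).measurableEmbedding
  have hpre : (fun u : ℝ => 1 - u) ⁻¹' Ioo 0 2 = Ioo (-1) 1 := by
    ext u; simp only [mem_preimage, mem_Ioo]; constructor <;> rintro ⟨h1, h2⟩ <;>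
      constructor <;> linarith
  have hsub : Ioo (0 : ℝ) 2 ⊆ Ioi 0 := fun z hz => hz.1
  have hgi : IntegrableOn (fun u => g (1 - u)) (Ioo (-1) 1) := by
    rw [← hpre]
    exact (hmp.integrableOn_comp_preimage hemb).2 (hg.mono_set hsub)
  rw [integral_ultraMeasure_Ioo]
  calc _ ≤ ∫ u in Ioo (-1 : ℝ) 1, g (1 - u) :=
        setIntegral_mono_on ((integrable_ultraMeasure_iff _ _).1 hf) hgi measurableSet_Ioo h
    _ = ∫ z in Ioo (0 : ℝ) 2, g z := by
        rw [← hpre]; exact hmp.setIntegral_preimage_emb hemb _ _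
    _ ≤ _ := setIntegral_mono_set hg ((ae_restrict_mem measurableSet_Ioi).mono hg0)
        hsub.eventuallyLE

/-- The Laplace transform of `(1 - u)^η` with respect to the ultraspherical measure. -/
def ultraLaplace (s η y : ℝ) : ℝ := ∫ u, (1 - u) ^ η * Real.exp (-(y * (1 - u))) ∂ultraMeasure s

theorem one_sub_rpow_mul_exp_mem {η y u : ℝ} (hη : 0 ≤ η) (hy : 0 ≤ y)
    (hu : u ∈ Ioo (-1 : ℝ) 1) :
    |(1 - u) ^ η * Real.exp (-(y * (1 - u)))| ≤ 2 ^ η := by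
  have h1 : 0 ≤ 1 - u := by linarith [hu.2]
  rw [abs_of_nonneg (by positivity)]
  refine (mul_le_of_le_one_right (by positivity) ?_).trans
    (Real.rpow_le_rpow h1 (by linarith [hu.1]) hη)
  exact Real.exp_le_one_iff.2 (by nlinarith)

theorem integrable_one_sub_rpow_mul_exp {s η y : ℝ} (hs : 0 < s) (hη : 0 ≤ η) (hy : 0 ≤ y) :
    Integrable (fun u => (1 - u) ^ η * Real.exp (-(y * (1 - u)))) (ultraMeasure s) :=
  integrable_ultraMeasure_of_bound hs (by fun_prop) fun _ hu => one_sub_rpow_mul_exp_mem hη hy hu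

theorem ultraLaplace_nonneg (s η y : ℝ) : 0 ≤ ultraLaplace s η y :=
  integral_nonneg_of_ae ((ae_ultraMeasure_mem s).mono fun u hu => by
    have : 0 ≤ 1 - u := by linarith [hu.2]
    simp only [Pi.zero_apply]
    positivity)

theorem ultraLaplace_zero_le_mass {s y : ℝ} (hs : 0 < s) (hy : 0 ≤ y) :
    ultraLaplace s 0 y ≤ (ultraMeasure s).real univ := by
  have := isFiniteMeasure_ultraMeasure hs
  have h : ultraLaplace s 0 y ≤ ∫ _, (1 : ℝ) ∂ultraMeasure s := by
    refine integral_mono_ae (integrable_one_sub_rpow_mul_exp hs le_rfl hy) (integrable_const 1)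
      ((ae_ultraMeasure_mem s).mono fun u hu => ?_)
    have := (abs_le.1 (one_sub_rpow_mul_exp_mem le_rfl hy hu)).2
    simpa using this
  simpa using h

theorem integrableOn_rpow_mul_exp {k y : ℝ} (hk : 0 < k) (hy : 0 < y) :
    IntegrableOn (fun z : ℝ => z ^ (k - 1) * Real.exp (-(y * z))) (Ioi 0) := by
  have h := integrableOn_rpow_mul_exp_neg_mul_rpow (p := 1) (s := k - 1) (b := y) (by linarith)
    one_pos hy
  refine h.congr_fun (fun z _ => ?_) measurableSet_Ioi
  simp

theorem integral_rpow_mul_exp {k y : ℝ} (hk : 0 < k) (hy : 0 < y) :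
    ∫ z in Ioi (0 : ℝ), z ^ (k - 1) * Real.exp (-(y * z)) = y ^ (-k) * Real.Gamma k := by
  rw [Real.integral_rpow_mul_exp_neg_mul_Ioi hk hy, one_div, Real.inv_rpow hy.le,
    Real.rpow_neg hy.le]

theorem exists_ultraLaplace_zero_le {s : ℝ} (hs : 0 < s) :
    ∃ C, 0 < C ∧ ∀ y, 0 < y → ultraLaplace s 0 y ≤ C * y ^ (-s) := by
  have := isFiniteMeasure_ultraMeasure hs
  obtain ⟨C₁, hC₁, h₁⟩ := exists_one_add_rpow_le_exp hs.le one_pos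
  have hG := Real.Gamma_pos_of_pos hs
  refine ⟨(1 + 2 ^ (s - 1)) * Real.Gamma s + C₁ * (ultraMeasure s).real univ, by positivity,
    fun y hy => ?_⟩
  have hexp : Real.exp (-y) ≤ C₁ * y ^ (-s) := by
    rw [Real.rpow_neg hy.le, ← div_eq_mul_inv, le_div_iff₀ (by positivity), Real.exp_neg,
      inv_mul_le_iff₀ (Real.exp_pos _), mul_comm]
    have := h₁ y hy.le
    rw [one_mul] at this
    exact (Real.rpow_le_rpow hy.le (by linarith) hs.le).trans this
  -- Split at u = 0. For u ≤ 0 the exponential is at most e^(-y), which is O(y^(-s)). For u > 0 the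
  -- factor 1 + u lies in [1, 2], so (1 + u)^(s - 1) is at most 1 + 2^(s - 1) for either sign of s -
  -- 1.
  set f : ℝ → ℝ := (Ioi (0 : ℝ)).indicator fun u => Real.exp (-(y * (1 - u))) with hf
  have hfm : Measurable f := by
    rw [hf]
    exact (by fun_prop : Measurable fun u : ℝ => Real.exp (-(y * (1 - u)))).indicator
      measurableSet_Ioi
  have hfi : Integrable f (ultraMeasure s) := by
    refine integrable_ultraMeasure_of_bound hs hfm (C := 1) fun u hu => ?_
    rw [hf, ← Real.norm_eq_abs]
    refine (norm_indicator_le_norm_self _ _).trans ?_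
    rw [Real.norm_eq_abs, abs_of_pos (Real.exp_pos _)]
    exact Real.exp_le_one_iff.2 (by nlinarith [hu.2])
  have h2 : ultraLaplace s 0 y ≤ ∫ u, (f u + C₁ * y ^ (-s)) ∂ultraMeasure s := by
    refine integral_mono_ae (integrable_one_sub_rpow_mul_exp hs le_rfl hy.le)
      (hfi.add (integrable_const _)) ((ae_ultraMeasure_mem s).mono fun u hu => ?_)
    simp only [Real.rpow_zero, one_mul, hf]
    by_cases hu0 : u ∈ Ioi (0 : ℝ)
    · rw [indicator_of_mem hu0]
      have : 0 < C₁ * y ^ (-s) := by positivity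
      linarith
    · rw [indicator_of_notMem hu0, zero_add]
      refine le_trans (Real.exp_le_exp.2 ?_) hexp
      have : u ≤ 0 := not_lt.1 hu0
      nlinarith
  rw [integral_add hfi (integrable_const _), integral_const, smul_eq_mul] at h2
  have h3 : ∫ u, f u ∂ultraMeasure s ≤
      ∫ z in Ioi (0 : ℝ), (1 + 2 ^ (s - 1)) * (z ^ (s - 1) * Real.exp (-(y * z))) := by
    refine integral_ultraMeasure_le_Ioi hfi ((integrableOn_rpow_mul_exp hs hy).const_mul _)
      (fun z hz => ?_) fun u hu => ?_
    · have := mem_Ioi.1 hz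
      positivity
    · have h0 : 0 < 1 - u := by linarith [hu.2]
      simp only [hf]
      by_cases hu0 : u ∈ Ioi (0 : ℝ)
      · have hu0' := mem_Ioi.1 hu0
        rw [indicator_of_mem hu0, ← mul_assoc]
        refine mul_le_mul_of_nonneg_right ?_ (Real.exp_pos _).le
        rw [show 1 - u ^ 2 = (1 + u) * (1 - u) by ring, Real.mul_rpow (by linarith) h0.le]
        refine mul_le_mul_of_nonneg_right ?_ (by positivity)
        have h2p : (0 : ℝ) < 2 ^ (s - 1) := by positivity
        rcases le_total 1 s with h1s | h1s
        · have := Real.rpow_le_rpow (by linarith) (by linarith [hu.2] : 1 + u ≤ 2)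
            (by linarith : 0 ≤ s - 1)
          linarith
        · have := Real.rpow_le_one_of_one_le_of_nonpos (by linarith : 1 ≤ 1 + u)
            (by linarith : s - 1 ≤ 0)
          linarith
      · rw [indicator_of_notMem hu0, mul_zero]
        positivity
  rw [integral_const_mul, integral_rpow_mul_exp hs hy] at h3
  calc _ ≤ _ := h2
    _ ≤ (1 + 2 ^ (s - 1)) * (y ^ (-s) * Real.Gamma s) +
        (ultraMeasure s).real univ * (C₁ * y ^ (-s)) := by linarith
    _ = _ := by ring

/-- Bounded `N`: the comparison with the measure of parameter `s`. -/
theorem exists_ultraLaplace_add_le {s η κ : ℝ} (hs : 0 < s) (hη : 0 ≤ η) (hκ : κ ≤ η) :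
    ∃ C, 0 < C ∧ ∀ N y, 0 ≤ N → N ≤ 2 → 0 ≤ N + κ → 0 < y →
      ultraLaplace (N + s) η y ≤ C * y ^ (-(N + κ)) * ultraLaplace s 0 (y / 2) := by
  obtain ⟨C, hC, h⟩ := exists_one_add_rpow_le_exp (K := 2 + η) (c := 1 / 2) (by linarith)
    (by norm_num)
  refine ⟨4 * 2 ^ (η - κ) * C, by positivity, fun N y hN hN2 hNκ hy => ?_⟩
  rw [ultraLaplace, ultraLaplace, ← integral_const_mul]
  refine integral_ultraMeasure_mono (integrable_one_sub_rpow_mul_exp (by linarith) hη hy.le)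
    ((integrable_one_sub_rpow_mul_exp hs le_rfl (by positivity)).const_mul _) fun u hu => ?_
  have hz : 0 < 1 - u := by linarith [hu.2]
  have hz2 : 1 - u ≤ 2 := by linarith [hu.1]
  have hq : 0 < 1 - u ^ 2 := by nlinarith [hu.1, hu.2]
  rw [show N + s - 1 = (s - 1) + N by ring, Real.rpow_add hq, mul_assoc]
  refine mul_le_mul_of_nonneg_left ?_ (by positivity)
  rw [Real.rpow_zero, one_mul]
  set z := 1 - u
  have h1 : (1 - u ^ 2) ^ N ≤ 4 * z ^ N := by
    have e : (1 - u ^ 2) ^ N ≤ (2 * z) ^ N :=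
      Real.rpow_le_rpow hq.le (by simp only [z]; nlinarith [hu.1, hu.2]) hN
    rw [Real.mul_rpow (by norm_num) hz.le] at e
    have : (2 : ℝ) ^ N ≤ 4 := by
      calc (2 : ℝ) ^ N ≤ 2 ^ (2 : ℝ) := Real.rpow_le_rpow_of_exponent_le (by norm_num) hN2
        _ = 4 := by norm_num
    exact e.trans (mul_le_mul_of_nonneg_right this (by positivity))
  have h2 : z ^ (η - κ) ≤ 2 ^ (η - κ) := Real.rpow_le_rpow hz.le hz2 (by linarith)
  -- Powers of z are traded for powers of 1/y at the price of half of the exponential; hence y/2 on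
  -- the right side.
  have h3 : z ^ (N + κ) ≤ y ^ (-(N + κ)) * (C * Real.exp (1 / 2 * (y * z))) := by
    have e : (y * z) ^ (N + κ) ≤ C * Real.exp (1 / 2 * (y * z)) := by
      refine le_trans ?_ (h (y * z) (by positivity))
      calc (y * z) ^ (N + κ) ≤ (1 + y * z) ^ (N + κ) :=
            Real.rpow_le_rpow (by positivity) (by linarith) hNκ
        _ ≤ _ := Real.rpow_le_rpow_of_exponent_le (by nlinarith) (by linarith)
    rw [Real.mul_rpow hy.le hz.le] at e
    rwa [Real.rpow_neg hy.le, le_inv_mul_iff₀ (by positivity)]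
  have hexp : Real.exp (1 / 2 * (y * z)) * Real.exp (-(y * z)) = Real.exp (-(y / 2 * z)) := by
    rw [← Real.exp_add]; ring_nf
  calc (1 - u ^ 2) ^ N * (z ^ η * Real.exp (-(y * z)))
      ≤ 4 * z ^ N * (z ^ η * Real.exp (-(y * z))) :=
        mul_le_mul_of_nonneg_right h1 (by positivity)
    _ = 4 * (z ^ (η - κ) * z ^ (N + κ)) * Real.exp (-(y * z)) := by
        rw [← Real.rpow_add hz, show η - κ + (N + κ) = N + η by ring, Real.rpow_add hz]; ring
    _ ≤ 4 * (2 ^ (η - κ) * (y ^ (-(N + κ)) * (C * Real.exp (1 / 2 * (y * z))))) *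
        Real.exp (-(y * z)) := by gcongr
    _ = 4 * 2 ^ (η - κ) * C * y ^ (-(N + κ)) *
        (Real.exp (1 / 2 * (y * z)) * Real.exp (-(y * z))) := by ring
    _ = _ := by rw [hexp]

/-- Large `N`: the damping by the factor `(1 + u)^{N+s-1}`. -/
theorem exists_ultraLaplace_add_le_of_two_le {s η q : ℝ} (hs : 0 < s) (hη : 0 ≤ η) (hq : 0 ≤ q)
    (hsq : 0 < 2 + s + η - q) :
    ∃ C, 0 < C ∧ ∀ N y, 2 ≤ N → 0 < y → ultraLaplace (N + s) η y ≤
      C * (2 ^ N * (1 + N) ^ (η - 2 * q) * Real.Gamma (N + s) * y ^ (-(N + s + η - q))) := by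
  obtain ⟨C, hC, h⟩ := exists_one_add_rpow_le_exp (c := 1 / 6) hq (by norm_num)
  obtain ⟨C₂, hC₂, h₂⟩ := exists_Gamma_ratio_le (s + η - q) s
    (κ := min (2 + s + η - q) (2 + s)) (lt_min hsq (by linarith))
  refine ⟨2 ^ (s - 1) * C * C₂, by positivity, fun N y hN hy => ?_⟩
  have hk : 0 < N + s + η - q := by linarith
  have hN1 : 0 < 1 + N := by linarith
  have h3 : ultraLaplace (N + s) η y ≤ ∫ z in Ioi (0 : ℝ),
      2 ^ (N + s - 1) * C * (1 + N) ^ (-q) *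
        (z ^ ((N + s + η - q) - 1) * Real.exp (-(y * z))) := by
    refine integral_ultraMeasure_le_Ioi (integrable_one_sub_rpow_mul_exp (by linarith) hη hy.le)
      ((integrableOn_rpow_mul_exp hk hy).const_mul _) (fun z hz => ?_) fun u hu => ?_
    · have := mem_Ioi.1 hz
      positivity
    · have hz : 0 < 1 - u := by linarith [hu.2]
      have hw : 0 < (1 + u) / 2 := by linarith [hu.1]
      rw [show 1 - u ^ 2 = 2 * (1 - u) * ((1 + u) / 2) by ring,
        Real.mul_rpow (by positivity) hw.le, Real.mul_rpow (by norm_num) hz.le]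
      -- Here (1 + u)/2 ≤ e^(-(1 - u)/2), and N + s - 1 ≥ (1 + N)/3 because N ≥ 2; this gives the
      -- rate 1/6. The exponential then absorbs the power q of (1 + N)(1 - u).
      have h4 : ((1 + u) / 2) ^ (N + s - 1) ≤ C * ((1 + N) ^ (-q) * (1 - u) ^ (-q)) := by
        rw [← Real.mul_rpow hN1.le hz.le, Real.rpow_neg (by positivity), ← div_eq_mul_inv,
          le_div_iff₀ (by positivity)]
        have e1 : ((1 + u) / 2) ^ (N + s - 1) ≤ Real.exp (-(1 / 6 * ((1 + N) * (1 - u)))) := by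
          calc ((1 + u) / 2) ^ (N + s - 1) ≤ (Real.exp (-((1 - u) / 2))) ^ (N + s - 1) := by
                refine Real.rpow_le_rpow hw.le ?_ (by linarith)
                have := Real.add_one_le_exp (-((1 - u) / 2))
                linarith
            _ = Real.exp (-((1 - u) / 2) * (N + s - 1)) := by rw [← Real.exp_mul]
            _ ≤ _ := by
                refine Real.exp_le_exp.2 ?_
                nlinarith
        have e2 : ((1 + N) * (1 - u)) ^ q ≤ C * Real.exp (1 / 6 * ((1 + N) * (1 - u))) :=
          (Real.rpow_le_rpow (by positivity) (by linarith) hq).trans (h _ (by positivity))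
        calc _ ≤ Real.exp (-(1 / 6 * ((1 + N) * (1 - u)))) *
              (C * Real.exp (1 / 6 * ((1 + N) * (1 - u)))) :=
              mul_le_mul e1 e2 (by positivity) (by positivity)
          _ = C := by rw [mul_left_comm, ← Real.exp_add]; simp
      have h5 : (1 - u) ^ (N + s - 1) * (1 - u) ^ (-q) * (1 - u) ^ η =
          (1 - u) ^ (N + s + η - q - 1) := by
        rw [← Real.rpow_add hz, ← Real.rpow_add hz]; ring_nf
      rw [← h5]
      calc 2 ^ (N + s - 1) * (1 - u) ^ (N + s - 1) * ((1 + u) / 2) ^ (N + s - 1) *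
            ((1 - u) ^ η * Real.exp (-(y * (1 - u))))
          ≤ 2 ^ (N + s - 1) * (1 - u) ^ (N + s - 1) * (C * ((1 + N) ^ (-q) * (1 - u) ^ (-q))) *
            ((1 - u) ^ η * Real.exp (-(y * (1 - u)))) := by gcongr
        _ = _ := by ring
  rw [integral_const_mul, integral_rpow_mul_exp hk hy] at h3
  have h6 := h₂ N (by linarith) ((min_le_left _ _).trans (by linarith))
    ((min_le_right _ _).trans (by linarith))
  rw [show s + η - q - s = η - q by ring, show N + (s + η - q) = N + s + η - q by ring] at h6
  refine h3.trans ?_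
  calc 2 ^ (N + s - 1) * C * (1 + N) ^ (-q) *
        (y ^ (-(N + s + η - q)) * Real.Gamma (N + s + η - q))
      ≤ 2 ^ (N + s - 1) * C * (1 + N) ^ (-q) *
        (y ^ (-(N + s + η - q)) * (C₂ * (1 + N) ^ (η - q) * Real.Gamma (N + s))) := by gcongr
    _ = _ := by
      rw [show N + s - 1 = N + (s - 1) by ring, Real.rpow_add two_pos,
        show η - 2 * q = -q + (η - q) by ring, Real.rpow_add hN1]
      ring

theorem exists_one_le_mul_Gamma {s : ℝ} (hs : 0 < s) (r : ℝ) :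
    ∃ C, 0 < C ∧ ∀ N, 0 ≤ N → N ≤ 2 → 1 ≤ C * (2 ^ N * (1 + N) ^ r * Real.Gamma (N + s)) := by
  obtain ⟨x, hx, hmin⟩ := isCompact_Icc.exists_isMinOn (nonempty_Icc.2 (zero_le_two (α := ℝ)))
    (f := fun N : ℝ => 2 ^ N * (1 + N) ^ r * Real.Gamma (N + s)) (by
      intro N hN
      have h1 : ContinuousAt (fun N : ℝ => (2 : ℝ) ^ N) N :=
        (Real.continuous_const_rpow two_ne_zero).continuousAt
      have h2 : ContinuousAt (fun N : ℝ => (1 + N) ^ r) N :=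
        (continuousAt_const.add continuousAt_id).rpow_const
          (Or.inl (by have := hN.1; show (1 + N : ℝ) ≠ 0; positivity))
      have h3 : ContinuousAt (fun N : ℝ => Real.Gamma (N + s)) N := by
        refine ContinuousAt.comp (f := fun N : ℝ => N + s) (g := Real.Gamma)
          (Real.differentiableAt_Gamma fun m => ?_).continuousAt (by fun_prop)
        have := hN.1
        have hm : (0 : ℝ) ≤ m := m.cast_nonneg
        linarith [hN.1]
      exact ((h1.mul h2).mul h3).continuousWithinAt)
  have hpos : 0 < 2 ^ x * (1 + x) ^ r * Real.Gamma (x + s) := by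
    have h0 := hx.1
    have := Real.Gamma_pos_of_pos (by linarith : 0 < x + s)
    positivity
  refine ⟨(2 ^ x * (1 + x) ^ r * Real.Gamma (x + s))⁻¹, by positivity, fun N h0 h2 => ?_⟩
  rw [le_inv_mul_iff₀ hpos, mul_one]
  exact hmin ⟨h0, h2⟩

end


/-! ### Bounds uniform in N, and separation of the variables. -/

noncomputable section

/-- The parameter r weakens the decay in y by y^r and gains (1 + N)^(-2r). For N ≥ 2 the damping
lemma is used with q = p + r. For N ≤ 2 the powers of 1 + N are immaterial, and the transform of
parameter s is bounded by y^(-s) when r = 0 and by the total mass when r ≥ s, which explains the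
alternative imposed on r. -/
theorem exists_ultraLaplace_le {s σ p r : ℝ} (hs : 0 < s) (hp : 0 ≤ p) (hη : 0 ≤ σ + p)
    (hr : r = 0 ∨ s ≤ r) (hκ : 0 < 2 + s + σ - r) :
    ∃ C, 0 < C ∧ ∀ N y, 0 ≤ N → 0 < y → 0 ≤ N + σ → 0 ≤ N + s + σ - r →
      ultraLaplace (N + s) (σ + p) y ≤
        C * (2 ^ N * (1 + N) ^ (σ - p - 2 * r) * Real.Gamma (N + s) *
          y ^ (-(N + s + σ - r))) := by
  have hr0 : 0 ≤ r := by rcases hr with h | h <;> linarith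
  obtain ⟨C₁, hC₁, h₁⟩ := exists_ultraLaplace_add_le_of_two_le (q := p + r) hs hη
    (by linarith) (by linarith)
  obtain ⟨C₂, hC₂, h₂⟩ := exists_one_le_mul_Gamma hs (σ - p - 2 * r)
  obtain ⟨C₃, hC₃, h₃⟩ : ∃ C, 0 < C ∧ ∀ N y, 0 ≤ N → N ≤ 2 → 0 < y → 0 ≤ N + σ →
      0 ≤ N + s + σ - r → ultraLaplace (N + s) (σ + p) y ≤ C * y ^ (-(N + s + σ - r)) := by
    rcases hr with rfl | hr
    · obtain ⟨C, hC, h⟩ := exists_ultraLaplace_add_le (κ := σ) hs hη (by linarith)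
      obtain ⟨C', hC', h'⟩ := exists_ultraLaplace_zero_le hs
      refine ⟨C * (C' * 2 ^ s), by positivity, fun N y hN hN2 hy hNσ _ => ?_⟩
      refine (h N y hN hN2 hNσ hy).trans ?_
      calc C * y ^ (-(N + σ)) * ultraLaplace s 0 (y / 2)
          ≤ C * y ^ (-(N + σ)) * (C' * (y / 2) ^ (-s)) := by
            gcongr
            exact h' _ (by positivity)
        _ = _ := by
            rw [Real.div_rpow hy.le (by norm_num), Real.rpow_neg (by norm_num : (0 : ℝ) ≤ 2),
              show -(N + s + σ - 0) = -(N + σ) + -s by ring, Real.rpow_add hy]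
            field_simp
    · obtain ⟨C, hC, h⟩ := exists_ultraLaplace_add_le (κ := s + σ - r) hs hη (by linarith)
      have := isFiniteMeasure_ultraMeasure hs
      refine ⟨C * ((ultraMeasure s).real univ + 1), by positivity,
        fun N y hN hN2 hy _ hNr => ?_⟩
      refine (h N y hN hN2 (by linarith) hy).trans ?_
      rw [show N + (s + σ - r) = N + s + σ - r by ring, mul_right_comm]
      gcongr
      exact (ultraLaplace_zero_le_mass hs (by positivity)).trans (by linarith)
  refine ⟨C₁ + C₃ * C₂, by positivity, fun N y hN hy hNσ hNr => ?_⟩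
  have hG := Real.Gamma_pos_of_pos (by linarith : 0 < N + s)
  have hB : 0 < 2 ^ N * (1 + N) ^ (σ - p - 2 * r) * Real.Gamma (N + s) := by positivity
  have hyp : 0 < y ^ (-(N + s + σ - r)) := by positivity
  rcases le_total N 2 with hN2 | hN2
  · calc _ ≤ C₃ * y ^ (-(N + s + σ - r)) := h₃ N y hN hN2 hy hNσ hNr
      _ ≤ C₃ * y ^ (-(N + s + σ - r)) *
          (C₂ * (2 ^ N * (1 + N) ^ (σ - p - 2 * r) * Real.Gamma (N + s))) :=
          le_mul_of_one_le_right (by positivity) (h₂ N hN hN2)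
      _ = C₃ * C₂ * (2 ^ N * (1 + N) ^ (σ - p - 2 * r) * Real.Gamma (N + s) *
          y ^ (-(N + s + σ - r))) := by ring
      _ ≤ _ := by gcongr; linarith
  · have := h₁ N y hN2 hy
    rw [show σ + p - 2 * (p + r) = σ - p - 2 * r by ring,
      show N + s + (σ + p) - (p + r) = N + s + σ - r by ring] at this
    refine this.trans ?_
    gcongr
    linarith [mul_pos hC₃ hC₂]

theorem exists_weighted_ultraLaplace_le {s σ p r : ℝ} (hs : 0 < s) (hp : 0 ≤ p)
    (hη : 0 ≤ σ + p) (hr : r = 0 ∨ s ≤ r) (hκ : 0 < 2 + s + σ - r) :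
    ∃ C, 0 < C ∧ ∀ N X τ, 0 ≤ N → 0 < X → 0 < τ → 0 ≤ N + σ → 0 ≤ N + s + σ - r →
      (1 + N) ^ (p - σ) * X ^ σ * (X ^ N / (2 ^ N * Real.Gamma (N + s))) *
        ultraLaplace (N + s) (σ + p) (τ * X) ≤
      C * ((1 + N) ^ (-2 * r) * X ^ (r - s) * τ ^ r * τ ^ (-(N + s + σ))) := by
  obtain ⟨C, hC, h⟩ := exists_ultraLaplace_le hs hp hη hr hκ
  refine ⟨C, hC, fun N X τ hN hX hτ hNσ hNr => ?_⟩
  have hG := Real.Gamma_pos_of_pos (by linarith : 0 < N + s)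
  have hN1 : 0 < 1 + N := by linarith
  refine (mul_le_mul_of_nonneg_left (h N (τ * X) hN (by positivity) hNσ hNr)
    (by positivity)).trans_eq ?_
  have e1 : (1 + N) ^ (-2 * r) = (1 + N) ^ (p - σ) * (1 + N) ^ (σ - p - 2 * r) := by
    rw [← Real.rpow_add hN1]; ring_nf
  have e2 : X ^ (r - s) = X ^ σ * X ^ N * X ^ (-(N + s + σ - r)) := by
    rw [← Real.rpow_add hX, ← Real.rpow_add hX]; ring_nf
  have e3 : τ ^ (-(N + s + σ - r)) = τ ^ r * τ ^ (-(N + s + σ)) := by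
    rw [← Real.rpow_add hτ]; ring_nf
  rw [Real.mul_rpow hτ.le hX.le, e1, e2, e3]
  field_simp

/-- A bound for a weighted Laplace transform, of the order which makes the integrals over `τ`
scale like powers of `D`. -/
def LaplaceBound (E s N D X σ η W : ℝ) : Prop :=
  ∀ τ, 0 < τ → W * (X + D) ^ s * (X ^ N / (2 ^ N * Real.Gamma (N + s))) *
    ultraLaplace (N + s) η (τ * X) ≤ E * τ ^ (-(N + s + σ)) * (1 + D * τ) ^ (s + 1)

/-- If D ≤ X, the choice r = 0 yields X^(-s), which cancels (X + D)^s. If X ≤ D, the choice r = s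
yields τ^s, and (Dτ)^s is absorbed by the slack (1 + Dτ)^(s + 1). -/
theorem exists_laplaceBound {s σ p : ℝ} (hs : 0 < s) (hp : 0 ≤ p) (hη : 0 ≤ σ + p)
    (hσ : -2 < σ) :
    ∃ E, 0 < E ∧ ∀ N X D, 0 ≤ N → 0 ≤ N + σ → 0 < X → 0 < D →
      LaplaceBound E s N D X σ (σ + p) ((1 + N) ^ (p - σ) * X ^ σ) := by
  obtain ⟨C₀, hC₀, h₀⟩ := exists_weighted_ultraLaplace_le (r := 0) hs hp hη (Or.inl rfl)
    (by linarith)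
  obtain ⟨C₁, hC₁, h₁⟩ := exists_weighted_ultraLaplace_le (r := s) hs hp hη (Or.inr le_rfl)
    (by linarith)
  refine ⟨2 ^ s * (C₀ + C₁), by positivity, fun N X D hN hNσ hX hD τ hτ => ?_⟩
  have hN1 : 1 ≤ 1 + N := by linarith
  have hDτ : 0 < D * τ := by positivity
  have hL := ultraLaplace_nonneg (N + s) (σ + p) (τ * X)
  rw [show (1 + N) ^ (p - σ) * X ^ σ * (X + D) ^ s * (X ^ N / (2 ^ N * Real.Gamma (N + s))) *
    ultraLaplace (N + s) (σ + p) (τ * X) = (X + D) ^ s * ((1 + N) ^ (p - σ) * X ^ σ *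
      (X ^ N / (2 ^ N * Real.Gamma (N + s))) * ultraLaplace (N + s) (σ + p) (τ * X)) by ring]
  have hone : 1 ≤ (1 + D * τ) ^ (s + 1) := Real.one_le_rpow (by linarith) (by linarith)
  rcases le_total D X with hDX | hDX
  · calc _ ≤ (2 * X) ^ s * (C₀ * ((1 + N) ^ (-2 * (0 : ℝ)) * X ^ (0 - s) * τ ^ (0 : ℝ) *
          τ ^ (-(N + s + σ)))) :=
          mul_le_mul (Real.rpow_le_rpow (by positivity) (by linarith) hs.le)
            (h₀ N X τ hN hX hτ hNσ (by linarith)) (by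
              have := Real.Gamma_pos_of_pos (by linarith : 0 < N + s)
              positivity) (by positivity)
      _ = 2 ^ s * C₀ * τ ^ (-(N + s + σ)) * 1 := by
          rw [Real.mul_rpow (by norm_num) hX.le, zero_sub, Real.rpow_neg hX.le, mul_zero,
            Real.rpow_zero, Real.rpow_zero]
          have := Real.rpow_pos_of_pos hX s
          field_simp
      _ ≤ _ := by
          gcongr
          linarith
  · have hle1 : (1 + N) ^ (-2 * s) ≤ 1 := Real.rpow_le_one_of_one_le_of_nonpos hN1 (by linarith)
    calc _ ≤ (2 * D) ^ s * (C₁ * ((1 + N) ^ (-2 * s) * X ^ (s - s) * τ ^ s *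
          τ ^ (-(N + s + σ)))) :=
          mul_le_mul (Real.rpow_le_rpow (by positivity) (by linarith) hs.le)
            (h₁ N X τ hN hX hτ hNσ (by linarith)) (by
              have := Real.Gamma_pos_of_pos (by linarith : 0 < N + s)
              positivity) (by positivity)
      _ ≤ (2 * D) ^ s * (C₁ * (1 * X ^ (s - s) * τ ^ s * τ ^ (-(N + s + σ)))) := by gcongr
      _ = 2 ^ s * C₁ * τ ^ (-(N + s + σ)) * (D * τ) ^ s := by
          rw [Real.mul_rpow (by norm_num) hD.le, Real.mul_rpow hD.le hτ.le, sub_self,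
            Real.rpow_zero]
          ring
      _ ≤ 2 ^ s * (C₀ + C₁) * τ ^ (-(N + s + σ)) * (1 + D * τ) ^ (s + 1) := by
          have : (D * τ) ^ s ≤ (1 + D * τ) ^ (s + 1) :=
            (Real.rpow_le_rpow hDτ.le (by linarith) hs.le).trans
              (Real.rpow_le_rpow_of_exponent_le (by linarith) (by linarith))
          gcongr
          linarith

/-- The choice r = s + 1 yields an extra X, which cancels the 1/X of the weight, and (1 + N)^(-2(s +
1)), which absorbs N. It requires N + σ ≥ 1, whence the alternative N = 0 or N ≥ 1. -/
theorem exists_laplaceBound_of_le {s σ p : ℝ} (hs : 0 < s) (hp : 0 ≤ p) (hσ : 0 ≤ σ) :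
    ∃ E, 0 < E ∧ ∀ N X D, (N = 0 ∨ 1 ≤ N) → 0 < X → X ≤ 4 * D →
      LaplaceBound E s N D X σ (σ + p) (N * (D / X) * ((1 + N) ^ (p - σ) * X ^ σ)) := by
  obtain ⟨C₁, hC₁, h₁⟩ := exists_weighted_ultraLaplace_le (r := s + 1) (σ := σ) hs hp
    (by linarith) (Or.inr (by linarith)) (by linarith)
  refine ⟨5 ^ s * C₁, by positivity, fun N X D hN hX hXD τ hτ => ?_⟩
  have hD : 0 < D := by linarith
  rcases hN with rfl | hN
  · simp only [zero_mul]
    positivity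
  have hDτ : 0 < D * τ := by positivity
  have hG := Real.Gamma_pos_of_pos (by linarith : 0 < N + s)
  have hL := ultraLaplace_nonneg (N + s) (σ + p) (τ * X)
  rw [show N * (D / X) * ((1 + N) ^ (p - σ) * X ^ σ) * (X + D) ^ s *
    (X ^ N / (2 ^ N * Real.Gamma (N + s))) *
    ultraLaplace (N + s) (σ + p) (τ * X) = N * (D / X) * ((X + D) ^ s * ((1 + N) ^ (p - σ) *
      X ^ σ * (X ^ N / (2 ^ N * Real.Gamma (N + s))) *
        ultraLaplace (N + s) (σ + p) (τ * X))) by ring]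
  have hle1 : N * (1 + N) ^ (-2 * (s + 1)) ≤ 1 := by
    have : (1 + N) ^ (-2 * (s + 1)) ≤ (1 + N) ^ (-1 : ℝ) :=
      Real.rpow_le_rpow_of_exponent_le (by linarith) (by linarith)
    rw [Real.rpow_neg_one] at this
    calc N * (1 + N) ^ (-2 * (s + 1)) ≤ N * (1 + N)⁻¹ := by gcongr
      _ ≤ 1 := by rw [← div_eq_mul_inv, div_le_one (by linarith)]; linarith
  calc _ ≤ N * (D / X) * ((5 * D) ^ s * (C₁ * ((1 + N) ^ (-2 * (s + 1)) * X ^ (s + 1 - s) *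
          τ ^ (s + 1) * τ ^ (-(N + s + σ))))) := by
        refine mul_le_mul_of_nonneg_left ?_ (by positivity)
        exact mul_le_mul (Real.rpow_le_rpow (by positivity) (by linarith) hs.le)
            (h₁ N X τ (by linarith) hX hτ (by linarith) (by linarith))
            (by positivity) (by positivity)
    _ = N * (1 + N) ^ (-2 * (s + 1)) * (5 ^ s * C₁ * τ ^ (-(N + s + σ)) *
          (D * τ) ^ (s + 1)) := by
        rw [Real.mul_rpow (by norm_num) hD.le, Real.mul_rpow hD.le hτ.le, add_sub_cancel_left,
          Real.rpow_one, Real.rpow_add_one hD.ne']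
        field_simp
    _ ≤ 1 * (5 ^ s * C₁ * τ ^ (-(N + s + σ)) * (D * τ) ^ (s + 1)) := by gcongr
    _ ≤ _ := by
        rw [one_mul]
        gcongr
        linarith

theorem LaplaceBound.mono_weight {E s N D X σ η W W' : ℝ} (h : LaplaceBound E s N D X σ η W)
    (hs : 0 < N + s) (hX : 0 ≤ X) (hD : 0 ≤ D) (hW : W' ≤ W) :
    LaplaceBound E s N D X σ η W' := fun τ hτ => by
  refine le_trans ?_ (h τ hτ)
  have := ultraLaplace_nonneg (N + s) η (τ * X)
  have := Real.Gamma_pos_of_pos hs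
  gcongr

/-- Writing Γ(e) q^(-e) as the integral of τ^(e - 1) e^(-qτ) factorizes the exponential, since q is
affine in u and v separately; Fubini's theorem does the rest. -/
theorem Gamma_mul_integral_ultraProd {s s' η η' e D X Y : ℝ} (hs : 0 < s) (hs' : 0 < s')
    (hη : 0 ≤ η) (hη' : 0 ≤ η') (he : 0 < e) (hD : 0 < D) (hX : 0 ≤ X) (hY : 0 ≤ Y) :
    Real.Gamma e * ∫ p, (1 - p.1) ^ η * (1 - p.2) ^ η' *
        (D + X * (1 - p.1) + Y * (1 - p.2)) ^ (-e) ∂ultraProd s s' =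
      ∫ τ in Ioi (0 : ℝ), τ ^ (e - 1) * Real.exp (-(D * τ)) *
        (ultraLaplace s η (τ * X) * ultraLaplace s' η' (τ * Y)) := by
  have := isFiniteMeasure_ultraMeasure hs
  have := isFiniteMeasure_ultraMeasure hs'
  have hint : Integrable (fun y : (ℝ × ℝ) × ℝ => (1 - y.1.1) ^ η *
      Real.exp (-(y.2 * X * (1 - y.1.1))) * ((1 - y.1.2) ^ η' *
      Real.exp (-(y.2 * Y * (1 - y.1.2)))) * (y.2 ^ (e - 1) * Real.exp (-(D * y.2))))
      ((ultraProd s s').prod (volume.restrict (Ioi 0))) := by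
    have h := (integrable_const (2 ^ η * 2 ^ η' : ℝ) (μ := ultraProd s s')).mul_prod
      (integrableOn_rpow_mul_exp he hD)
    refine h.mono' (Measurable.aestronglyMeasurable (by fun_prop)) ?_
    filter_upwards [Measure.quasiMeasurePreserving_snd.ae (ae_restrict_mem measurableSet_Ioi),
      Measure.quasiMeasurePreserving_fst.ae (ae_ultraMeasure_prod_mem s s')] with y hy1 hy2
    have hy : 0 < y.2 := hy1
    rw [Real.norm_eq_abs, abs_mul, abs_mul, abs_of_nonneg
      (by positivity : 0 ≤ y.2 ^ (e - 1) * Real.exp (-(D * y.2)))]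
    refine mul_le_mul_of_nonneg_right ?_ (by positivity)
    exact mul_le_mul (one_sub_rpow_mul_exp_mem hη (by positivity) hy2.1)
      (one_sub_rpow_mul_exp_mem hη' (by positivity) hy2.2) (abs_nonneg _) (by positivity)
  have h1 : ∀ᵐ p ∂ultraProd s s', Real.Gamma e * ((1 - p.1) ^ η * (1 - p.2) ^ η' *
        (D + X * (1 - p.1) + Y * (1 - p.2)) ^ (-e)) =
      ∫ τ in Ioi (0 : ℝ), (1 - p.1) ^ η *
      Real.exp (-(τ * X * (1 - p.1))) * ((1 - p.2) ^ η' *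
      Real.exp (-(τ * Y * (1 - p.2)))) * (τ ^ (e - 1) * Real.exp (-(D * τ))) := by
    filter_upwards [ae_ultraMeasure_prod_mem s s'] with p hp
    have h1 : 0 < 1 - p.1 := by linarith [hp.1.2]
    have h2 : 0 < 1 - p.2 := by linarith [hp.2.2]
    have hq : 0 < D + X * (1 - p.1) + Y * (1 - p.2) := by positivity
    have h3 := integral_rpow_mul_exp he hq
    calc _ = (1 - p.1) ^ η * (1 - p.2) ^ η' *
          ((D + X * (1 - p.1) + Y * (1 - p.2)) ^ (-e) * Real.Gamma e) := by ring
      _ = _ := by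
        rw [← h3, ← integral_const_mul]
        refine integral_congr_ae (Filter.Eventually.of_forall fun τ => ?_)
        have hexp : Real.exp (-((D + X * (1 - p.1) + Y * (1 - p.2)) * τ)) =
            Real.exp (-(τ * X * (1 - p.1))) * Real.exp (-(τ * Y * (1 - p.2))) *
              Real.exp (-(D * τ)) := by
          rw [← Real.exp_add, ← Real.exp_add]; ring_nf
        simp only [hexp]
        ring
  rw [← integral_const_mul, integral_congr_ae h1, integral_integral_swap hint]
  refine integral_congr_ae (Filter.Eventually.of_forall fun τ => ?_)
  simp only
  rw [integral_mul_const, integral_prod_mul (fun u : ℝ => (1 - u) ^ η *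
      Real.exp (-(τ * X * (1 - u)))) (fun v : ℝ => (1 - v) ^ η' *
      Real.exp (-(τ * Y * (1 - v)))), mul_comm]
  rfl

/-- The exponents of τ in the two Laplace bounds cancel against e - 1 down to δ - 1, independently
of N and M. Half of e^(-Dτ) absorbs the powers of 1 + Dτ, and the other half gives a Gamma integral
of size D^(-δ). -/
theorem exists_weighted_integral_le {s s' δ : ℝ} (hs : 0 < s) (hs' : 0 < s') (hδ : 0 < δ) :
    ∃ C, 0 < C ∧ ∀ E E' N M D X Y σ σ' η η' W W', 0 ≤ E → 0 ≤ N → 0 ≤ M → 0 < D → 0 < X → 0 < Y →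
      0 ≤ η → 0 ≤ η' → 0 ≤ W → 0 ≤ W' → 0 < N + M + s + s' + σ + σ' + δ →
      LaplaceBound E s N D X σ η W → LaplaceBound E' s' M D Y σ' η' W' →
      W * W' * ((X + D) ^ s * (Y + D) ^ s') * ((X ^ N / (2 ^ N * Real.Gamma (N + s))) *
        (Y ^ M / (2 ^ M * Real.Gamma (M + s')))) *
        (Real.Gamma (N + M + s + s' + σ + σ' + δ) *
          ∫ p, (1 - p.1) ^ η * (1 - p.2) ^ η' * (D + X * (1 - p.1) + Y * (1 - p.2)) ^
            (-(N + M + s + s' + σ + σ' + δ)) ∂ultraProd (N + s) (M + s')) ≤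
        E * E' * C * D ^ (-δ) := by
  obtain ⟨C, hC, h⟩ := exists_one_add_rpow_le_exp (K := s + 1 + (s' + 1)) (c := 1 / 2)
    (by linarith) (by norm_num)
  have hG := Real.Gamma_pos_of_pos hδ
  refine ⟨C * (2 ^ δ * Real.Gamma δ), by positivity, ?_⟩
  intro E E' N M D X Y σ σ' η η' W W' hE hN hM hD hX hY hη hη' hW hW' he hB hB'
  set e := N + M + s + s' + σ + σ' + δ with hedef
  have hgN := Real.Gamma_pos_of_pos (by linarith : 0 < N + s)
  have hgM := Real.Gamma_pos_of_pos (by linarith : 0 < M + s')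
  rw [Gamma_mul_integral_ultraProd (by linarith) (by linarith) hη hη' he hD hX.le hY.le,
    ← integral_const_mul]
  have hmaj := (integrableOn_rpow_mul_exp hδ (half_pos hD)).const_mul (E * E' * C)
  have hval := integral_rpow_mul_exp hδ (half_pos hD)
  calc _ ≤ ∫ τ in Ioi (0 : ℝ), E * E' * C * (τ ^ (δ - 1) * Real.exp (-(D / 2 * τ))) := by
        refine integral_mono_of_nonneg ?_ hmaj ?_
        · filter_upwards [ae_restrict_mem measurableSet_Ioi] with τ hτ
          have hτ' : 0 < τ := hτ
          have := ultraLaplace_nonneg (N + s) η (τ * X)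
          have := ultraLaplace_nonneg (M + s') η' (τ * Y)
          simp only [Pi.zero_apply]
          positivity
        · filter_upwards [ae_restrict_mem measurableSet_Ioi] with τ hτ
          have hτ' : 0 < τ := hτ
          have hL := ultraLaplace_nonneg (N + s) η (τ * X)
          have hL' := ultraLaplace_nonneg (M + s') η' (τ * Y)
          have hDτ : 0 < D * τ := by positivity
          have hprod := mul_le_mul (hB τ hτ') (hB' τ hτ') (by positivity) (by positivity)
          have h1 := h (D * τ) hDτ.le
          have hexp : Real.exp (1 / 2 * (D * τ)) * Real.exp (-(D * τ)) =
              Real.exp (-(D / 2 * τ)) := by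
            rw [← Real.exp_add]; ring_nf
          have hE' : 0 ≤ E' := by
            have h2 : 0 ≤ E' * τ ^ (-(M + s' + σ')) * (1 + D * τ) ^ (s' + 1) :=
              le_trans (by positivity) (hB' τ hτ')
            exact nonneg_of_mul_nonneg_left
              (nonneg_of_mul_nonneg_left h2 (by positivity)) (by positivity)
          calc W * W' * ((X + D) ^ s * (Y + D) ^ s') * ((X ^ N / (2 ^ N * Real.Gamma (N + s))) *
                (Y ^ M / (2 ^ M * Real.Gamma (M + s')))) * (τ ^ (e - 1) * Real.exp (-(D * τ)) *
                (ultraLaplace (N + s) η (τ * X) * ultraLaplace (M + s') η' (τ * Y)))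
              = τ ^ (e - 1) * Real.exp (-(D * τ)) *
                (W * (X + D) ^ s * (X ^ N / (2 ^ N * Real.Gamma (N + s))) *
                  ultraLaplace (N + s) η (τ * X) *
                (W' * (Y + D) ^ s' * (Y ^ M / (2 ^ M * Real.Gamma (M + s'))) *
                  ultraLaplace (M + s') η' (τ * Y))) := by ring
            _ ≤ τ ^ (e - 1) * Real.exp (-(D * τ)) *
                (E * τ ^ (-(N + s + σ)) * (1 + D * τ) ^ (s + 1) *
                  (E' * τ ^ (-(M + s' + σ')) * (1 + D * τ) ^ (s' + 1))) :=
                mul_le_mul_of_nonneg_left hprod (by positivity)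
            _ = E * E' * (τ ^ (δ - 1) * Real.exp (-(D * τ))) *
                (1 + D * τ) ^ (s + 1 + (s' + 1)) := by
                rw [Real.rpow_add (by positivity : 0 < 1 + D * τ) (s + 1) (s' + 1),
                  show δ - 1 = (e - 1) + -(N + s + σ) + -(M + s' + σ') by rw [hedef]; ring,
                  Real.rpow_add hτ', Real.rpow_add hτ']
                ring
            _ ≤ E * E' * (τ ^ (δ - 1) * Real.exp (-(D * τ))) *
                (C * Real.exp (1 / 2 * (D * τ))) := by gcongr
            _ = E * E' * C * (τ ^ (δ - 1) *
                (Real.exp (1 / 2 * (D * τ)) * Real.exp (-(D * τ)))) := by ring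
            _ = _ := by rw [hexp]
    _ = _ := by
        rw [integral_const_mul, hval, Real.div_rpow hD.le (by norm_num),
          Real.rpow_neg (by norm_num : (0 : ℝ) ≤ 2)]
        field_simp

end


/-! ### The list of weights, and the moments they control. -/

noncomputable section

theorem LaplaceBound.of_le {E E' s N D X σ η η' W W' : ℝ} (h : LaplaceBound E s N D X σ η W)
    (hs : 0 < N + s) (hX : 0 ≤ X) (hD : 0 ≤ D) (hE : E ≤ E') (hη : η = η') (hW : W' ≤ W) :
    LaplaceBound E' s N D X σ η' W' := fun τ hτ => by
  subst hη
  refine (h.mono_weight hs hX hD hW τ hτ).trans ?_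
  gcongr

theorem exists_laplaceBounds {s : ℝ} (hs : 0 < s) :
    ∃ E, 0 < E ∧ ∀ N X D, (N = 0 ∨ 1 ≤ N) → 0 < X → 0 < D →
      LaplaceBound E s N D X 0 0 1 ∧ LaplaceBound E s N D X (1 / 2) 1 √X ∧
      LaplaceBound E s N D X 1 2 X ∧ LaplaceBound E s N D X (-(1 / 2)) 0 (N / √X) ∧
      LaplaceBound E s N D X 0 1 (N / √X * √X) ∧
      (X ≤ 4 * D → LaplaceBound E s N D X 0 0 (N * (D / X)) ∧
        LaplaceBound E s N D X (1 / 2) 1 (N * (D / X) * √X)) := by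
  obtain ⟨E₁, hE₁, h₁⟩ := exists_laplaceBound (σ := 0) (p := 0) hs (by norm_num) (by norm_num)
    (by norm_num)
  obtain ⟨E₂, hE₂, h₂⟩ := exists_laplaceBound (σ := 1 / 2) (p := 1 / 2) hs (by norm_num)
    (by norm_num) (by norm_num)
  obtain ⟨E₃, hE₃, h₃⟩ := exists_laplaceBound (σ := 1) (p := 1) hs (by norm_num) (by norm_num)
    (by norm_num)
  obtain ⟨E₄, hE₄, h₄⟩ := exists_laplaceBound (σ := -(1 / 2)) (p := 1 / 2) hs (by norm_num)
    (by norm_num) (by norm_num)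
  obtain ⟨E₅, hE₅, h₅⟩ := exists_laplaceBound (σ := 0) (p := 1) hs (by norm_num) (by norm_num)
    (by norm_num)
  obtain ⟨E₆, hE₆, h₆⟩ := exists_laplaceBound_of_le (σ := 0) (p := 0) hs (by norm_num)
    (by norm_num)
  obtain ⟨E₇, hE₇, h₇⟩ := exists_laplaceBound_of_le (σ := 1 / 2) (p := 1 / 2) hs (by norm_num)
    (by norm_num)
  refine ⟨E₁ + E₂ + E₃ + E₄ + E₅ + E₆ + E₇, by positivity, fun N X D hN hX hD => ?_⟩
  have hN0 : 0 ≤ N := by rcases hN with h | h <;> linarith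
  have hNs : 0 < N + s := by linarith
  have hsq := Real.sqrt_pos.2 hX
  refine ⟨?_, ?_, ?_, ?_, ?_, fun hXD => ⟨?_, ?_⟩⟩
  · exact (h₁ N X D hN0 (by linarith) hX hD).of_le hNs hX.le hD.le (by linarith) (by norm_num)
      (by norm_num)
  · exact (h₂ N X D hN0 (by linarith) hX hD).of_le hNs hX.le hD.le (by linarith) (by norm_num)
      (by rw [sub_self, Real.rpow_zero, one_mul, Real.sqrt_eq_rpow])
  · exact (h₃ N X D hN0 (by linarith) hX hD).of_le hNs hX.le hD.le (by linarith) (by norm_num)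
      (by rw [sub_self, Real.rpow_zero, one_mul, Real.rpow_one])
  -- For σ = -1/2 the general bound needs N ≥ 1/2. At N = 0 the weight N/√X vanishes and there is
  -- nothing to prove.
  · rcases hN with rfl | hN
    · intro τ hτ
      simp only [zero_div, zero_mul]
      positivity
    · exact (h₄ N X D hN0 (by linarith) hX hD).of_le hNs hX.le hD.le (by linarith) (by norm_num)
        (by
          rw [Real.rpow_neg hX.le, ← Real.sqrt_eq_rpow, ← div_eq_mul_inv,
            show (1 / 2 - -(1 / 2) : ℝ) = 1 by norm_num, Real.rpow_one]
          gcongr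
          linarith)
  · exact (h₅ N X D hN0 (by linarith) hX hD).of_le hNs hX.le hD.le (by linarith) (by norm_num)
      (by
        rw [div_mul_cancel₀ _ hsq.ne', sub_zero, Real.rpow_one, Real.rpow_zero]
        linarith)
  · exact (h₆ N X D hN hX hXD).of_le hNs hX.le hD.le (by linarith) (by norm_num)
      (by norm_num)
  · exact (h₇ N X D hN hX hXD).of_le hNs hX.le hD.le (by linarith) (by norm_num)
      (by rw [sub_self, Real.rpow_zero, one_mul, Real.sqrt_eq_rpow])

/-- The normalized integral of `(1 - u)^η (1 - v)^η' (D + X(1 - u) + Y(1 - v))^{-e}`. -/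
def jacobiMoment (s s' N M X Y D e η η' : ℝ) : ℝ :=
  (X ^ N / (2 ^ N * Real.Gamma (N + s))) * (Y ^ M / (2 ^ M * Real.Gamma (M + s'))) *
    (Real.Gamma e * ∫ p, (1 - p.1) ^ η * (1 - p.2) ^ η' *
      (D + X * (1 - p.1) + Y * (1 - p.2)) ^ (-e) ∂ultraProd (N + s) (M + s'))

theorem exists_jacobiMoment_le {s s' δ : ℝ} (hs : 0 < s) (hs' : 0 < s') (hδ : 0 < δ) :
    ∃ C, 0 < C ∧ ∀ {E N M D X Y σ σ' η η' W W' e}, 0 ≤ E → 0 ≤ N → 0 ≤ M → 0 < D →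
      0 < X → 0 < Y → 0 ≤ η → 0 ≤ η' → 0 ≤ W → 0 ≤ W' → 0 < e →
      e = N + M + s + s' + σ + σ' + δ →
      LaplaceBound E s N D X σ η W → LaplaceBound E s' M D Y σ' η' W' →
      (X + D) ^ s * (Y + D) ^ s' * (W * W' * jacobiMoment s s' N M X Y D e η η') ≤
        E ^ 2 * C * D ^ (-δ) := by
  obtain ⟨C, hC, h⟩ := exists_weighted_integral_le hs hs' hδ
  refine ⟨C, hC, fun {E N M D X Y σ σ' η η' W W' e} hE hN hM hD hX hY hη hη' hW hW' he hee hB hB' => ?_⟩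
  subst hee
  refine le_trans (le_of_eq ?_) ((h E E N M D X Y σ σ' η η' W W' hE hN hM hD hX hY hη hη' hW hW' he
    hB hB').trans_eq (by ring))
  rw [jacobiMoment]
  ring

/-- The exponent e is fixed, so weights of order σ and σ' force δ = 1 - σ - σ'. A factor √X (1 - u)
or √Y (1 - v) has order 1/2 and lowers δ by 1/2, which is what the factor √D achieves in the first
term. -/
theorem exists_first_moment_le {s s' σ σ' : ℝ} (hs : 0 < s) (hs' : 0 < s')
    (hσ : σ + σ' < 1 / 2) :
    ∃ C, 0 < C ∧ ∀ {E N M D X Y ω ω'}, 0 ≤ E → 0 ≤ N → 0 ≤ M → 0 < D →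
      0 < X → 0 < Y → 0 ≤ ω → 0 ≤ ω' →
      LaplaceBound E s N D X σ 0 ω → LaplaceBound E s N D X (σ + 1 / 2) 1 (ω * √X) →
      LaplaceBound E s' M D Y σ' 0 ω' → LaplaceBound E s' M D Y (σ' + 1 / 2) 1 (ω' * √Y) →
      (X + D) ^ s * (Y + D) ^ s' * (ω * ω' *
        (√D * jacobiMoment s s' N M X Y D (N + M + s + s' + 1) 0 0 +
          √X * jacobiMoment s s' N M X Y D (N + M + s + s' + 1) 1 0 +
          √Y * jacobiMoment s s' N M X Y D (N + M + s + s' + 1) 0 1)) ≤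
        E ^ 2 * C * D ^ (-(1 / 2 - σ - σ')) := by
  obtain ⟨C₁, hC₁, h₁⟩ := exists_jacobiMoment_le (δ := 1 - σ - σ') hs hs' (by linarith)
  obtain ⟨C₂, hC₂, h₂⟩ := exists_jacobiMoment_le (δ := 1 / 2 - σ - σ') hs hs' (by linarith)
  refine ⟨C₁ + C₂ + C₂, by positivity,
    fun {E N M D X Y ω ω'} hE hN hM hD hX hY hω hω' hA hB hA' hB' => ?_⟩
  have he : 0 < N + M + s + s' + 1 := by linarith
  have k₁ := h₁ hE hN hM hD hX hY le_rfl le_rfl hω hω' he (by ring) hA hA'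
  have k₂ := h₂ hE hN hM hD hX hY zero_le_one le_rfl (by positivity) hω' he (by ring) hB hA'
  have k₃ := h₂ hE hN hM hD hX hY le_rfl zero_le_one hω (by positivity) he (by ring) hA hB'
  have k₁' := mul_le_mul_of_nonneg_left k₁ (Real.sqrt_nonneg D)
  have e1 : √D * D ^ (-(1 - σ - σ')) = D ^ (-(1 / 2 - σ - σ')) := by
    rw [Real.sqrt_eq_rpow, ← Real.rpow_add hD]; ring_nf
  rw [show √D * (E ^ 2 * C₁ * D ^ (-(1 - σ - σ'))) =
    E ^ 2 * C₁ * (√D * D ^ (-(1 - σ - σ'))) by ring, e1] at k₁'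
  calc _ = √D * ((X + D) ^ s * (Y + D) ^ s' *
          (ω * ω' * jacobiMoment s s' N M X Y D (N + M + s + s' + 1) 0 0)) +
        (X + D) ^ s * (Y + D) ^ s' *
          (ω * √X * ω' * jacobiMoment s s' N M X Y D (N + M + s + s' + 1) 1 0) +
        (X + D) ^ s * (Y + D) ^ s' *
          (ω * (ω' * √Y) * jacobiMoment s s' N M X Y D (N + M + s + s' + 1) 0 1) := by ring
    _ ≤ _ := by linarith

/-- All terms scale like D^(-1): raising the exponent to e + 1 costs one power of D, which is
recovered from D itself or from X(1 - u)² and Y(1 - v)², both of order 1. -/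
theorem exists_second_moment_le {s s' : ℝ} (hs : 0 < s) (hs' : 0 < s') :
    ∃ C, 0 < C ∧ ∀ {E N M D X Y}, 0 ≤ E → 0 ≤ N → 0 ≤ M → 0 < D → 0 < X → 0 < Y →
      LaplaceBound E s N D X 0 0 1 → LaplaceBound E s N D X 1 2 X →
      LaplaceBound E s' M D Y 0 0 1 → LaplaceBound E s' M D Y 1 2 Y →
      (X + D) ^ s * (Y + D) ^ s' *
        (jacobiMoment s s' N M X Y D (N + M + s + s' + 1) 0 0 +
          (D * jacobiMoment s s' N M X Y D (N + M + s + s' + 2) 0 0 +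
          X * jacobiMoment s s' N M X Y D (N + M + s + s' + 2) 2 0 +
          Y * jacobiMoment s s' N M X Y D (N + M + s + s' + 2) 0 2)) ≤
        E ^ 2 * C * D⁻¹ := by
  obtain ⟨C₁, hC₁, h₁⟩ := exists_jacobiMoment_le (δ := 1) hs hs' (by linarith)
  obtain ⟨C₂, hC₂, h₂⟩ := exists_jacobiMoment_le (δ := 2) hs hs' (by linarith)
  refine ⟨C₁ + C₂ + C₁ + C₁, by positivity,
    fun {E N M D X Y} hE hN hM hD hX hY hA hB hA' hB' => ?_⟩
  have he : 0 < N + M + s + s' + 1 := by linarith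
  have he' : 0 < N + M + s + s' + 2 := by linarith
  have k₁ := h₁ hE hN hM hD hX hY le_rfl le_rfl zero_le_one zero_le_one he (by ring) hA hA'
  have k₂ := h₂ hE hN hM hD hX hY le_rfl le_rfl zero_le_one zero_le_one he' (by ring) hA hA'
  have k₃ := h₁ hE hN hM hD hX hY zero_le_two le_rfl hX.le zero_le_one he' (by ring) hB hA'
  have k₄ := h₁ hE hN hM hD hX hY le_rfl zero_le_two zero_le_one hY.le he' (by ring) hA hB'
  have k₂' := mul_le_mul_of_nonneg_left k₂ hD.le
  have e1 : D * D ^ (-2 : ℝ) = D⁻¹ := by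
    rw [← Real.rpow_one_add' hD.le (by norm_num), ← Real.rpow_neg_one]; norm_num
  rw [Real.rpow_neg_one] at k₁ k₃ k₄
  rw [show D * (E ^ 2 * C₂ * D ^ (-2 : ℝ)) = E ^ 2 * C₂ * (D * D ^ (-2 : ℝ)) by ring, e1] at k₂'
  calc _ = (X + D) ^ s * (Y + D) ^ s' *
          (1 * 1 * jacobiMoment s s' N M X Y D (N + M + s + s' + 1) 0 0) +
        D * ((X + D) ^ s * (Y + D) ^ s' *
          (1 * 1 * jacobiMoment s s' N M X Y D (N + M + s + s' + 2) 0 0)) +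
        (X + D) ^ s * (Y + D) ^ s' *
          (X * 1 * jacobiMoment s s' N M X Y D (N + M + s + s' + 2) 2 0) +
        (X + D) ^ s * (Y + D) ^ s' *
          (1 * Y * jacobiMoment s s' N M X Y D (N + M + s + s' + 2) 0 2) := by ring
    _ ≤ _ := by linarith

end


/-! ### Majorants for the kernel and its derivatives. -/

noncomputable section

theorem jacobiMoment_nonneg {s s' N M X Y D e η η' : ℝ} (hs : 0 < N + s) (hs' : 0 < M + s')
    (hX : 0 ≤ X) (hY : 0 ≤ Y) (hD : 0 ≤ D) (he : 0 < e) :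
    0 ≤ jacobiMoment s s' N M X Y D e η η' := by
  have := Real.Gamma_pos_of_pos hs
  have := Real.Gamma_pos_of_pos hs'
  have := Real.Gamma_pos_of_pos he
  refine mul_nonneg (by positivity) (mul_nonneg (by positivity)
    (integral_nonneg_of_ae ((ae_ultraMeasure_prod_mem _ _).mono fun p hp => ?_)))
  have h1 : 0 < 1 - p.1 := by linarith [hp.1.2]
  have h2 : 0 < 1 - p.2 := by linarith [hp.2.2]
  simp only [Pi.zero_apply]
  positivity

/-- The majorant of the normalized integral of the first derivative of the kernel. -/
def firstMajorant (s s' N M X Y D : ℝ) : ℝ :=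
  √D * jacobiMoment s s' N M X Y D (N + M + s + s' + 1) 0 0 +
    √X * jacobiMoment s s' N M X Y D (N + M + s + s' + 1) 1 0 +
    √Y * jacobiMoment s s' N M X Y D (N + M + s + s' + 1) 0 1

/-- The majorant of the normalized integral of the second derivatives of the kernel. -/
def secondMajorant (s s' N M X Y D : ℝ) : ℝ :=
  jacobiMoment s s' N M X Y D (N + M + s + s' + 1) 0 0 +
    (D * jacobiMoment s s' N M X Y D (N + M + s + s' + 2) 0 0 +
      X * jacobiMoment s s' N M X Y D (N + M + s + s' + 2) 2 0 +
      Y * jacobiMoment s s' N M X Y D (N + M + s + s' + 2) 0 2)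

theorem firstMajorant_nonneg {s s' N M X Y D : ℝ} (hs : 0 < s) (hs' : 0 < s') (hN : 0 ≤ N)
    (hM : 0 ≤ M) (hX : 0 ≤ X) (hY : 0 ≤ Y) (hD : 0 ≤ D) : 0 ≤ firstMajorant s s' N M X Y D := by
  have h : ∀ η η', 0 ≤ jacobiMoment s s' N M X Y D (N + M + s + s' + 1) η η' := fun η η' =>
    jacobiMoment_nonneg (by linarith) (by linarith) hX hY hD (by linarith)
  have := h 0 0
  have := h 1 0
  have := h 0 1
  unfold firstMajorant
  positivity

/-- S and T stand for the sine and cosine of half of either angle. The middle estimate is for the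
logarithmic derivative of u_j: either 1/S is at most 2/√X, and the weight N/√X costs D^(-1/2), or X
≤ 4D, and the weight N D/X costs nothing while 1/d is explicit. -/
theorem exists_majorant_le {s s' : ℝ} (hs : 0 < s) (hs' : 0 < s') :
    ∃ C, 0 < C ∧ ∀ {N M X Y D d S T : ℝ}, (N = 0 ∨ 1 ≤ N) → (M = 0 ∨ 1 ≤ M) → 0 < X → 0 < Y →
      0 < D → 0 < d → d ^ 2 ≤ 20 * D →
      (1 / S ≤ 2 / √X ∨ (X ≤ 4 * D ∧ 1 / S ≤ 14 / d * (D / X))) →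
      (1 / T ≤ 2 / √Y ∨ (Y ≤ 4 * D ∧ 1 / T ≤ 14 / d * (D / Y))) →
      (X + D) ^ s * (Y + D) ^ s' * firstMajorant s s' N M X Y D ≤ C / d ∧
      (X + D) ^ s * (Y + D) ^ s' * ((N * (1 / S) + M * (1 / T)) * firstMajorant s s' N M X Y D) ≤
        C / d ^ 2 ∧
      (X + D) ^ s * (Y + D) ^ s' * secondMajorant s s' N M X Y D ≤ C / d ^ 2 := by
  obtain ⟨E₁, hE₁, hLX⟩ := exists_laplaceBounds hs
  obtain ⟨E₂, hE₂, hLY⟩ := exists_laplaceBounds hs'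
  obtain ⟨C₁, hC₁, h₁⟩ := exists_first_moment_le (σ := 0) (σ' := 0) hs hs' (by norm_num)
  obtain ⟨C₂, hC₂, h₂⟩ := exists_first_moment_le (σ := -(1 / 2)) (σ' := 0) hs hs' (by norm_num)
  obtain ⟨C₃, hC₃, h₃⟩ := exists_first_moment_le (σ := 0) (σ' := -(1 / 2)) hs hs' (by norm_num)
  obtain ⟨C₄, hC₄, h₄⟩ := exists_second_moment_le hs hs'
  set E := E₁ + E₂ with hE
  have hE0 : 0 < E := by positivity
  refine ⟨E ^ 2 * (5 * C₁ + (40 * C₂ + 70 * C₁) + (40 * C₃ + 70 * C₁) + 20 * C₄), by positivity,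
    fun {N M X Y D d S T} hN hM hX hY hD hd hdD hS hT => ?_⟩
  have hN0 : 0 ≤ N := by rcases hN with h | h <;> linarith
  have hM0 : 0 ≤ M := by rcases hM with h | h <;> linarith
  have hF := firstMajorant_nonneg hs hs' hN0 hM0 hX.le hY.le hD.le
  have hsX := Real.sqrt_pos.2 hX
  have hsY := Real.sqrt_pos.2 hY
  have hsD := Real.sqrt_pos.2 hD
  have incX : ∀ {σ η W}, LaplaceBound E₁ s N D X σ η W → LaplaceBound E s N D X σ η W :=
    fun h => h.of_le (by linarith) hX.le hD.le (by linarith) rfl le_rfl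
  have incY : ∀ {σ η W}, LaplaceBound E₂ s' M D Y σ η W → LaplaceBound E s' M D Y σ η W :=
    fun h => h.of_le (by linarith) hY.le hD.le (by linarith) rfl le_rfl
  obtain ⟨x₁, x₂, x₃, x₄, x₅, x₆⟩ := hLX N X D hN hX hD
  obtain ⟨y₁, y₂, y₃, y₄, y₅, y₆⟩ := hLY M Y D hM hY hD
  have hx₂ : LaplaceBound E s N D X (0 + 1 / 2) 1 (1 * √X) := by
    rw [zero_add, one_mul]; exact incX x₂
  have hy₂ : LaplaceBound E s' M D Y (0 + 1 / 2) 1 (1 * √Y) := by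
    rw [zero_add, one_mul]; exact incY y₂
  have hx₅ : LaplaceBound E s N D X (-(1 / 2) + 1 / 2) 1 (N / √X * √X) := by
    rw [neg_add_cancel]; exact incX x₅
  have hy₅ : LaplaceBound E s' M D Y (-(1 / 2) + 1 / 2) 1 (M / √Y * √Y) := by
    rw [neg_add_cancel]; exact incY y₅
  have hdD' : d ≤ 5 * √D := by
    refine abs_le_of_sq_le_sq' ?_ (by positivity) |>.2
    rw [mul_pow, Real.sq_sqrt hD.le]; linarith
  have hinv : D⁻¹ ≤ 20 / d ^ 2 := by
    rw [inv_eq_one_div, div_le_div_iff₀ hD (by positivity)]; linarith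
  have hinv2 : D ^ (-(1 / 2 : ℝ)) ≤ 5 / d := by
    rw [Real.rpow_neg hD.le, ← Real.sqrt_eq_rpow, inv_eq_one_div, div_le_div_iff₀ hsD hd]
    linarith
  set w := (X + D) ^ s * (Y + D) ^ s' with hw
  have hw0 : 0 < w := by positivity
  have k₁ := h₁ hE0.le hN0 hM0 hD hX hY zero_le_one zero_le_one (incX x₁) hx₂ (incY y₁) hy₂
  rw [← firstMajorant, mul_one, one_mul, sub_zero, sub_zero, ← hw] at k₁
  have k₂ := h₂ hE0.le hN0 hM0 hD hX hY (by positivity) zero_le_one (incX x₄) hx₅ (incY y₁) hy₂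
  rw [← firstMajorant, mul_one, ← hw, show -(1 / 2 - -(1 / 2) - 0 : ℝ) = -1 by norm_num,
    Real.rpow_neg_one] at k₂
  have k₃ := h₃ hE0.le hN0 hM0 hD hX hY zero_le_one (by positivity) (incX x₁) hx₂ (incY y₄) hy₅
  rw [← firstMajorant, one_mul, ← hw, show -(1 / 2 - 0 - -(1 / 2) : ℝ) = -1 by norm_num,
    Real.rpow_neg_one] at k₃
  have k₄ := h₄ hE0.le hN0 hM0 hD hX hY (incX x₁) (incX x₃) (incY y₁) (incY y₃)
  rw [← secondMajorant, ← hw] at k₄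
  have hNS : w * (N * (1 / S) * firstMajorant s s' N M X Y D) ≤
      E ^ 2 * (40 * C₂ + 70 * C₁) / d ^ 2 := by
    rcases hS with hS | ⟨hXD, hS⟩
    · calc _ ≤ w * (N * (2 / √X) * firstMajorant s s' N M X Y D) := by gcongr
        _ = 2 * (w * (N / √X * firstMajorant s s' N M X Y D)) := by ring
        _ ≤ 2 * (E ^ 2 * C₂ * (20 / d ^ 2)) := mul_le_mul_of_nonneg_left
            (k₂.trans (mul_le_mul_of_nonneg_left hinv (by positivity))) (by positivity)
        _ = E ^ 2 * (40 * C₂) / d ^ 2 := by ring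
        _ ≤ _ := div_le_div_of_nonneg_right (mul_le_mul_of_nonneg_left (by linarith)
          (by positivity)) (by positivity)
    · obtain ⟨x₆, x₇⟩ := x₆ hXD
      have hx₇ : LaplaceBound E s N D X (0 + 1 / 2) 1 (N * (D / X) * √X) := by
        rw [zero_add]; exact incX x₇
      have k₅ := h₁ hE0.le hN0 hM0 hD hX hY (by positivity) zero_le_one (incX x₆) hx₇ (incY y₁) hy₂
      rw [← firstMajorant, mul_one, sub_zero, sub_zero, ← hw] at k₅
      calc _ ≤ w * (N * (14 / d * (D / X)) * firstMajorant s s' N M X Y D) := by gcongr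
        _ = 14 / d * (w * (N * (D / X) * firstMajorant s s' N M X Y D)) := by ring
        _ ≤ 14 / d * (E ^ 2 * C₁ * (5 / d)) := mul_le_mul_of_nonneg_left
            (k₅.trans (mul_le_mul_of_nonneg_left hinv2 (by positivity))) (by positivity)
        _ = E ^ 2 * (70 * C₁) / d ^ 2 := by field_simp; ring
        _ ≤ _ := div_le_div_of_nonneg_right (mul_le_mul_of_nonneg_left (by linarith)
          (by positivity)) (by positivity)
  have hMT : w * (M * (1 / T) * firstMajorant s s' N M X Y D) ≤
      E ^ 2 * (40 * C₃ + 70 * C₁) / d ^ 2 := by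
    rcases hT with hT | ⟨hYD, hT⟩
    · calc _ ≤ w * (M * (2 / √Y) * firstMajorant s s' N M X Y D) := by gcongr
        _ = 2 * (w * (M / √Y * firstMajorant s s' N M X Y D)) := by ring
        _ ≤ 2 * (E ^ 2 * C₃ * (20 / d ^ 2)) := mul_le_mul_of_nonneg_left
            (k₃.trans (mul_le_mul_of_nonneg_left hinv (by positivity))) (by positivity)
        _ = E ^ 2 * (40 * C₃) / d ^ 2 := by ring
        _ ≤ _ := div_le_div_of_nonneg_right (mul_le_mul_of_nonneg_left (by linarith)
          (by positivity)) (by positivity)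
    · obtain ⟨y₆, y₇⟩ := y₆ hYD
      have hy₇ : LaplaceBound E s' M D Y (0 + 1 / 2) 1 (M * (D / Y) * √Y) := by
        rw [zero_add]; exact incY y₇
      have k₅ := h₁ hE0.le hN0 hM0 hD hX hY zero_le_one (by positivity) (incX x₁) hx₂ (incY y₆) hy₇
      rw [← firstMajorant, one_mul, sub_zero, sub_zero, ← hw] at k₅
      calc _ ≤ w * (M * (14 / d * (D / Y)) * firstMajorant s s' N M X Y D) := by gcongr
        _ = 14 / d * (w * (M * (D / Y) * firstMajorant s s' N M X Y D)) := by ring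
        _ ≤ 14 / d * (E ^ 2 * C₁ * (5 / d)) := mul_le_mul_of_nonneg_left
            (k₅.trans (mul_le_mul_of_nonneg_left hinv2 (by positivity))) (by positivity)
        _ = E ^ 2 * (70 * C₁) / d ^ 2 := by field_simp; ring
        _ ≤ _ := div_le_div_of_nonneg_right (mul_le_mul_of_nonneg_left (by linarith)
          (by positivity)) (by positivity)
  refine ⟨?_, ?_, ?_⟩
  · calc _ ≤ E ^ 2 * C₁ * (5 / d) := k₁.trans (mul_le_mul_of_nonneg_left hinv2 (by positivity))
      _ = E ^ 2 * (5 * C₁) / d := by ring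
      _ ≤ _ := div_le_div_of_nonneg_right (mul_le_mul_of_nonneg_left (by linarith)
          (by positivity)) (by positivity)
  · calc _ = w * (N * (1 / S) * firstMajorant s s' N M X Y D) +
          w * (M * (1 / T) * firstMajorant s s' N M X Y D) := by ring
      _ ≤ E ^ 2 * (40 * C₂ + 70 * C₁) / d ^ 2 + E ^ 2 * (40 * C₃ + 70 * C₁) / d ^ 2 :=
        add_le_add hNS hMT
      _ = E ^ 2 * ((40 * C₂ + 70 * C₁) + (40 * C₃ + 70 * C₁)) / d ^ 2 := by ring
      _ ≤ _ := div_le_div_of_nonneg_right (mul_le_mul_of_nonneg_left (by linarith)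
          (by positivity)) (by positivity)
  · calc _ ≤ E ^ 2 * C₄ * (20 / d ^ 2) := k₄.trans (mul_le_mul_of_nonneg_left hinv (by positivity))
      _ = E ^ 2 * (20 * C₄) / d ^ 2 := by ring
      _ ≤ _ := div_le_div_of_nonneg_right (mul_le_mul_of_nonneg_left (by linarith)
          (by positivity)) (by positivity)

theorem integrable_jacobiMoment {s s' D X Y e η η' : ℝ} (hs : 0 < s) (hs' : 0 < s') (hD : 0 < D)
    (hX : 0 ≤ X) (hY : 0 ≤ Y) (he : 0 ≤ e) (hη : 0 ≤ η) (hη' : 0 ≤ η') :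
    Integrable (fun p : ℝ × ℝ => (1 - p.1) ^ η * (1 - p.2) ^ η' *
      (D + X * (1 - p.1) + Y * (1 - p.2)) ^ (-e)) (ultraProd s s') := by
  refine integrable_ultraMeasure_prod_of_bound hs hs' (by fun_prop)
    (C := 2 ^ η * 2 ^ η' * D ^ (-e)) fun u hu v hv => ?_
  have h1 : 0 < 1 - u := by linarith [hu.2]
  have h2 : 0 < 1 - v := by linarith [hv.2]
  have h3 : (D + X * (1 - u) + Y * (1 - v)) ^ (-e) ≤ D ^ (-e) :=
    Real.rpow_le_rpow_of_nonpos hD (by nlinarith) (by linarith)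
  simp only
  rw [abs_of_nonneg (by positivity)]
  gcongr
  · linarith [hu.1]
  · linarith [hv.1]

theorem abs_integral_le_firstMajorant {s s' N M X Y D K : ℝ} (hs : 0 < s) (hs' : 0 < s')
    (hN : 0 ≤ N) (hM : 0 ≤ M) (hX : 0 < X) (hY : 0 < Y) (hD : 0 < D) {f : ℝ × ℝ → ℝ}
    (hf : ∀ p ∈ Icc (-1 : ℝ) 1 ×ˢ Icc (-1 : ℝ) 1,
      |f p| ≤ K * (√D + √X * (1 - p.1) + √Y * (1 - p.2))) :
    (X ^ N / (2 ^ N * Real.Gamma (N + s))) * (Y ^ M / (2 ^ M * Real.Gamma (M + s'))) *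
      Real.Gamma (N + M + s + s' + 1) *
      |∫ p, f p * (D + X * (1 - p.1) + Y * (1 - p.2)) ^ (-(N + M + s + s' + 1))
        ∂ultraProd (N + s) (M + s')| ≤ K * firstMajorant s s' N M X Y D := by
  have hNs : 0 < N + s := by linarith
  have hMs : 0 < M + s' := by linarith
  set e := N + M + s + s' + 1 with he
  have he0 : 0 < e := by linarith
  have hGN := Real.Gamma_pos_of_pos hNs
  have hGM := Real.Gamma_pos_of_pos hMs
  have hGe := Real.Gamma_pos_of_pos he0
  have i₁ := integrable_jacobiMoment (η := 0) (η' := 0) hNs hMs hD hX.le hY.le he0.le le_rfl le_rfl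
  have i₂ := integrable_jacobiMoment (η := 1) (η' := 0) hNs hMs hD hX.le hY.le he0.le zero_le_one
    le_rfl
  have i₃ := integrable_jacobiMoment (η := 0) (η' := 1) hNs hMs hD hX.le hY.le he0.le le_rfl
    zero_le_one
  have h := norm_integral_le_of_norm_le
    ((((i₁.const_mul √D).add (i₂.const_mul √X)).add (i₃.const_mul √Y)).const_mul K)
    (f := fun p => f p * (D + X * (1 - p.1) + Y * (1 - p.2)) ^ (-e)) ?_
  · rw [integral_const_mul, integral_add' ((i₁.const_mul √D).add (i₂.const_mul √X))
      (i₃.const_mul √Y), integral_add' (i₁.const_mul √D) (i₂.const_mul √X), integral_const_mul,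
      integral_const_mul, integral_const_mul, Real.norm_eq_abs] at h
    refine (mul_le_mul_of_nonneg_left h (by positivity)).trans_eq ?_
    rw [firstMajorant, jacobiMoment, jacobiMoment, jacobiMoment, ← he]
    ring
  · filter_upwards [ae_ultraProd_mem (N + s) (M + s')] with p hp
    have h1 : 0 ≤ 1 - p.1 := by linarith [hp.1.2]
    have h2 : 0 ≤ 1 - p.2 := by linarith [hp.2.2]
    have h3 : 0 < D + X * (1 - p.1) + Y * (1 - p.2) := by positivity
    rw [Real.norm_eq_abs, abs_mul, abs_of_pos (Real.rpow_pos_of_pos h3 _)]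
    refine (mul_le_mul_of_nonneg_right (hf p hp) (by positivity)).trans_eq ?_
    simp only [Pi.add_apply, Real.rpow_zero, Real.rpow_one]
    ring

theorem abs_integral_le_secondMajorant {s s' N M X Y D K : ℝ} (hs : 0 < s) (hs' : 0 < s')
    (hN : 0 ≤ N) (hM : 0 ≤ M) (hX : 0 < X) (hY : 0 < Y) (hD : 0 < D) (hK : 1 ≤ K)
    {f g h : ℝ × ℝ → ℝ}
    (hf : ∀ p ∈ Icc (-1 : ℝ) 1 ×ˢ Icc (-1 : ℝ) 1,
      |f p| ≤ K * (√D + √X * (1 - p.1) + √Y * (1 - p.2)))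
    (hg : ∀ p ∈ Icc (-1 : ℝ) 1 ×ˢ Icc (-1 : ℝ) 1,
      |g p| ≤ K * (√D + √X * (1 - p.1) + √Y * (1 - p.2)))
    (hh : ∀ p ∈ Icc (-1 : ℝ) 1 ×ˢ Icc (-1 : ℝ) 1, |h p| ≤ 1) :
    (X ^ N / (2 ^ N * Real.Gamma (N + s))) * (Y ^ M / (2 ^ M * Real.Gamma (M + s'))) *
      Real.Gamma (N + M + s + s' + 1) *
      |∫ p, (h p * (D + X * (1 - p.1) + Y * (1 - p.2)) ^ (-(N + M + s + s' + 1)) -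
        (N + M + s + s' + 1) * (f p * g p *
          (D + X * (1 - p.1) + Y * (1 - p.2)) ^ (-(N + M + s + s' + 1) - 1)))
        ∂ultraProd (N + s) (M + s')| ≤ 3 * K ^ 2 * secondMajorant s s' N M X Y D := by
  have hNs : 0 < N + s := by linarith
  have hMs : 0 < M + s' := by linarith
  have hm := jacobiMoment_nonneg (η := 0) (η' := 0) hNs hMs hX.le hY.le hD.le
    (by linarith : 0 < N + M + s + s' + 1)
  set e := N + M + s + s' + 1 with he
  have he0 : 0 < e := by linarith
  have he1 : N + M + s + s' + 2 = e + 1 := by rw [he]; ring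
  have hGN := Real.Gamma_pos_of_pos hNs
  have hGM := Real.Gamma_pos_of_pos hMs
  have hGe := Real.Gamma_pos_of_pos he0
  have i₀ := integrable_jacobiMoment (η := 0) (η' := 0) hNs hMs hD hX.le hY.le he0.le le_rfl le_rfl
  have i₁ := integrable_jacobiMoment (e := e + 1) (η := 0) (η' := 0) hNs hMs hD hX.le hY.le
    (by linarith) le_rfl le_rfl
  have i₂ := integrable_jacobiMoment (e := e + 1) (η := 2) (η' := 0) hNs hMs hD hX.le hY.le
    (by linarith) zero_le_two le_rfl
  have i₃ := integrable_jacobiMoment (e := e + 1) (η := 0) (η' := 2) hNs hMs hD hX.le hY.le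
    (by linarith) le_rfl zero_le_two
  have hmain := norm_integral_le_of_norm_le
    (i₀.add ((((i₁.const_mul D).add (i₂.const_mul X)).add (i₃.const_mul Y)).const_mul
      (e * (3 * K ^ 2))))
    (f := fun p => h p * (D + X * (1 - p.1) + Y * (1 - p.2)) ^ (-e) -
      e * (f p * g p * (D + X * (1 - p.1) + Y * (1 - p.2)) ^ (-e - 1))) ?_
  · rw [integral_add' i₀ ((((i₁.const_mul D).add (i₂.const_mul X)).add
      (i₃.const_mul Y)).const_mul _), integral_const_mul,
      integral_add' ((i₁.const_mul D).add (i₂.const_mul X))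
      (i₃.const_mul Y), integral_add' (i₁.const_mul D) (i₂.const_mul X), integral_const_mul,
      integral_const_mul, integral_const_mul, Real.norm_eq_abs] at hmain
    -- The term with the second derivative of the form has coefficient 1; it is enlarged to 3K² so
    -- that one constant factors out.
    have h3 : jacobiMoment s s' N M X Y D e 0 0 ≤
        3 * K ^ 2 * jacobiMoment s s' N M X Y D e 0 0 := le_mul_of_one_le_left hm (by nlinarith)
    rw [secondMajorant, mul_add (3 * K ^ 2), ← he]
    refine le_trans ?_ (add_le_add_left h3 _)
    refine (mul_le_mul_of_nonneg_left hmain (by positivity)).trans_eq ?_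
    -- The factor e produced by differentiating the power, which grows with j, is absorbed by e Γ(e)
    -- = Γ(e + 1).
    rw [jacobiMoment, jacobiMoment, jacobiMoment, jacobiMoment, he1,
      Real.Gamma_add_one he0.ne']
    ring
  · filter_upwards [ae_ultraProd_mem (N + s) (M + s')] with p hp
    have h1 : 0 ≤ 1 - p.1 := by linarith [hp.1.2]
    have h2 : 0 ≤ 1 - p.2 := by linarith [hp.2.2]
    have h3 : 0 < D + X * (1 - p.1) + Y * (1 - p.2) := by positivity
    have h4 : |f p * g p| ≤ 3 * K ^ 2 * (D + X * (1 - p.1) ^ 2 + Y * (1 - p.2) ^ 2) := by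
      rw [abs_mul]
      refine (mul_le_mul (hf p hp) (hg p hp) (abs_nonneg _) (by positivity)).trans ?_
      have e1 := Real.sq_sqrt hD.le
      have e2 := Real.sq_sqrt hX.le
      have e3 := Real.sq_sqrt hY.le
      have e4 : (√D + √X * (1 - p.1) + √Y * (1 - p.2)) ^ 2 ≤
          3 * (√D ^ 2 + √X ^ 2 * (1 - p.1) ^ 2 + √Y ^ 2 * (1 - p.2) ^ 2) := by
        nlinarith [sq_nonneg (√D - √X * (1 - p.1)), sq_nonneg (√D - √Y * (1 - p.2)),
          sq_nonneg (√X * (1 - p.1) - √Y * (1 - p.2))]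
      rw [e1, e2, e3] at e4
      calc _ = K ^ 2 * (√D + √X * (1 - p.1) + √Y * (1 - p.2)) ^ 2 := by ring
        _ ≤ K ^ 2 * (3 * (D + X * (1 - p.1) ^ 2 + Y * (1 - p.2) ^ 2)) := by gcongr
        _ = _ := by ring
    rw [Real.norm_eq_abs, show -e - 1 = -(e + 1) by ring]
    refine (abs_sub _ _).trans ?_
    rw [abs_mul, abs_mul e, abs_mul (f p * g p), abs_of_pos he0,
      abs_of_pos (Real.rpow_pos_of_pos h3 _), abs_of_pos (Real.rpow_pos_of_pos h3 _)]
    refine (add_le_add (mul_le_mul_of_nonneg_right (hh p hp) (by positivity))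
      (mul_le_mul_of_nonneg_left (mul_le_mul_of_nonneg_right h4 (by positivity)) he0.le)).trans_eq
        ?_
    simp only [Pi.add_apply, Real.rpow_zero, Real.rpow_two]
    ring

end


/-! ### Trigonometric estimates. -/

noncomputable section

/-- From 1 - cos x ≥ (2/π²) x² at x = (θ - φ)/2 and π² < 10, one gets D ≥ d²/20. -/
theorem sq_le_mul_one_sub_cos_half {θ φ : ℝ} (hθ : θ ∈ Ioo 0 Real.pi) (hφ : φ ∈ Ioo 0 Real.pi) :
    |θ - φ| ^ 2 ≤ 20 * (1 - Real.cos ((θ - φ) / 2)) := by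
  have hπ := Real.pi_pos
  have hπ2 : Real.pi ^ 2 < 10 := by nlinarith [Real.pi_lt_d2]
  have h := Real.cos_le_one_sub_mul_cos_sq (x := (θ - φ) / 2)
    (abs_le.2 ⟨by linarith [hθ.1, hφ.2], by linarith [hθ.2, hφ.1]⟩)
  have h1 : 1 / 5 * ((θ - φ) / 2) ^ 2 ≤ 2 / Real.pi ^ 2 * ((θ - φ) / 2) ^ 2 := by
    refine mul_le_mul_of_nonneg_right ?_ (sq_nonneg _)
    rw [div_le_div_iff₀ (by norm_num) (by positivity)]
    linarith
  rw [sq_abs]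
  nlinarith

theorem le_sqrt_mul_add {S S' d : ℝ} (hS : 0 < S) (hS' : 0 < S') (hd : |S - S'| ≤ d / 2) :
    S' ≤ √(S * S') + d / 2 := by
  rcases le_total S' S with h | h
  · have : S' ≤ √(S * S') := by
      refine Real.le_sqrt_of_sq_le ?_
      nlinarith
    linarith [abs_nonneg (S - S')]
  · have : S ≤ √(S * S') := by
      refine Real.le_sqrt_of_sq_le ?_
      nlinarith
    linarith [(abs_le.1 hd).1]

/-- If S' ≤ 4S, then √(SS') ≤ 2S. Otherwise the distance dominates: S ≤ d/6 and S' ≤ 2d/3, so SS' ≤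
4D and dS' ≤ 14D, and 1/S = S'/(SS'). -/
theorem one_div_le_or {S S' d D : ℝ} (hS : 0 < S) (hS' : 0 < S') (hd0 : 0 < d)
    (hd : |S - S'| ≤ d / 2) (hdD : d ^ 2 ≤ 20 * D) :
    1 / S ≤ 2 / √(S * S') ∨ (S * S' ≤ 4 * D ∧ 1 / S ≤ 14 / d * (D / (S * S'))) := by
  rcases le_total S' (4 * S) with h | h
  · left
    have hX : 0 < S * S' := by positivity
    rw [div_le_div_iff₀ hS (Real.sqrt_pos.2 hX), one_mul, Real.sqrt_le_left (by positivity)]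
    nlinarith
  · right
    have h1 := (abs_le.1 hd).1
    have h2 : 3 * S' ≤ 2 * d := by linarith
    have h3 : 6 * S ≤ d := by linarith
    refine ⟨by nlinarith, ?_⟩
    rw [div_mul_div_comm, div_le_div_iff₀ hS (by positivity)]
    have : d * S' ≤ 14 * D := by nlinarith
    nlinarith

theorem abs_sin_half_sub_le (θ φ : ℝ) :
    |Real.sin (θ / 2) - Real.sin (φ / 2)| ≤ |θ - φ| / 2 := by
  refine (Real.abs_sin_sub_sin_le _ _).trans_eq ?_
  rw [← sub_div, abs_div, abs_two]

theorem abs_cos_half_sub_le (θ φ : ℝ) :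
    |Real.cos (θ / 2) - Real.cos (φ / 2)| ≤ |θ - φ| / 2 := by
  refine (Real.abs_cos_sub_cos_le _ _).trans_eq ?_
  rw [← sub_div, abs_div, abs_two]

theorem sin_half_pos {θ : ℝ} (hθ : θ ∈ Ioo 0 Real.pi) : 0 < Real.sin (θ / 2) :=
  Real.sin_pos_of_pos_of_lt_pi (by linarith [hθ.1]) (by linarith [hθ.2, hθ.1])

theorem cos_half_pos {θ : ℝ} (hθ : θ ∈ Ioo 0 Real.pi) : 0 < Real.cos (θ / 2) :=
  Real.cos_pos_of_mem_Ioo ⟨by linarith [hθ.2, hθ.1], by linarith [hθ.2]⟩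

theorem halfAngleForm_eq (θ φ : ℝ) (p : ℝ × ℝ) :
    halfAngleForm (θ, φ) p = (1 - Real.cos ((θ - φ) / 2)) +
      Real.sin (θ / 2) * Real.sin (φ / 2) * (1 - p.1) +
      Real.cos (θ / 2) * Real.cos (φ / 2) * (1 - p.2) := by
  rw [← sin_half_mul_add_cos_half_mul, halfAngleForm]
  ring

theorem abs_halfAngleFormFst_le {θ φ : ℝ} (hθ : θ ∈ Ioo 0 Real.pi) (hφ : φ ∈ Ioo 0 Real.pi)
    {p : ℝ × ℝ} (hp : p ∈ Icc (-1 : ℝ) 1 ×ˢ Icc (-1 : ℝ) 1) :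
    |halfAngleFormFst (θ, φ) p| ≤ 10 * (√(1 - Real.cos ((θ - φ) / 2)) +
      √(Real.sin (θ / 2) * Real.sin (φ / 2)) * (1 - p.1) +
      √(Real.cos (θ / 2) * Real.cos (φ / 2)) * (1 - p.2)) := by
  have hS := sin_half_pos hθ
  have hS' := sin_half_pos hφ
  have hC := cos_half_pos hθ
  have hC' := cos_half_pos hφ
  have h1 := le_sqrt_mul_add hS hS' (abs_sin_half_sub_le θ φ)
  have h2 := le_sqrt_mul_add hC hC' (abs_cos_half_sub_le θ φ)
  have hd : |θ - φ| ≤ 5 * √(1 - Real.cos ((θ - φ) / 2)) := by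
    refine (abs_le_of_sq_le_sq' ?_ (by positivity)).2
    rw [mul_pow, Real.sq_sqrt (by linarith [Real.cos_le_one ((θ - φ) / 2)])]
    linarith [sq_le_mul_one_sub_cos_half hθ hφ, Real.cos_le_one ((θ - φ) / 2)]
  have hz0 : 0 ≤ 1 - p.1 := by linarith [hp.1.2]
  have hz2 : 1 - p.1 ≤ 2 := by linarith [hp.1.1]
  have hw0 : 0 ≤ 1 - p.2 := by linarith [hp.2.2]
  have hw2 : 1 - p.2 ≤ 2 := by linarith [hp.2.1]
  -- Expanding about u = v = 1 isolates sin((θ - φ)/2), which is O(√D). In the other terms a single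
  -- sine or cosine is at most √X + d/2 or √Y + d/2.
  have e : halfAngleFormFst (θ, φ) p = (Real.sin ((θ - φ) / 2) +
      (1 - p.1) * (Real.cos (θ / 2) * Real.sin (φ / 2)) -
      (1 - p.2) * (Real.sin (θ / 2) * Real.cos (φ / 2))) / 2 := by
    rw [show (θ - φ) / 2 = θ / 2 - φ / 2 by ring, Real.sin_sub, halfAngleFormFst]
    ring
  have hsin : |Real.sin ((θ - φ) / 2)| ≤ |θ - φ| / 2 := by
    refine Real.abs_sin_le_abs.trans_eq ?_
    rw [abs_div, abs_two]
  have hd0 := abs_nonneg (θ - φ)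
  set d := |θ - φ|
  set X := Real.sin (θ / 2) * Real.sin (φ / 2)
  set Y := Real.cos (θ / 2) * Real.cos (φ / 2)
  have h3 : |(1 - p.1) * (Real.cos (θ / 2) * Real.sin (φ / 2))| ≤ √X * (1 - p.1) + d := by
    rw [abs_of_nonneg (by positivity)]
    calc (1 - p.1) * (Real.cos (θ / 2) * Real.sin (φ / 2))
        ≤ (1 - p.1) * (1 * (√X + d / 2)) := by
          gcongr
          exact Real.cos_le_one _
      _ ≤ _ := by nlinarith
  have h4 : |(1 - p.2) * (Real.sin (θ / 2) * Real.cos (φ / 2))| ≤ √Y * (1 - p.2) + d := by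
    rw [abs_of_nonneg (by positivity)]
    calc (1 - p.2) * (Real.sin (θ / 2) * Real.cos (φ / 2))
        ≤ (1 - p.2) * (1 * (√Y + d / 2)) := by
          gcongr
          exact Real.sin_le_one _
      _ ≤ _ := by nlinarith
  have h5 : 0 ≤ √X * (1 - p.1) := by positivity
  have h6 : 0 ≤ √Y * (1 - p.2) := by positivity
  rw [e, abs_div, abs_two, div_le_iff₀ two_pos]
  have h7 := abs_sub (Real.sin ((θ - φ) / 2) + (1 - p.1) * (Real.cos (θ / 2) * Real.sin (φ / 2)))
    ((1 - p.2) * (Real.sin (θ / 2) * Real.cos (φ / 2)))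
  have h8 := abs_add_le (Real.sin ((θ - φ) / 2)) ((1 - p.1) * (Real.cos (θ / 2) * Real.sin (φ / 2)))
  linarith

theorem halfAngleFormSnd_eq_swap (θ φ : ℝ) (p : ℝ × ℝ) :
    halfAngleFormSnd (θ, φ) p = halfAngleFormFst (φ, θ) p := by
  simp only [halfAngleFormSnd, halfAngleFormFst]
  ring

theorem abs_halfAngleFormSnd_le {θ φ : ℝ} (hθ : θ ∈ Ioo 0 Real.pi) (hφ : φ ∈ Ioo 0 Real.pi)
    {p : ℝ × ℝ} (hp : p ∈ Icc (-1 : ℝ) 1 ×ˢ Icc (-1 : ℝ) 1) :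
    |halfAngleFormSnd (θ, φ) p| ≤ 10 * (√(1 - Real.cos ((θ - φ) / 2)) +
      √(Real.sin (θ / 2) * Real.sin (φ / 2)) * (1 - p.1) +
      √(Real.cos (θ / 2) * Real.cos (φ / 2)) * (1 - p.2)) := by
  have h := abs_halfAngleFormFst_le hφ hθ hp
  rw [halfAngleFormSnd_eq_swap]
  rwa [show (φ - θ) / 2 = -((θ - φ) / 2) by ring, Real.cos_neg,
    mul_comm (Real.sin (φ / 2)), mul_comm (Real.cos (φ / 2))] at h

theorem abs_halfAngleFormFstFst_le_one (x : ℝ × ℝ) {p : ℝ × ℝ}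
    (hp : p ∈ Icc (-1 : ℝ) 1 ×ˢ Icc (-1 : ℝ) 1) : |halfAngleFormFstFst x p| ≤ 1 := by
  have h : ∀ u c d : ℝ, |u| ≤ 1 → |c| ≤ 1 → |d| ≤ 1 → |u * (c * d)| ≤ 1 := fun u c d hu hc hd => by
    rw [abs_mul, abs_mul]
    exact mul_le_one₀ hu (by positivity) (mul_le_one₀ hc (abs_nonneg _) hd)
  have h3 := h _ _ _ (abs_le.2 hp.1) (Real.abs_sin_le_one (x.1 / 2)) (Real.abs_sin_le_one (x.2 / 2))
  have h4 := h _ _ _ (abs_le.2 hp.2) (Real.abs_cos_le_one (x.1 / 2)) (Real.abs_cos_le_one (x.2 / 2))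
  rw [halfAngleFormFstFst, abs_div, abs_of_pos (by norm_num : (0 : ℝ) < 4),
    div_le_one (by norm_num)]
  exact (abs_add_le _ _).trans (by linarith)

theorem abs_halfAngleFormFstSnd_le_one (x : ℝ × ℝ) {p : ℝ × ℝ}
    (hp : p ∈ Icc (-1 : ℝ) 1 ×ˢ Icc (-1 : ℝ) 1) : |halfAngleFormFstSnd x p| ≤ 1 := by
  have h : ∀ u c d : ℝ, |u| ≤ 1 → |c| ≤ 1 → |d| ≤ 1 → |u * (c * d)| ≤ 1 := fun u c d hu hc hd => by
    rw [abs_mul, abs_mul]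
    exact mul_le_one₀ hu (by positivity) (mul_le_one₀ hc (abs_nonneg _) hd)
  have h3 := h _ _ _ (abs_le.2 hp.1) (Real.abs_cos_le_one (x.1 / 2)) (Real.abs_cos_le_one (x.2 / 2))
  have h4 := h _ _ _ (abs_le.2 hp.2) (Real.abs_sin_le_one (x.1 / 2)) (Real.abs_sin_le_one (x.2 / 2))
  rw [halfAngleFormFstSnd, abs_div, abs_neg, abs_of_pos (by norm_num : (0 : ℝ) < 4),
    div_le_one (by norm_num)]
  exact (abs_add_le _ _).trans (by linarith)

/-! ### Measures of balls -/

/-- In the ball, sin(η/2) ≤ √X + d, and squaring gives at most 2X + 2d² ≤ 2X + 40D. -/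
theorem sin_half_sq_le {θ φ η : ℝ} (hθ : θ ∈ Ioo 0 Real.pi) (hφ : φ ∈ Ioo 0 Real.pi)
    (hη : η ∈ Ioo 0 Real.pi) (h : |η - θ| ≤ |θ - φ|) :
    Real.sin (η / 2) ^ 2 ≤ 40 * (Real.sin (θ / 2) * Real.sin (φ / 2) +
      (1 - Real.cos ((θ - φ) / 2))) := by
  have hS := sin_half_pos hθ
  have hS' := sin_half_pos hφ
  have h1 := le_sqrt_mul_add hS' hS (by rw [abs_sub_comm]; exact abs_sin_half_sub_le θ φ)
  have h2 := (abs_le.1 (abs_sin_half_sub_le η θ)).2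
  have h3 := sq_le_mul_one_sub_cos_half hθ hφ
  have h4 := Real.sq_sqrt (mul_pos hS' hS).le
  have h5 := Real.sqrt_nonneg (Real.sin (φ / 2) * Real.sin (θ / 2))
  have hη0 := sin_half_pos hη
  rw [mul_comm (Real.sin (θ / 2))]
  have h6 : Real.sin (η / 2) ≤ √(Real.sin (φ / 2) * Real.sin (θ / 2)) + |θ - φ| := by linarith
  have h7 := pow_le_pow_left₀ hη0.le h6 2
  nlinarith [sq_nonneg (√(Real.sin (φ / 2) * Real.sin (θ / 2)) - |θ - φ|)]

theorem cos_half_sq_le {θ φ η : ℝ} (hθ : θ ∈ Ioo 0 Real.pi) (hφ : φ ∈ Ioo 0 Real.pi)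
    (hη : η ∈ Ioo 0 Real.pi) (h : |η - θ| ≤ |θ - φ|) :
    Real.cos (η / 2) ^ 2 ≤ 40 * (Real.cos (θ / 2) * Real.cos (φ / 2) +
      (1 - Real.cos ((θ - φ) / 2))) := by
  have hS := cos_half_pos hθ
  have hS' := cos_half_pos hφ
  have h1 := le_sqrt_mul_add hS' hS (by rw [abs_sub_comm]; exact abs_cos_half_sub_le θ φ)
  have h2 := (abs_le.1 (abs_cos_half_sub_le η θ)).2
  have h3 := sq_le_mul_one_sub_cos_half hθ hφ
  have h4 := Real.sq_sqrt (mul_pos hS' hS).le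
  have h5 := Real.sqrt_nonneg (Real.cos (φ / 2) * Real.cos (θ / 2))
  have hη0 := cos_half_pos hη
  rw [mul_comm (Real.cos (θ / 2))]
  have h6 : Real.cos (η / 2) ≤ √(Real.cos (φ / 2) * Real.cos (θ / 2)) + |θ - φ| := by linarith
  have h7 := pow_le_pow_left₀ hη0.le h6 2
  nlinarith [sq_nonneg (√(Real.cos (φ / 2) * Real.cos (θ / 2)) - |θ - φ|)]

/-- Since the exponents 2α + 1 and 2β + 1 are positive, the density is bounded on the ball by its
value at the largest sine and cosine, and the length is at most 2d. Only the upper bound matters for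
the theorem; positivity permits the division. -/
theorem jacobiMeasure_ball_pos_and_le {α β : ℝ} (hα : -(1 / 2) < α) (hβ : -(1 / 2) < β)
    {θ φ : ℝ} (hθ : θ ∈ Ioo 0 Real.pi) (hφ : φ ∈ Ioo 0 Real.pi) (hne : θ ≠ φ) :
    0 < (jacobiMeasure α β).real (Metric.ball θ |θ - φ|) ∧
    (jacobiMeasure α β).real (Metric.ball θ |θ - φ|) ≤
      2 * 40 ^ (α + 1 / 2) * 40 ^ (β + 1 / 2) * (|θ - φ| *
        ((Real.sin (θ / 2) * Real.sin (φ / 2) + (1 - Real.cos ((θ - φ) / 2))) ^ (α + 1 / 2) *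
        (Real.cos (θ / 2) * Real.cos (φ / 2) + (1 - Real.cos ((θ - φ) / 2))) ^ (β + 1 / 2))) := by
  have hd : 0 < |θ - φ| := abs_pos.2 (sub_ne_zero.2 hne)
  have hD := one_sub_cos_half_sub_pos hθ hφ hne
  have hX := sin_half_mul_pos hθ hφ
  have hY := cos_half_mul_pos hθ hφ
  have hs : 0 < α + 1 / 2 := by linarith
  have hs' : 0 < β + 1 / 2 := by linarith
  have hsin := fun η hη => sin_half_sq_le (η := η) hθ hφ hη
  have hcos := fun η hη => cos_half_sq_le (η := η) hθ hφ hη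
  set d := |θ - φ|
  set D := 1 - Real.cos ((θ - φ) / 2)
  set X := Real.sin (θ / 2) * Real.sin (φ / 2)
  set Y := Real.cos (θ / 2) * Real.cos (φ / 2)
  set B := Metric.ball θ d ∩ Ioo 0 Real.pi with hB
  have hBm : MeasurableSet B := Metric.isOpen_ball.measurableSet.inter measurableSet_Ioo
  set f : ℝ → ℝ := fun η => Real.sin (η / 2) ^ (2 * α + 1) * Real.cos (η / 2) ^ (2 * β + 1) with hf
  have hval : jacobiMeasure α β (Metric.ball θ d) = ∫⁻ η in B, ENNReal.ofReal (f η) := by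
    rw [jacobiMeasure, withDensity_apply _ Metric.isOpen_ball.measurableSet,
      Measure.restrict_restrict Metric.isOpen_ball.measurableSet]
  set K := (40 * (X + D)) ^ (α + 1 / 2) * (40 * (Y + D)) ^ (β + 1 / 2) with hK
  have hK0 : 0 < K := by positivity
  have hle : ∀ η ∈ B, f η ≤ K := fun η hη => by
    have h1 := hsin η hη.2 (by
      have := Metric.mem_ball.1 hη.1
      rw [Real.dist_eq] at this
      exact this.le)
    have h2 := hcos η hη.2 (by
      have := Metric.mem_ball.1 hη.1
      rw [Real.dist_eq] at this
      exact this.le)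
    have h3 := sin_half_pos hη.2
    have h4 := cos_half_pos hη.2
    have e1 : Real.sin (η / 2) ^ (2 * α + 1) = (Real.sin (η / 2) ^ 2) ^ (α + 1 / 2) := by
      rw [← Real.rpow_two, ← Real.rpow_mul h3.le]; ring_nf
    have e2 : Real.cos (η / 2) ^ (2 * β + 1) = (Real.cos (η / 2) ^ 2) ^ (β + 1 / 2) := by
      rw [← Real.rpow_two, ← Real.rpow_mul h4.le]; ring_nf
    simp only [hf]
    rw [e1, e2]
    exact mul_le_mul (Real.rpow_le_rpow (by positivity) h1 hs.le)
      (Real.rpow_le_rpow (by positivity) h2 hs'.le) (by positivity) (by positivity)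
  have hupper : jacobiMeasure α β (Metric.ball θ d) ≤ ENNReal.ofReal (K * (2 * d)) := by
    rw [hval]
    calc ∫⁻ η in B, ENNReal.ofReal (f η) ≤ ∫⁻ _ in B, ENNReal.ofReal K :=
          setLIntegral_mono measurable_const fun η hη => ENNReal.ofReal_le_ofReal (hle η hη)
      _ = ENNReal.ofReal K * volume B := by rw [setLIntegral_const]
      _ ≤ ENNReal.ofReal K * volume (Metric.ball θ d) := by
          gcongr
          exact inter_subset_left
      _ = _ := by rw [Real.volume_ball, ← ENNReal.ofReal_mul hK0.le]
  have hlower : jacobiMeasure α β (Metric.ball θ d) ≠ 0 := by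
    have hfm : Measurable fun η => ENNReal.ofReal (f η) := by fun_prop
    rw [hval]
    refine ((setLIntegral_pos_iff hfm).2 ?_).ne'
    refine ((Metric.isOpen_ball.inter isOpen_Ioo).measure_pos volume
      ⟨θ, Metric.mem_ball_self hd, hθ⟩).trans_le (measure_mono fun η hη => ⟨?_, hη⟩)
    have h3 := sin_half_pos hη.2
    have h4 := cos_half_pos hη.2
    refine (ENNReal.ofReal_pos.2 ?_).ne'
    simp only [hf]
    positivity
  constructor
  · exact ENNReal.toReal_pos hlower (hupper.trans_lt ENNReal.ofReal_lt_top).ne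
  · refine (ENNReal.toReal_le_of_le_ofReal (by positivity) hupper).trans_eq ?_
    rw [hK, Real.mul_rpow (by norm_num) (by positivity), Real.mul_rpow (by norm_num) (by positivity)]
    ring

end


/-! ### The conjugated kernel and the final estimates. -/

noncomputable section

theorem hasDerivAt_uWeight (a b : ℝ) (j : ℕ) {θ : ℝ} (hθ : θ ∈ Ioo 0 Real.pi) :
    HasDerivAt (uWeight a b j) ((a * j * (Real.cos (θ / 2) / Real.sin (θ / 2)) -
      b * j * (Real.sin (θ / 2) / Real.cos (θ / 2))) / 2 * uWeight a b j θ) θ := by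
  have hS := sin_half_pos hθ
  have hC := cos_half_pos hθ
  have h1 := ((hasDerivAt_id θ).div_const 2).sin.rpow_const (p := a * j) (Or.inl hS.ne')
  have h2 := ((hasDerivAt_id θ).div_const 2).cos.rpow_const (p := b * j) (Or.inl hC.ne')
  refine (h1.fun_mul h2).congr_deriv ?_
  simp only [id, uWeight]
  rw [Real.rpow_sub_one hS.ne', Real.rpow_sub_one hC.ne']
  field_simp
  ring

/-- The weights are differentiated through their logarithmic derivatives, so that u_j(θ) u_j(φ)
factors out of the whole gradient and can be merged with the constant. -/
theorem hasFDerivAt_conjRieszKernel {α β a b : ℝ} {j : ℕ} (hA : -(1 / 2) < α + a * j)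
    (hB : -(1 / 2) < β + b * j) {θ φ : ℝ} (hx : (θ, φ) ∈ offDiagonal) :
    HasFDerivAt (fun p : ℝ × ℝ => conjRieszKernel α β a b j p.1 p.2)
      ((-2 * poissonConst (α + a * j) (β + b * j) * (uWeight a b j θ * uWeight a b j φ)) •
        (((a * j * (Real.cos (θ / 2) / Real.sin (θ / 2)) -
            b * j * (Real.sin (θ / 2) / Real.cos (θ / 2))) / 2 *
          (∫ p, halfAngleFormFst (θ, φ) p * halfAngleForm (θ, φ) p ^
            (-(α + a * j + (β + b * j) + 2))
            ∂ultraProd (α + a * j + 1 / 2) (β + b * j + 1 / 2)) +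
          ∫ p, (halfAngleFormFstFst (θ, φ) p * halfAngleForm (θ, φ) p ^
              (-(α + a * j + (β + b * j) + 2)) -
            (α + a * j + (β + b * j) + 2) * (halfAngleFormFst (θ, φ) p *
              halfAngleFormFst (θ, φ) p * halfAngleForm (θ, φ) p ^
              (-(α + a * j + (β + b * j) + 2) - 1)))
            ∂ultraProd (α + a * j + 1 / 2) (β + b * j + 1 / 2)) •
          ContinuousLinearMap.fst ℝ ℝ ℝ +
        ((a * j * (Real.cos (φ / 2) / Real.sin (φ / 2)) -
            b * j * (Real.sin (φ / 2) / Real.cos (φ / 2))) / 2 *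
          (∫ p, halfAngleFormFst (θ, φ) p * halfAngleForm (θ, φ) p ^
            (-(α + a * j + (β + b * j) + 2))
            ∂ultraProd (α + a * j + 1 / 2) (β + b * j + 1 / 2)) +
          ∫ p, (halfAngleFormFstSnd (θ, φ) p * halfAngleForm (θ, φ) p ^
              (-(α + a * j + (β + b * j) + 2)) -
            (α + a * j + (β + b * j) + 2) * (halfAngleFormFst (θ, φ) p *
              halfAngleFormSnd (θ, φ) p * halfAngleForm (θ, φ) p ^
              (-(α + a * j + (β + b * j) + 2) - 1)))
            ∂ultraProd (α + a * j + 1 / 2) (β + b * j + 1 / 2)) •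
          ContinuousLinearMap.snd ℝ ℝ ℝ)) (θ, φ) := by
  have hG := hasFDerivAt_integral_halfAngleFormFst_mul (s := α + a * j + 1 / 2)
    (s' := β + b * j + 1 / 2) (by linarith) (by linarith) (α + a * j + (β + b * j) + 2) hx
  have hu₁ : HasFDerivAt (fun p : ℝ × ℝ => uWeight a b j p.1) _ (θ, φ) :=
    HasDerivAt.comp_hasFDerivAt (f := Prod.fst) (θ, φ) (hasDerivAt_uWeight a b j hx.1.1)
      (hasFDerivAt_fst (𝕜 := ℝ) (p := (θ, φ)))
  have hu₂ : HasFDerivAt (fun p : ℝ × ℝ => uWeight a b j p.2) _ (θ, φ) :=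
    HasDerivAt.comp_hasFDerivAt (f := Prod.snd) (θ, φ) (hasDerivAt_uWeight a b j hx.1.2)
      (hasFDerivAt_snd (𝕜 := ℝ) (p := (θ, φ)))
  have h := (hu₁.fun_mul hu₂).fun_mul
    (hG.const_mul (-2 * poissonConst (α + a * j) (β + b * j)))
  refine (h.congr_of_eventuallyEq ?_).congr_fderiv ?_
  · filter_upwards [isOpen_offDiagonal.mem_nhds hx] with y hy
    rw [conjRieszKernel, jacobiRieszKernel_eq hA hB (θ := y.1) (φ := y.2) hy]
  · ext
    · simp only [ContinuousLinearMap.coe_comp, Function.comp_apply, ContinuousLinearMap.inl_apply,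
        add_apply, smul_apply, ContinuousLinearMap.coe_fst', ContinuousLinearMap.coe_snd',
        smul_eq_mul, mul_one, mul_zero, add_zero, zero_add]
      ring
    · simp only [ContinuousLinearMap.coe_comp, Function.comp_apply, ContinuousLinearMap.inr_apply,
        add_apply, smul_apply, ContinuousLinearMap.coe_fst', ContinuousLinearMap.coe_snd',
        smul_eq_mul, mul_one, mul_zero, add_zero, zero_add]
      ring

/-- All dependence on j is sorted into one normalizing factor per variable and one Gamma factor for
the exponent, exactly the normalization of `jacobiMoment`. -/
theorem poissonConst_mul_uWeight {α β a b : ℝ} {j : ℕ} {θ φ : ℝ} (hθ : θ ∈ Ioo 0 Real.pi)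
    (hφ : φ ∈ Ioo 0 Real.pi) :
    2 * poissonConst (α + a * j) (β + b * j) * (uWeight a b j θ * uWeight a b j φ) =
      2 * 2 ^ (-(α + β + 1)) / Real.pi *
        (((Real.sin (θ / 2) * Real.sin (φ / 2)) ^ (a * j) /
            (2 ^ (a * j) * Real.Gamma (a * j + (α + 1 / 2)))) *
          ((Real.cos (θ / 2) * Real.cos (φ / 2)) ^ (b * j) /
            (2 ^ (b * j) * Real.Gamma (b * j + (β + 1 / 2)))) *
          Real.Gamma (a * j + b * j + (α + 1 / 2) + (β + 1 / 2) + 1)) := by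
  have hS := sin_half_pos hθ
  have hC := cos_half_pos hθ
  have hS' := sin_half_pos hφ
  have hC' := cos_half_pos hφ
  rw [poissonConst, uWeight, uWeight, Real.mul_rpow hS.le hS'.le, Real.mul_rpow hC.le hC'.le,
    show α + a * j + 1 / 2 = a * j + (α + 1 / 2) by ring,
    show β + b * j + 1 / 2 = b * j + (β + 1 / 2) by ring,
    show α + a * j + (β + b * j) + 2 = a * j + b * j + (α + 1 / 2) + (β + 1 / 2) + 1 by ring,
    show -(α + a * j + (β + b * j) + 1) = -(α + β + 1) - a * j - b * j by ring,
    Real.rpow_sub two_pos, Real.rpow_sub two_pos]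
  ring

theorem abs_logDeriv_le {N M S C : ℝ} (hN : 0 ≤ N) (hM : 0 ≤ M) (hS : 0 < S) (hC : 0 < C)
    (hS1 : S ≤ 1) (hC1 : C ≤ 1) :
    |(N * (C / S) - M * (S / C)) / 2| ≤ N * (1 / S) + M * (1 / C) := by
  have h1 : N * (C / S) ≤ N * (1 / S) := by gcongr
  have h2 : M * (S / C) ≤ M * (1 / C) := by gcongr
  have h3 : 0 ≤ N * (C / S) := by positivity
  have h4 : 0 ≤ M * (S / C) := by positivity
  rw [abs_le]
  constructor <;> linarith

theorem gradLength_le_of_hasFDerivAt {F : ℝ → ℝ → ℝ} {c g₁ g₂ θ φ : ℝ}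
    (h : HasFDerivAt (fun p : ℝ × ℝ => F p.1 p.2)
      (c • (g₁ • ContinuousLinearMap.fst ℝ ℝ ℝ + g₂ • ContinuousLinearMap.snd ℝ ℝ ℝ)) (θ, φ)) :
    gradLength F θ φ ≤ |c * g₁| + |c * g₂| := by
  have d₁ : deriv (fun t => F t φ) θ = _ :=
    (HasFDerivAt.comp_hasDerivAt (f := fun t => (t, φ)) θ h
      ((hasDerivAt_id θ).prodMk (hasDerivAt_const θ φ))).deriv
  have d₂ : deriv (fun t => F θ t) φ = _ :=
    (HasFDerivAt.comp_hasDerivAt (f := fun t => (θ, t)) φ h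
      ((hasDerivAt_const φ θ).prodMk (hasDerivAt_id φ))).deriv
  rw [gradLength, d₁, d₂]
  simp only [add_apply, smul_apply, ContinuousLinearMap.coe_fst', ContinuousLinearMap.coe_snd',
    smul_eq_mul, mul_one, mul_zero, add_zero, zero_add]
  refine Real.sqrt_le_iff.2 ⟨by positivity, ?_⟩
  nlinarith [sq_abs (c * g₁), sq_abs (c * g₂), mul_nonneg (abs_nonneg (c * g₁)) (abs_nonneg (c * g₂))]

theorem exists_conjRieszKernel_le {α β a b : ℝ} (hα : -(1 / 2) < α) (hβ : -(1 / 2) < β)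
    (ha : 1 ≤ a) (hb : b = 0 ∨ 1 ≤ b) :
    ∃ C, 0 < C ∧ ∀ j : ℕ, ∀ θ ∈ Ioo 0 Real.pi, ∀ φ ∈ Ioo 0 Real.pi, θ ≠ φ →
      ((Real.sin (θ / 2) * Real.sin (φ / 2) + (1 - Real.cos ((θ - φ) / 2))) ^ (α + 1 / 2) *
        (Real.cos (θ / 2) * Real.cos (φ / 2) + (1 - Real.cos ((θ - φ) / 2))) ^ (β + 1 / 2)) *
        |conjRieszKernel α β a b j θ φ| ≤ C / |θ - φ| ∧
      DifferentiableAt ℝ (fun p : ℝ × ℝ => conjRieszKernel α β a b j p.1 p.2) (θ, φ) ∧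
      ((Real.sin (θ / 2) * Real.sin (φ / 2) + (1 - Real.cos ((θ - φ) / 2))) ^ (α + 1 / 2) *
        (Real.cos (θ / 2) * Real.cos (φ / 2) + (1 - Real.cos ((θ - φ) / 2))) ^ (β + 1 / 2)) *
        gradLength (conjRieszKernel α β a b j) θ φ ≤ C / |θ - φ| ^ 2 := by
  have hs : 0 < α + 1 / 2 := by linarith
  have hs' : 0 < β + 1 / 2 := by linarith
  obtain ⟨C, hC, h⟩ := exists_majorant_le hs hs'
  set c₀ : ℝ := 2 * 2 ^ (-(α + β + 1)) / Real.pi with hc₀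
  have hc₀0 : 0 < c₀ := by have := Real.pi_pos; positivity
  -- Each partial derivative costs 10 C from the weight and 300 C from the integral; there are two
  -- of them.
  refine ⟨c₀ * (620 * C), by positivity, fun j θ hθ φ hφ hne => ?_⟩
  have hj : (j : ℝ) = 0 ∨ 1 ≤ (j : ℝ) := by
    rcases Nat.eq_zero_or_pos j with h | h
    · left; exact_mod_cast h
    · right; exact_mod_cast h
  have hN : a * j = 0 ∨ 1 ≤ a * j := by
    rcases hj with h | h
    · left; rw [h, mul_zero]
    · right; nlinarith
  have hM : b * j = 0 ∨ 1 ≤ b * j := by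
    rcases hb with h | hb
    · left; rw [h, zero_mul]
    · rcases hj with h | h
      · left; rw [h, mul_zero]
      · right; nlinarith
  have hN0 : 0 ≤ a * j := by rcases hN with h | h <;> linarith
  have hM0 : 0 ≤ b * j := by rcases hM with h | h <;> linarith
  have hx : (θ, φ) ∈ offDiagonal := ⟨⟨hθ, hφ⟩, hne⟩
  have hA : -(1 / 2) < α + a * j := by linarith
  have hB : -(1 / 2) < β + b * j := by linarith
  have hd : 0 < |θ - φ| := abs_pos.2 (sub_ne_zero.2 hne)
  have hdD := sq_le_mul_one_sub_cos_half hθ hφ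
  have hD := one_sub_cos_half_sub_pos hθ hφ hne
  have hX := sin_half_mul_pos hθ hφ
  have hY := cos_half_mul_pos hθ hφ
  have hS := sin_half_pos hθ
  have hT := cos_half_pos hθ
  have hS' := sin_half_pos hφ
  have hT' := cos_half_pos hφ
  have hfd := hasFDerivAt_conjRieszKernel hA hB hx
  have hK : conjRieszKernel α β a b j θ φ = -(2 * poissonConst (α + a * j) (β + b * j) *
      (uWeight a b j θ * uWeight a b j φ)) * ∫ p, halfAngleFormFst (θ, φ) p *
        halfAngleForm (θ, φ) p ^ (-(α + a * j + (β + b * j) + 2))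
        ∂ultraProd (α + a * j + 1 / 2) (β + b * j + 1 / 2) := by
    rw [conjRieszKernel, jacobiRieszKernel_eq hA hB hx]
    ring
  rw [show -2 * poissonConst (α + a * j) (β + b * j) * (uWeight a b j θ * uWeight a b j φ) =
    -(2 * poissonConst (α + a * j) (β + b * j) * (uWeight a b j θ * uWeight a b j φ)) by ring]
    at hfd
  rw [poissonConst_mul_uWeight hθ hφ, show α + a * j + 1 / 2 = a * j + (α + 1 / 2) by ring,
    show β + b * j + 1 / 2 = b * j + (β + 1 / 2) by ring,
    show α + a * j + (β + b * j) + 2 = a * j + b * j + (α + 1 / 2) + (β + 1 / 2) + 1 by ring]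
    at hfd hK
  simp_rw [halfAngleForm_eq] at hfd hK
  obtain ⟨k₁, k₂, k₃⟩ := h hN hM hX hY hD hd hdD
    (one_div_le_or hS hS' hd (abs_sin_half_sub_le θ φ) hdD)
    (one_div_le_or hT hT' hd (abs_cos_half_sub_le θ φ) hdD)
  -- The derivative in φ needs the weighted estimate with the sine and cosine of φ/2.
  obtain ⟨_, k₂', _⟩ := h hN hM hX hY hD hd hdD
    (S := Real.sin (φ / 2)) (T := Real.cos (φ / 2))
    (by
      rw [mul_comm (Real.sin (θ / 2))]
      exact one_div_le_or hS' hS hd (by rw [abs_sub_comm]; exact abs_sin_half_sub_le θ φ) hdD)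
    (by
      rw [mul_comm (Real.cos (θ / 2))]
      exact one_div_le_or hT' hT hd (by rw [abs_sub_comm]; exact abs_cos_half_sub_le θ φ) hdD)
  have hG := abs_integral_le_firstMajorant hs hs' hN0 hM0 hX hY hD
    (f := fun p => halfAngleFormFst (θ, φ) p) fun p hp => abs_halfAngleFormFst_le hθ hφ hp
  have hG₁ := abs_integral_le_secondMajorant hs hs' hN0 hM0 hX hY hD (by norm_num)
    (f := fun p => halfAngleFormFst (θ, φ) p) (g := fun p => halfAngleFormFst (θ, φ) p)
    (h := fun p => halfAngleFormFstFst (θ, φ) p)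
    (fun p hp => abs_halfAngleFormFst_le hθ hφ hp) (fun p hp => abs_halfAngleFormFst_le hθ hφ hp)
    (fun p hp => abs_halfAngleFormFstFst_le_one _ hp)
  have hG₂ := abs_integral_le_secondMajorant hs hs' hN0 hM0 hX hY hD (by norm_num)
    (f := fun p => halfAngleFormFst (θ, φ) p) (g := fun p => halfAngleFormSnd (θ, φ) p)
    (h := fun p => halfAngleFormFstSnd (θ, φ) p)
    (fun p hp => abs_halfAngleFormFst_le hθ hφ hp) (fun p hp => abs_halfAngleFormSnd_le hθ hφ hp)
    (fun p hp => abs_halfAngleFormFstSnd_le_one _ hp)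
  have hF := firstMajorant_nonneg hs hs' hN0 hM0 hX.le hY.le hD.le
  have hc := abs_logDeriv_le hN0 hM0 hS hT (Real.sin_le_one _) (Real.cos_le_one _)
  have hc' := abs_logDeriv_le hN0 hM0 hS' hT' (Real.sin_le_one _) (Real.cos_le_one _)
  have hGA := Real.Gamma_pos_of_pos (by linarith : 0 < a * j + (α + 1 / 2))
  have hGB := Real.Gamma_pos_of_pos (by linarith : 0 < b * j + (β + 1 / 2))
  have hGl := Real.Gamma_pos_of_pos
    (by linarith : 0 < a * j + b * j + (α + 1 / 2) + (β + 1 / 2) + 1)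
  set X := Real.sin (θ / 2) * Real.sin (φ / 2)
  set Y := Real.cos (θ / 2) * Real.cos (φ / 2)
  set D := 1 - Real.cos ((θ - φ) / 2)
  set d := |θ - φ|
  set P := X ^ (a * j) / (2 ^ (a * j) * Real.Gamma (a * j + (α + 1 / 2))) *
    (Y ^ (b * j) / (2 ^ (b * j) * Real.Gamma (b * j + (β + 1 / 2)))) *
    Real.Gamma (a * j + b * j + (α + 1 / 2) + (β + 1 / 2) + 1) with hP
  have hP0 : 0 < P := by positivity
  set w := (X + D) ^ (α + 1 / 2) * (Y + D) ^ (β + 1 / 2)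
  have hw0 : 0 < w := by positivity
  set F₁ := firstMajorant (α + 1 / 2) (β + 1 / 2) (a * j) (b * j) X Y D
  set F₂ := secondMajorant (α + 1 / 2) (β + 1 / 2) (a * j) (b * j) X Y D
  have hpart : ∀ {c e G G' : ℝ}, |c| ≤ e → P * |G| ≤ 10 * F₁ → P * |G'| ≤ 3 * 10 ^ 2 * F₂ →
      w * (e * F₁) ≤ C / d ^ 2 → w * |-(c₀ * P) * (c * G + G')| ≤ c₀ * (310 * C) / d ^ 2 := by
    intro c e G G' hce hG hG' hwe
    have he : 0 ≤ e := (abs_nonneg _).trans hce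
    rw [abs_mul, abs_neg, abs_of_pos (mul_pos hc₀0 hP0)]
    calc w * (c₀ * P * |c * G + G'|) ≤ w * (c₀ * P * (|c| * |G| + |G'|)) := by
          gcongr
          exact (abs_add_le _ _).trans_eq (by rw [abs_mul])
      _ = c₀ * (w * (|c| * (P * |G|)) + w * (P * |G'|)) := by ring
      _ ≤ c₀ * (w * (e * (10 * F₁)) + w * (3 * 10 ^ 2 * F₂)) := by gcongr
      _ = c₀ * (10 * (w * (e * F₁)) + 300 * (w * F₂)) := by ring
      _ ≤ c₀ * (10 * (C / d ^ 2) + 300 * (C / d ^ 2)) := by gcongr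
      _ = _ := by ring
  refine ⟨?_, hfd.differentiableAt, ?_⟩
  · rw [hK, abs_mul, abs_neg, abs_of_pos (mul_pos hc₀0 hP0)]
    refine (le_of_eq (by ring)).trans ((mul_le_mul_of_nonneg_left
      (mul_le_mul_of_nonneg_left hG hw0.le) hc₀0.le).trans ?_)
    calc c₀ * (w * (10 * F₁)) = c₀ * (10 * (w * F₁)) := by ring
      _ ≤ c₀ * (10 * (C / d)) := by gcongr
      _ = c₀ * (10 * C) / d := by ring
      _ ≤ _ := div_le_div_of_nonneg_right (mul_le_mul_of_nonneg_left (by linarith) hc₀0.le) hd.le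
  · have p₁ := hpart hc hG hG₁ k₂
    have p₂ := hpart hc' hG hG₂ k₂'
    refine (mul_le_mul_of_nonneg_left (gradLength_le_of_hasFDerivAt hfd) hw0.le).trans ?_
    rw [mul_add]
    refine (add_le_add p₁ p₂).trans_eq ?_
    ring

end

theorem theorem5 (α β a b : ℝ) (hα : -(1 / 2) < α) (hβ : -(1 / 2) < β) (ha : 1 ≤ a)
    (hb : b = 0 ∨ 1 ≤ b) :
    -- the kernels are well defined off the diagonal
    (∀ j : ℕ, ∀ θ ∈ Ioo 0 Real.pi, ∀ φ ∈ Ioo 0 Real.pi, θ ≠ φ →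
      (∀ t : ℝ, 0 < t →
        Summable (jacobiPoissonTerm (α + a * j) (β + b * j) t θ φ) ∧
        DifferentiableAt ℝ
          (fun s => jacobiPoissonKernel (α + a * j) (β + b * j) t s φ) θ) ∧
      IntegrableOn
        (fun t => deriv (fun s => jacobiPoissonKernel (α + a * j) (β + b * j) t s φ) θ)
        (Ioi 0)) ∧
    -- growth and smoothness estimates, with constants independent of `j`
    ∃ C₁ C₂ : ℝ, ∀ j : ℕ, ∀ θ ∈ Ioo 0 Real.pi, ∀ φ ∈ Ioo 0 Real.pi, θ ≠ φ →
      |conjRieszKernel α β a b j θ φ| ≤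
        C₁ / (jacobiMeasure α β).real (Metric.ball θ |θ - φ|) ∧
      DifferentiableAt ℝ (fun p : ℝ × ℝ => conjRieszKernel α β a b j p.1 p.2) (θ, φ) ∧
      gradLength (conjRieszKernel α β a b j) θ φ ≤
        C₂ / (|θ - φ| * (jacobiMeasure α β).real (Metric.ball θ |θ - φ|)) := by
  constructor
  · intro j θ hθ φ hφ hne
    have hA : -(1 / 2) < α + a * j := by
      have : 0 ≤ a * j := mul_nonneg (by linarith) j.cast_nonneg
      linarith
    have hB : -(1 / 2) < β + b * j := by
      have : 0 ≤ b * j := mul_nonneg (by rcases hb with h | h <;> linarith) j.cast_nonneg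
      linarith
    exact ⟨fun t ht => ⟨(hasSum_jacobiPoissonTerm hA hB hθ hφ ht).summable,
      (hasDerivAt_jacobiPoissonKernel hA hB hθ hφ ht).differentiableAt⟩,
      integrableOn_deriv_jacobiPoissonKernel hA hB ⟨⟨hθ, hφ⟩, hne⟩⟩
  · obtain ⟨C, hC, h⟩ := exists_conjRieszKernel_le hα hβ ha hb
    refine ⟨2 * 40 ^ (α + 1 / 2) * 40 ^ (β + 1 / 2) * C,
      2 * 40 ^ (α + 1 / 2) * 40 ^ (β + 1 / 2) * C, fun j θ hθ φ hφ hne => ?_⟩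
    have hd : 0 < |θ - φ| := abs_pos.2 (sub_ne_zero.2 hne)
    obtain ⟨hμ0, hμ⟩ := jacobiMeasure_ball_pos_and_le hα hβ hθ hφ hne
    obtain ⟨h₁, h₂, h₃⟩ := h j θ hθ φ hφ hne
    generalize (jacobiMeasure α β).real (Metric.ball θ |θ - φ|) = μ at *
    generalize (Real.sin (θ / 2) * Real.sin (φ / 2) + (1 - Real.cos ((θ - φ) / 2))) ^
      (α + 1 / 2) * (Real.cos (θ / 2) * Real.cos (φ / 2) + (1 - Real.cos ((θ - φ) / 2))) ^
      (β + 1 / 2) = w at *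
    have hK : (0 : ℝ) < 2 * 40 ^ (α + 1 / 2) * 40 ^ (β + 1 / 2) := by positivity
    generalize (2 : ℝ) * 40 ^ (α + 1 / 2) * 40 ^ (β + 1 / 2) = K at *
    refine ⟨?_, h₂, ?_⟩
    · rw [le_div_iff₀ hμ0]
      rw [le_div_iff₀ hd] at h₁
      calc _ ≤ |conjRieszKernel α β a b j θ φ| * (K * (|θ - φ| * w)) := by gcongr
        _ = K * (w * |conjRieszKernel α β a b j θ φ| * |θ - φ|) := by ring
        _ ≤ _ := by gcongr
    · have hg : 0 ≤ gradLength (conjRieszKernel α β a b j) θ φ := Real.sqrt_nonneg _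
      rw [le_div_iff₀ (by positivity)]
      rw [le_div_iff₀ (by positivity)] at h₃
      calc _ ≤ gradLength (conjRieszKernel α β a b j) θ φ * (|θ - φ| * (K * (|θ - φ| * w))) := by
            gcongr
        _ = K * (w * gradLength (conjRieszKernel α β a b j) θ φ * |θ - φ| ^ 2) := by ring
        _ ≤ _ := by gcongr
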